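/- Let $(E,[\cdot,\cdot]_E,\sigma)$ be a Lie algebroid of rank $m$ over a smooth manifold $M$ with bundle projection $\pi:E\to M$. Let $\mathcal TE\to E$ be its prolongation, with fibres $\mathcal T_wE=\{(u,v)\in E_{\pi(w)}\times T_wE:\ \sigma(u)=T_w\pi(v)\}$, with its Lie algebroid bracket $[\cdot,\cdot]_{\mathcal TE}$ and anchor $\sigma^1(u,v)=v$. Let $J(u,v)=(0,u^v_w)$ be the vertical endomorphism, where $u^v_w\in T_wE$ is the vertical lift of $u$, and let $\mathbb C(w)=(0,w^v_w)$ be the Euler section. Let $\mathcal S$ be a semispray, that is, a smooth section of $\mathcal TE$ over $E\setminus\{0\}$ with $J\mathcal S=\mathbb C$. A smooth section $X$ of $\mathcal TE$ over $E\setminus\{0\}$ is a dynamical symmetry of $\mathcal S$ if $[\mathcal S,X]_{\mathcal TE}=0$, and it is Newtonoid if $J[\mathcal S,X]_{\mathcal TE}=0$. A nonlinear connection is a smooth bundle morphism $\mathcal N$ of $\mathcal TE$ over $E\setminus\{0\}$ with $\mathcal N^2=\mathrm{Id}$ and $\ker(\mathrm{Id}+\mathcal N)=\{(0,v)\in\mathcal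 TE\}$. Put $\mathrm h=\frac12(\mathrm{Id}+\mathcal N)$, $\mathrm v=\frac12(\mathrm{Id}-\mathcal N)$, $\mathcal L_{\mathcal S}=[\mathcal S,\cdot]_{\mathcal TE}$, $\nabla=\mathrm h\circ\mathcal L_{\mathcal S}\circ\mathrm h+\mathrm v\circ\mathcal L_{\mathcal S}\circ\mathrm v$ (the dynamical covariant derivative) and $\Phi=-\mathrm v\circ(\mathcal L_{\mathcal S}\circ\mathrm v-\mathrm v\circ\mathcal L_{\mathcal S})$ (the Jacobi endomorphism). (a) For an arbitrary nonlinear connection, a smooth section $X$ of $\mathcal TE$ over $E\setminus\{0\}$ is a dynamical symmetry of $\mathcal S$ if and only if $X$ is Newtonoid and $\nabla(J\nabla X)+\Phi(X)=0$. (b) $\mathcal N=-\mathcal L_{\mathcal S}J=-(\mathcal L_{\mathcal S}\circ J-J\circ\mathcal L_{\mathcal S})$ is a nonlinear connection (the canonical one). With this connection, $X$ is a dynamical symmetry of $\mathcal S$ if and only if $X$ is Newtonoid and $\nabla^2JX+\Phi(X)=0$. (c) Let $\mathcal N$ be the canonical nonlinear connection and let $(s_\alpha)_{\alpha=1}^m$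 be a smooth local frame of $E$ over an open set $U\subseteq M$, with fibre coordinates $y^\alpha$, structure functions $[s_\alpha,s_\beta]_E=L^\gamma_{\alpha\beta}s_\gamma$, and induced local frame $\mathcal X_\alpha=(s_\alpha\circ\pi,\sigma^i_\alpha\,\partial/\partial x^i)$, $\mathcal V_\alpha=(0,\partial/\partial y^\alpha)$ of $\mathcal TE$. Write $X=X^\alpha\mathcal X_\alpha+Y^\alpha\mathcal V_\alpha$, $\mathcal N(\mathcal X_\beta)=\mathcal X_\beta-2\mathcal N^\alpha_\beta\mathcal V_\alpha$ and $\Phi(\mathcal X_\beta)=\mathcal R^\alpha_\beta\mathcal V_\alpha$. For an $m$-tuple of functions $f^\alpha$ put $\nabla f^\alpha=\sigma^1(\mathcal S)(f^\alpha)+(\mathcal N^\alpha_\beta+y^\varepsilon L^\alpha_{\varepsilon\beta})f^\beta$. Then over $\pi^{-1}(U)\setminus\{0\}$ $$\nabla^2JX+\Phi(X)=\bigl(\nabla^2X^\alpha+\mathcal R^\alpha_\beta X^\beta\bigr)\mathcal V_\alpha .$$ Hence $X$ is a dynamical symmetry of $\mathcal S$ if and only if it is Newtonoid and $\nabla^2X^\alpha+\mathcal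 R^\alpha_\beta X^\beta=0$ for all $\alpha$ in every local frame. -/

import Mathlib

open Bundle Filter Topology
open scoped Manifold ContDiff

noncomputable section

/-- The standard fibre of a vector bundle of rank `m`. -/
abbrev FibreModel (m : ℕ) : Type := EuclideanSpace ℝ (Fin m)

/-- The model with corners of the total space of a rank `m` vector bundle over an
`n`-dimensional manifold. -/
abbrev totalModel (n m : ℕ) :
    ModelWithCorners ℝ (EuclideanSpace ℝ (Fin n) × FibreModel m)
      (ModelProd (EuclideanSpace ℝ (Fin n)) (FibreModel m)) :=
  (𝓡 n).prod 𝓘(ℝ, FibreModel m)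

/-- The derivative `v f` of a function `f : N → ℝ` on a manifold along a tangent vector `v`. -/
def tangentDeriv {V H N : Type*} [NormedAddCommGroup V] [NormedSpace ℝ V] [TopologicalSpace H]
    (I : ModelWithCorners ℝ V H) [TopologicalSpace N] [ChartedSpace H N]
    (f : N → ℝ) {x : N} (v : TangentSpace I x) : ℝ :=
  mfderiv I 𝓘(ℝ, ℝ) f x v

/-- A Lie algebroid structure on the smooth vector bundle `E → M`: a Lie algebra structure on the
space `Γ(E)` of smooth sections and a smooth bundle map `E → TM` (the anchor) inducing a Lie
algebra homomorphism into the vector fields and satisfying the Leibniz rule. -/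
structure LieAlgebroid (n m : ℕ) {M : Type*} [TopologicalSpace M]
    [ChartedSpace (EuclideanSpace ℝ (Fin n)) M] [IsManifold (𝓡 n) ∞ M]
    (E : M → Type*) [∀ x, AddCommGroup (E x)] [∀ x, Module ℝ (E x)]
    [∀ x, TopologicalSpace (E x)] [TopologicalSpace (TotalSpace (FibreModel m) E)]
    [FiberBundle (FibreModel m) E] [VectorBundle ℝ (FibreModel m) E]
    [ContMDiffVectorBundle ∞ (FibreModel m) E (𝓡 n)] where
  /-- the bracket `[s, t]_E`, an `ℝ`-bilinear operation on smooth sections -/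
  bracket : Cₛ^∞⟮𝓡 n; FibreModel m, E⟯ →ₗ[ℝ] Cₛ^∞⟮𝓡 n; FibreModel m, E⟯ →ₗ[ℝ]
    Cₛ^∞⟮𝓡 n; FibreModel m, E⟯
  /-- the anchor `σ` -/
  anchor : ∀ x : M, E x →ₗ[ℝ] TangentSpace (𝓡 n) x
  skew : ∀ s t, bracket s t = -bracket t s
  jacobi : ∀ s t r,
    bracket s (bracket t r) + bracket t (bracket r s) + bracket r (bracket s t) = 0
  contMDiff_anchor : ContMDiff (totalModel n m) (𝓡 n).tangent ∞
    (fun u : TotalSpace (FibreModel m) E => (⟨u.proj, anchor u.proj u.2⟩ : TangentBundle (𝓡 n) M))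
  anchor_bracket : ∀ (s t : Cₛ^∞⟮𝓡 n; FibreModel m, E⟯) (x : M),
    anchor x (bracket s t x) =
      VectorField.mlieBracket (𝓡 n) (fun y => anchor y (s y)) (fun y => anchor y (t y)) x
  /-- `[s, f t] = f [s, t] + (σ(s) f) t` for `f ∈ C^∞(M)`; here `ft` is the section `f t` -/
  leibniz : ∀ (s t ft : Cₛ^∞⟮𝓡 n; FibreModel m, E⟯) (f : M → ℝ), ContMDiff (𝓡 n) 𝓘(ℝ, ℝ) ∞ f →
    (∀ x, ft x = f x • t x) → ∀ x,
      bracket s ft x = f x • bracket s t x +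
        tangentDeriv (𝓡 n) f (anchor x (s x)) • t x

namespace LieAlgebroid

variable {n m : ℕ} {M : Type*} [TopologicalSpace M]
  [ChartedSpace (EuclideanSpace ℝ (Fin n)) M] [IsManifold (𝓡 n) ∞ M]
  {E : M → Type*} [∀ x, AddCommGroup (E x)] [∀ x, Module ℝ (E x)]
  [∀ x, TopologicalSpace (E x)] [TopologicalSpace (TotalSpace (FibreModel m) E)]
  [FiberBundle (FibreModel m) E] [VectorBundle ℝ (FibreModel m) E]
  [ContMDiffVectorBundle ∞ (FibreModel m) E (𝓡 n)]

/-! ### The bracket on local sections -/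

open Classical in
/-- A global smooth section of `E` with the same germ at `x` as `s`; it exists whenever `s` is
smooth near `x` (and `M` is Hausdorff), and is `0` by convention otherwise. -/
def globalExtension (n : ℕ) {m : ℕ} {M : Type*} [TopologicalSpace M]
    [ChartedSpace (EuclideanSpace ℝ (Fin n)) M]
    {E : M → Type*} [∀ x, AddCommGroup (E x)] [∀ x, Module ℝ (E x)]
    [∀ x, TopologicalSpace (E x)] [TopologicalSpace (TotalSpace (FibreModel m) E)]
    [FiberBundle (FibreModel m) E] [VectorBundle ℝ (FibreModel m) E]
    (s : ∀ x, E x) (x : M) : Cₛ^∞⟮𝓡 n; FibreModel m, E⟯ :=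
  if h : ∃ t : Cₛ^∞⟮𝓡 n; FibreModel m, E⟯, ∀ᶠ y in 𝓝 x, t y = s y then h.choose else 0

/-- The value at `x` of the bracket of two local sections defined and smooth near `x`. As the
bracket of a Lie algebroid is a local operation, the chosen extensions do not matter. -/
def localBracket (A : LieAlgebroid n m E) (s t : ∀ x, E x) (x : M) : E x :=
  A.bracket (globalExtension n s x) (globalExtension n t x) x

/-! ### The prolongation `𝒯E` -/

/-- The tangent map at `w ∈ E` of the bundle projection `π : E → M`. -/
def tangentProj (_A : LieAlgebroid n m E) (w : TotalSpace (FibreModel m) E) :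
    TangentSpace (totalModel n m) w →L[ℝ] TangentSpace (𝓡 n) w.proj :=
  mfderiv (totalModel n m) (𝓡 n) (TotalSpace.proj : TotalSpace (FibreModel m) E → M) w

/-- The fibre `𝒯_w E = {(u, v) ∈ E_{π w} × T_w E | σ(u) = T_w π (v)}` of the prolongation. -/
def Prol (A : LieAlgebroid n m E) (w : TotalSpace (FibreModel m) E) :
    Submodule ℝ (E w.proj × TangentSpace (totalModel n m) w) :=
  LinearMap.eqLocus
    ((A.anchor w.proj).comp (LinearMap.fst ℝ (E w.proj) (TangentSpace (totalModel n m) w)))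
    ((A.tangentProj w).toLinearMap.comp
      (LinearMap.snd ℝ (E w.proj) (TangentSpace (totalModel n m) w)))

/-- Possibly non-smooth sections of `𝒯E → E`. As a local section is only relevant on the open set
where it is smooth, its values elsewhere are arbitrary. -/
abbrev ProlSection (A : LieAlgebroid n m E) := ∀ w : TotalSpace (FibreModel m) E, A.Prol w

variable (A : LieAlgebroid n m E)

/-- The complement `E \ {0}` of the zero section. -/
def slit : Set (TotalSpace (FibreModel m) E) := {w | w.2 ≠ 0}

/-- Smoothness of a section `w ↦ (u w, v w)` of `𝒯E` on a set `Ω ⊆ E`: both components are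
smooth. -/
def SmoothOn (Z : A.ProlSection) (Ω : Set (TotalSpace (FibreModel m) E)) : Prop :=
  ContMDiffOn (totalModel n m) (totalModel n m) ∞
    (fun w => (⟨w.proj, (Z w).1.1⟩ : TotalSpace (FibreModel m) E)) Ω ∧
  ContMDiffOn (totalModel n m) (totalModel n m).tangent ∞
    (fun w => (⟨w, (Z w).1.2⟩ : TangentBundle (totalModel n m) (TotalSpace (FibreModel m) E))) Ω

open Classical in
/-- The pair `p` as an element of `𝒯_w E`, and `0` by convention if it does not lie in `𝒯_w E`. -/
def toProl (w : TotalSpace (FibreModel m) E)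
    (p : E w.proj × TangentSpace (totalModel n m) w) : A.Prol w :=
  if h : p ∈ A.Prol w then ⟨p, h⟩ else 0

/-- The components of the bracket of two sections `Z = (a, V)` and `W = (b, U)` of `𝒯E` at `w`.
The second one is the bracket `[V, U]` of vector fields on `E`. For the first one, write
`a = ∑ aᵅ (s_α ∘ π)` and `b = ∑ bᵅ (s_α ∘ π)` in a local frame `s_α` of `E`
(namely the one given by the preferred trivialization at `π w`); it is
`∑ aᵅ bᵝ [s_α, s_β]_E + ∑ (V(bᵝ) - U(aᵝ)) s_β`. -/
def bracketPair (Z W : A.ProlSection) (w : TotalSpace (FibreModel m) E) :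
    E w.proj × TangentSpace (totalModel n m) w :=
  let e := trivializationAt (FibreModel m) E w.proj
  let a : TotalSpace (FibreModel m) E → FibreModel m := fun w' => (e ⟨w'.proj, (Z w').1.1⟩).2
  let b : TotalSpace (FibreModel m) E → FibreModel m := fun w' => (e ⟨w'.proj, (W w').1.1⟩).2
  let dbV : FibreModel m := mfderiv (totalModel n m) 𝓘(ℝ, FibreModel m) b w (Z w).1.2
  let daU : FibreModel m := mfderiv (totalModel n m) 𝓘(ℝ, FibreModel m) a w (W w).1.2
  (A.localBracket (fun x => e.symm x (a w)) (fun x => e.symm x (b w)) w.proj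
      + e.symm w.proj (dbV - daU),
    VectorField.mlieBracket (totalModel n m) (fun w' => (Z w').1.2) (fun w' => (W w').1.2) w)

/-- The bracket `[Z, W]_{𝒯E}` of sections of the prolongation; for sections that are smooth near
`w` the pair of components always lies in `𝒯_w E`. -/
def prolBracket (Z W : A.ProlSection) : A.ProlSection := fun w => A.toProl w (A.bracketPair Z W w)

/-- The vertical lift `u_w^v ∈ T_w E` of `u ∈ E_{π w}`: the velocity at `0` of `t ↦ w + t u`
(a vector based at `w + 0 u = w`). -/
def verticalLift (w : TotalSpace (FibreModel m) E) (u : E w.proj) :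
    TangentSpace (totalModel n m) w :=
  show TangentSpace (totalModel n m)
      (⟨w.proj, w.2 + (0 : ℝ) • u⟩ : TotalSpace (FibreModel m) E) from
    mfderiv 𝓘(ℝ, ℝ) (totalModel n m)
      (fun t : ℝ => (⟨w.proj, w.2 + t • u⟩ : TotalSpace (FibreModel m) E)) 0 (1 : ℝ)

theorem tangentProj_verticalLift (w : TotalSpace (FibreModel m) E) (u : E w.proj) :
    A.tangentProj w (verticalLift w u) = 0 := by
  by_cases hc : MDifferentiableAt 𝓘(ℝ, ℝ) (totalModel n m)
      (fun t : ℝ => (⟨w.proj, w.2 + t • u⟩ : TotalSpace (FibreModel m) E)) 0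
  · have hw : (⟨w.proj, w.2 + (0 : ℝ) • u⟩ : TotalSpace (FibreModel m) E) = w := by simp
    have hp : HasMFDerivAt (totalModel n m) (𝓡 n)
        (TotalSpace.proj : TotalSpace (FibreModel m) E → M)
        (⟨w.proj, w.2 + (0 : ℝ) • u⟩ : TotalSpace (FibreModel m) E) (A.tangentProj w) := by
      rw [hw]
      exact ((contMDiff_proj (n := ∞) E).mdifferentiable (by simp) w).hasMFDerivAt
    have h1 := hp.comp (0 : ℝ) hc.hasMFDerivAt
    have h2 : HasMFDerivAt 𝓘(ℝ, ℝ) (𝓡 n) (fun _ : ℝ => w.proj) 0 0 := hasMFDerivAt_const _ _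
    have h3 := hasMFDerivAt_unique h1 h2
    exact congrArg (fun L => L (1 : ℝ)) h3
  · have h : verticalLift (n := n) w u = 0 := by
      unfold verticalLift
      rw [mfderiv_zero_of_not_mdifferentiableAt hc]
      rfl
    rw [h, map_zero]

/-- `(0, u_w^v)` as an element of `𝒯_w E`. -/
def prolVertical (w : TotalSpace (FibreModel m) E) (u : E w.proj) : A.Prol w :=
  ⟨(0, verticalLift w u), by
    change A.anchor w.proj 0 = A.tangentProj w (verticalLift w u)
    rw [map_zero, A.tangentProj_verticalLift]⟩

/-- The Euler section `ℂ(w) = (0, w_w^v)`. -/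
def euler : A.ProlSection := fun w => A.prolVertical w w.2

/-- The vertical endomorphism (tangent structure) `J(u, v) = (0, u_w^v)` of `𝒯E`. -/
def tangentStructure (Z : A.ProlSection) : A.ProlSection := fun w => A.prolVertical w (Z w).1.1

/-- A semispray: a smooth section `S` of `𝒯E` over `E \ {0}` with `J(S) = ℂ`. -/
def IsSemispray (S : A.ProlSection) : Prop :=
  A.SmoothOn S (slit (m := m)) ∧ ∀ w ∈ slit (m := m), A.tangentStructure S w = A.euler w

/-- `X` is a dynamical symmetry of `S`: `[S, X] = 0` on `E \ {0}`. -/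
def IsDynamicalSymmetry (S X : A.ProlSection) : Prop :=
  ∀ w ∈ slit (m := m), A.prolBracket S X w = 0

/-- `X` is a Newtonoid section: `J[S, X] = 0` on `E \ {0}`. -/
def IsNewtonoid (S X : A.ProlSection) : Prop :=
  ∀ w ∈ slit (m := m), A.tangentStructure (A.prolBracket S X) w = 0

/-! ### Nonlinear connections, Jacobi endomorphism, dynamical covariant derivative -/

/-- A nonlinear connection: a bundle morphism `𝒩 : 𝒯E → 𝒯E` over `E \ {0}` with `𝒩² = Id` and
`ker (Id + 𝒩) = V𝒯E = ker π₁`, smooth in the sense that it maps smooth local sections to smooth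
local sections. (The values over the zero section are irrelevant.) -/
structure NonlinearConnection where
  toFun : ∀ w : TotalSpace (FibreModel m) E, A.Prol w →ₗ[ℝ] A.Prol w
  involutive : ∀ w ∈ slit (m := m), ∀ z : A.Prol w, toFun w (toFun w z) = z
  vertical : ∀ w ∈ slit (m := m), ∀ z : A.Prol w, z + toFun w z = 0 ↔ z.1.1 = 0
  smooth : ∀ Ω : Set (TotalSpace (FibreModel m) E), IsOpen Ω → Ω ⊆ slit (m := m) →
    ∀ Z : A.ProlSection, A.SmoothOn Z Ω → A.SmoothOn (fun w => toFun w (Z w)) Ω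

namespace NonlinearConnection

variable {A}
variable (N : A.NonlinearConnection)

/-- The horizontal projector `h = ½ (Id + 𝒩)`. -/
def hor (Z : A.ProlSection) : A.ProlSection := fun w => (1 / 2 : ℝ) • (Z w + N.toFun w (Z w))

/-- The vertical projector `v = ½ (Id - 𝒩)`. -/
def ver (Z : A.ProlSection) : A.ProlSection := fun w => (1 / 2 : ℝ) • (Z w - N.toFun w (Z w))

/-- The Jacobi endomorphism `Φ = -v ∘ ℒ_S v`, where
`(ℒ_S v)(Z) = [S, v Z] - v [S, Z]`. -/
def jacobiEndomorphism (S Z : A.ProlSection) : A.ProlSection :=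
  -N.ver (A.prolBracket S (N.ver Z) - N.ver (A.prolBracket S Z))

/-- The dynamical covariant derivative `∇ = h ∘ ℒ_S ∘ h + v ∘ ℒ_S ∘ v` on sections. -/
def nabla (S Z : A.ProlSection) : A.ProlSection :=
  N.hor (A.prolBracket S (N.hor Z)) + N.ver (A.prolBracket S (N.ver Z))

/-- `𝒩 = -ℒ_S J`, i.e. `𝒩(Z) = -([S, J Z] - J [S, Z])` for all local sections `Z` over open
subsets of `E \ {0}`: `𝒩` is the canonical nonlinear connection induced by `S`. -/
def IsCanonical (S : A.ProlSection) : Prop :=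
  ∀ Ω : Set (TotalSpace (FibreModel m) E), IsOpen Ω → Ω ⊆ slit (m := m) →
    ∀ Z : A.ProlSection, A.SmoothOn Z Ω → ∀ w ∈ Ω, N.toFun w (Z w) =
      -(A.prolBracket S (A.tangentStructure Z) w - A.tangentStructure (A.prolBracket S Z) w)

end NonlinearConnection

/-! ### Local expressions

Here `s_α` is a smooth local frame of `E` over an open set `U ⊆ M`. -/

section Local

variable {U : Set M} {s : Fin m → ∀ x, E x}

/-- The fibre coordinate `yᵅ` on `π⁻¹(U)` given by the frame. -/
def fibreCoord (hs : IsLocalFrameOn (𝓡 n) (FibreModel m) ∞ s U) (α : Fin m)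
    (w : TotalSpace (FibreModel m) E) : ℝ :=
  hs.coeff α w.proj w.2

/-- The structure functions `L^γ_{αβ}`: `[s_α, s_β]_E = L^γ_{αβ} s_γ`. -/
def structureFunction (hs : IsLocalFrameOn (𝓡 n) (FibreModel m) ∞ s U) (γ α β : Fin m) (x : M) :
    ℝ :=
  hs.coeff γ x (A.localBracket (s α) (s β) x)

/-- The local section `𝒳_α(w) = (s_α(π w), σ_αⁱ ∂/∂xⁱ|_w)`. The second component is the image of
`σ(s_α)` under the tangent map of the section `∑ yᵝ(w) s_β`, whose fibre coordinates are
constant. -/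
def frameX (hs : IsLocalFrameOn (𝓡 n) (FibreModel m) ∞ s U) (α : Fin m) : A.ProlSection :=
  fun w => A.toProl w (s α w.proj,
    show TangentSpace (totalModel n m)
        (⟨w.proj, ∑ β, fibreCoord hs β w • s β w.proj⟩ : TotalSpace (FibreModel m) E) from
      mfderiv (𝓡 n) (totalModel n m)
        (fun x => (⟨x, ∑ β, fibreCoord hs β w • s β x⟩ : TotalSpace (FibreModel m) E)) w.proj
        (A.anchor w.proj (s α w.proj)))

/-- The local section `𝒱_α(w) = (0, ∂/∂yᵅ|_w)`, the vertical lift of `s_α`. -/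
def frameV (s : Fin m → ∀ x, E x) (α : Fin m) : A.ProlSection :=
  fun w => A.prolVertical w (s α w.proj)

/-- The derivative `Z(f) = σ¹(Z) f` of a function on `E` along a section of `𝒯E`. -/
def deriv (Z : A.ProlSection) (f : TotalSpace (FibreModel m) E → ℝ) :
    TotalSpace (FibreModel m) E → ℝ :=
  fun w => tangentDeriv (totalModel n m) f (Z w).1.2

/-- The component `Zᵅ` in `Z = Zᵅ 𝒳_α + Yᵅ 𝒱_α`. -/
def coordX (hs : IsLocalFrameOn (𝓡 n) (FibreModel m) ∞ s U) (Z : A.ProlSection) (α : Fin m) :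
    TotalSpace (FibreModel m) E → ℝ :=
  fun w => hs.coeff α w.proj (Z w).1.1

/-- The component `Yᵅ = 𝒱ᵅ(Z) = dyᵅ(Z)` in `Z = Zᵅ 𝒳_α + Yᵅ 𝒱_α`. -/
def coordV (hs : IsLocalFrameOn (𝓡 n) (FibreModel m) ∞ s U) (Z : A.ProlSection) (α : Fin m) :
    TotalSpace (FibreModel m) E → ℝ :=
  A.deriv Z (fibreCoord hs α)

namespace NonlinearConnection

variable {A}
variable (N : A.NonlinearConnection)

/-- The local coefficients `𝒩_β^α` of the connection: `𝒩(𝒳_β) = 𝒳_β - 2 𝒩_β^α 𝒱_α`. -/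
def coefficient (hs : IsLocalFrameOn (𝓡 n) (FibreModel m) ∞ s U) (α β : Fin m) :
    TotalSpace (FibreModel m) E → ℝ :=
  fun w => -(1 / 2) * A.coordV hs (fun w' => N.toFun w' (A.frameX hs β w')) α w

/-- The local coefficients `ℛ_β^α` of the Jacobi endomorphism: `Φ(𝒳_β) = ℛ_β^α 𝒱_α`. -/
def jacobiCoefficient (S : A.ProlSection) (hs : IsLocalFrameOn (𝓡 n) (FibreModel m) ∞ s U)
    (α β : Fin m) : TotalSpace (FibreModel m) E → ℝ :=
  A.coordV hs (N.jacobiEndomorphism S (A.frameX hs β)) α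

/-- The operator `∇fᵅ = S(fᵅ) + (𝒩_β^α + y^ε L^α_{εβ}) fᵝ` on `m`-tuples of functions. -/
def nablaLocal (S : A.ProlSection) (hs : IsLocalFrameOn (𝓡 n) (FibreModel m) ∞ s U)
    (f : Fin m → TotalSpace (FibreModel m) E → ℝ) : Fin m → TotalSpace (FibreModel m) E → ℝ :=
  fun α w => A.deriv S (f α) w +
    ∑ β, (N.coefficient hs α β w +
      ∑ ε, fibreCoord hs ε w * A.structureFunction hs α ε β w.proj) * f β w

/-- The left-hand side `∇²Xᵅ + ℛ_β^α Xᵝ` of the local equation of dynamical symmetries. -/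
def symmetryEquation (S X : A.ProlSection) (hs : IsLocalFrameOn (𝓡 n) (FibreModel m) ∞ s U)
    (α : Fin m) : TotalSpace (FibreModel m) E → ℝ :=
  fun w => N.nablaLocal S hs (N.nablaLocal S hs (A.coordX hs X)) α w +
    ∑ β, N.jacobiCoefficient S hs α β w * A.coordX hs X β w

end NonlinearConnection

end Local

end LieAlgebroid

end

/-! The argument rests on one identity: J[S,V] = -V for vertical V
(`IsSemispray.tangentStructure_prolBracket`). The first components of a semispray are the fibre
coordinates y^γ, so the first components of [S,V] are S(0) - V(y^γ), up to structure-function terms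
that vanish with the first components of V. Since J kills vertical sections and J ∘ h = J, it
follows that J∇X = J[S,X] - J[S,vX] = vX + J[S,X].

On vertical sections ∇ is v ∘ ℒ_S, and v² = v gives Φ(X) = v[S,X] - v[S,vX]. The terms v[S,vX]
cancel, so for every nonlinear connection ∇(J∇X) + Φ(X) = v[S,X] + v[S, J[S,X]]
(`nabla_tangentStructure_nabla_add`). If X is Newtonoid, the last term vanishes and [S,X] is
vertical, so the right-hand side is [S,X] itself. This is (a).

For the canonical connection [S,JX] = J[S,X] - 𝒩X. Applying v, with v𝒩 = -v, gives ∇JX = J[S,X] + vX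
= J∇X, so the equation in (b) is the one in (a). The connection exists because in coordinates -ℒ_S J
keeps the first components z^γ and sends the vertical ones z'^γ to C^γ(z) - z'^γ, where C^γ is
linear and sees only the first component of z. Such a map is an involution which is -1 exactly on
vertical vectors.

For (c), JX is vertical with coordinates X^α, ∇ acts on the coordinates of a vertical section by
`nablaLocal` (`IsCanonical.prolV_nabla`), and Φ is tensorial and kills vertical sections, so it is
given by its coefficients ℛ.

Most of the work goes into making the bracket of 𝒯E usable. It is defined pointwise, from the
preferred trivialization and from chosen global extensions of germs. The bracket of E is shown to be
local by a cut-off argument. Then the bracket of 𝒯E is expressed in an arbitrary frame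
(`bracketPair_fst`) and shown to take values in 𝒯E (`bracketPair_mem`). What remains are the
formulas `coordX_prolBracket` and `coordV_prolBracket`. Together with the fact that 2m coordinates
separate points of a fibre (`prol_ext`), they yield the Leibniz rule, smoothness and the local
expressions. -/

set_option linter.unusedSectionVars false

noncomputable section

/-! ### Derivatives along vector fields on a manifold, and the commutator formula -/

section DirectionalDerivative

variable {V H N F : Type*} [NormedAddCommGroup V] [NormedSpace ℝ V] [TopologicalSpace H]
  {I : ModelWithCorners ℝ V H} [TopologicalSpace N] [ChartedSpace H N]
  [NormedAddCommGroup F] [NormedSpace ℝ F]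

/-- The derivative of a vector valued function, with values in the vector space itself instead of
its tangent space. -/
def dirD (I : ModelWithCorners ℝ V H) (f : N → F) (x : N) : TangentSpace I x →L[ℝ] F :=
  mfderiv I 𝓘(ℝ, F) f x

theorem tangentDeriv_eq_dirD (f : N → ℝ) {x : N} (v : TangentSpace I x) :
    tangentDeriv I f v = dirD I f x v := rfl

theorem dirD_congr {f g : N → F} {x : N} (h : f =ᶠ[𝓝 x] g) : dirD I f x = dirD I g x :=
  h.mfderiv_eq

theorem dirD_const (c : F) (x : N) : dirD I (fun _ : N => c) x = 0 := mfderiv_const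

theorem dirD_sum {ι : Type} (t : Finset ι) {f : ι → N → F} {x : N}
    (hf : ∀ i ∈ t, MDifferentiableAt I 𝓘(ℝ, F) (f i) x) :
    dirD I (fun y => ∑ i ∈ t, f i y) x = ∑ i ∈ t, dirD I (f i) x := by
  have h0 : ∀ i ∈ t, HasMFDerivAt I 𝓘(ℝ, F) (f i) x (dirD I (f i) x) :=
    fun i hi => (hf i hi).hasMFDerivAt
  have h := (HasMFDerivAt.sum h0).mfderiv
  have h' : (fun y => ∑ i ∈ t, f i y) = ∑ i ∈ t, f i := by ext; simp
  rw [h']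
  exact h

theorem dirD_clm {G : Type*} [NormedAddCommGroup G] [NormedSpace ℝ G] (L : F →L[ℝ] G) {f : N → F}
    {x : N} (hf : MDifferentiableAt I 𝓘(ℝ, F) f x) :
    dirD I (fun y => L (f y)) x = L.comp (dirD I f x) :=
  (L.hasMFDerivAt.comp x hf.hasMFDerivAt).mfderiv

theorem dirD_smul_apply {f : N → ℝ} {g : N → F} {x : N} (hf : MDifferentiableAt I 𝓘(ℝ, ℝ) f x)
    (hg : MDifferentiableAt I 𝓘(ℝ, F) g x) (v : TangentSpace I x) :
    dirD I (fun y => f y • g y) x v = f x • dirD I g x v + dirD I f x v • g x := by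
  have h : HasMFDerivAt I 𝓘(ℝ, F) (fun y => f y • g y) x
      (f x • dirD I g x + (dirD I f x).smulRight (g x) : V →L[ℝ] F) := by
    refine ⟨ContinuousAt.smul hf.continuousAt hg.continuousAt, ?_⟩
    have := hf.hasMFDerivAt.2.smul hg.hasMFDerivAt.2
    simpa [writtenInExtChartAt] using! this
  exact congrArg (fun L => L v) h.mfderiv

theorem dirD_mul_apply {f : N → ℝ} {g : N → ℝ} {x : N} (hf : MDifferentiableAt I 𝓘(ℝ, ℝ) f x)
    (hg : MDifferentiableAt I 𝓘(ℝ, ℝ) g x) (v : TangentSpace I x) :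
    dirD I (fun y => f y * g y) x v = f x * dirD I g x v + dirD I f x v * g x :=
  dirD_smul_apply hf hg v

theorem dirD_comp {V' H' N' : Type*} [NormedAddCommGroup V'] [NormedSpace ℝ V']
    [TopologicalSpace H'] {I' : ModelWithCorners ℝ V' H'} [TopologicalSpace N'] [ChartedSpace H' N']
    {f : N → F} {g : N' → N} {x : N'} (hf : MDifferentiableAt I 𝓘(ℝ, F) f (g x))
    (hg : MDifferentiableAt I' I g x) :
    dirD I' (fun y => f (g y)) x = (dirD I f (g x)).comp (mfderiv I' I g x) :=
  mfderiv_comp x hf hg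

/-- The function is the fibre component of the tangent map of f composed with the section X, and the
tangent bundle of a vector space is globally trivial. -/
theorem contMDiffOn_dirD [IsManifold I ∞ N] {f : N → F} {X : ∀ x : N, TangentSpace I x}
    {O : Set N} (hO : IsOpen O) (hf : ContMDiffOn I 𝓘(ℝ, F) ∞ f O)
    (hX : ContMDiffOn I I.tangent ∞ (fun x => (⟨x, X x⟩ : TangentBundle I N)) O) :
    ContMDiffOn I 𝓘(ℝ, F) ∞ (fun x => dirD I f x (X x)) O := by
  have h1 := hf.contMDiffOn_tangentMapWithin (m := ∞) le_rfl hO.uniqueMDiffOn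
  have h2 := h1.comp hX (fun x hx => hx)
  intro x hx
  have h3 := (contMDiffWithinAt_totalSpace.1 (h2 x hx)).2
  have key : ∀ y ∈ O, dirD I f y (X y) = (trivializationAt F (TangentSpace 𝓘(ℝ, F))
      ((tangentMapWithin I 𝓘(ℝ, F) f O ∘ fun x => ⟨x, X x⟩) x).proj
      ((tangentMapWithin I 𝓘(ℝ, F) f O ∘ fun x => ⟨x, X x⟩) y)).2 := by
    intro y hy
    rw [trivializationAt_model_space_apply]
    simp only [Function.comp_apply, tangentMapWithin, mfderivWithin_of_isOpen hO hy]
    rfl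
  exact h3.congr key (key x hx)

/-- The trivializations of the tangent bundle are by construction the derivatives of the charts.
This turns questions on vector fields into questions on their derivatives of a chart. -/
theorem dirD_extChartAt [IsManifold I ∞ N] {x₀ x : N} (hx : x ∈ (chartAt H x₀).source)
    (v : TangentSpace I x) : dirD I (extChartAt I x₀) x v =
      (trivializationAt V (TangentSpace I) x₀ ⟨x, v⟩).2 := by
  have h := TangentBundle.continuousLinearMapAt_trivializationAt (I := I) hx
  have h' := congrArg (fun L => L v) h
  refine h'.symm.trans ?_
  rw [Trivialization.continuousLinearMapAt_apply,
    Trivialization.linearMapAt_apply, if_pos (by simpa using hx)]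

theorem dirD_extChartAt_injective [IsManifold I ∞ N] {x₀ x : N} (hx : x ∈ (chartAt H x₀).source) :
    Function.Injective (dirD I (extChartAt I x₀) x) := by
  have h := isInvertible_mfderiv_extChartAt (I := I) (x := x₀) (y := x) (by simpa using hx)
  exact h.injective

theorem contMDiffOn_vectorField_of_dirD_extChartAt [IsManifold I ∞ N] {x₀ : N}
    {X : ∀ x : N, TangentSpace I x} {O : Set N} (hO : O ⊆ (chartAt H x₀).source)
    (hX : ContMDiffOn I 𝓘(ℝ, V) ∞ (fun x => dirD I (extChartAt I x₀) x (X x)) O) :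
    ContMDiffOn I I.tangent ∞ (fun x => (⟨x, X x⟩ : TangentBundle I N)) O := by
  intro x hx
  refine (((trivializationAt V (TangentSpace I) x₀).contMDiffWithinAt_section (IB := I) (n := ∞) O
    (s := X) (x₀ := x) (by simpa using hO hx)).2 ?_)
  exact (hX x hx).congr (fun y hy => (dirD_extChartAt (hO hy) _).symm)
    (dirD_extChartAt (hO hx) _).symm

/-- In a chart, X(Yf) = g''(X,Y) + g'(DY·X). Antisymmetrizing removes the symmetric second
derivative and leaves g' applied to DY·X - DX·Y, the bracket in coordinates. This is the only access
to `mlieBracket` that the computations with the second component of 𝒯E need. -/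
theorem dirD_mlieBracket [IsManifold I ∞ N] [I.Boundaryless] [CompleteSpace V] {f : N → F}
    {X Y : ∀ x : N, TangentSpace I x} {O : Set N}
    (hO : IsOpen O) (hf : ContMDiffOn I 𝓘(ℝ, F) ∞ f O)
    (hX : ContMDiffOn I I.tangent ∞ (fun x => (⟨x, X x⟩ : TangentBundle I N)) O)
    (hY : ContMDiffOn I I.tangent ∞ (fun x => (⟨x, Y x⟩ : TangentBundle I N)) O)
    {x : N} (hx : x ∈ O) :
    dirD I f x (VectorField.mlieBracket I X Y x) =
      dirD I (fun y => dirD I f y (Y y)) x (X x) - dirD I (fun y => dirD I f y (X y)) x (Y x) := by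
  have : IsManifold I 1 N := .of_le (n := ∞) (by simp)
  have : IsManifold I 2 N := .of_le (n := ∞) (WithTop.coe_le_coe.2 le_top)
  set φ := extChartAt I x with hφ
  have hsrc : IsOpen (chartAt H x).source := (chartAt H x).open_source
  have hmem : x ∈ (chartAt H x).source := mem_chart_source H x
  have hφs : ContMDiffOn I 𝓘(ℝ, V) ∞ φ (chartAt H x).source := contMDiffOn_extChartAt
  have hφx : φ.symm (φ x) = x := extChartAt_to_inv x
  have hsymm : ContMDiffAt 𝓘(ℝ, V) I ∞ φ.symm (φ x) := by
    have := contMDiffWithinAt_extChartAt_symm_range (I := I) (n := ∞) x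
      (y := φ x) (mem_extChartAt_target x)
    rwa [I.range_eq_univ, contMDiffWithinAt_univ] at this
  let g : V → F := fun z => f (φ.symm z)
  have hg : ContDiffAt ℝ ∞ g (φ x) := by
    rw [← contMDiffAt_iff_contDiffAt]
    refine ContMDiffAt.comp (I' := I) (φ x) (g := f) (f := φ.symm) ?_ hsymm
    rw [hφx]
    exact hf.contMDiffAt (hO.mem_nhds hx)
  let hat (Z : ∀ x : N, TangentSpace I x) : V → V := fun z => dirD I φ (φ.symm z) (Z (φ.symm z))
  have hhat : ∀ Z : ∀ x : N, TangentSpace I x,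
      ContMDiffOn I I.tangent ∞ (fun x => (⟨x, Z x⟩ : TangentBundle I N)) O →
      DifferentiableAt ℝ (hat Z) (φ x) := by
    intro Z hZ
    have h1 := contMDiffOn_dirD (hsrc.inter hO) (hφs.mono Set.inter_subset_left)
      (hZ.mono Set.inter_subset_right)
    have h2 := h1.contMDiffAt ((hsrc.inter hO).mem_nhds ⟨hmem, hx⟩)
    have h3 : ContMDiffAt 𝓘(ℝ, V) 𝓘(ℝ, V) ∞ (hat Z) (φ x) := by
      refine ContMDiffAt.comp (I' := I) (φ x) (g := fun y => dirD I φ y (Z y)) (f := φ.symm) ?_ hsymm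
      rw [hφx]
      exact h2
    exact (contMDiffAt_iff_contDiffAt.1 h3).differentiableAt (by simp)
  -- The field Z is quantified inside the neighbourhood and without smoothness, so that the formula
  -- can later be applied to the bracket itself.
  have hder : ∀ᶠ y in 𝓝 x, ∀ Z : ∀ x : N, TangentSpace I x,
      dirD I f y (Z y) = fderiv ℝ g (φ y) (hat Z (φ y)) := by
    have hev : ∀ᶠ y in 𝓝 x, ContDiffAt ℝ 1 g (φ y) :=
      (continuousAt_extChartAt x).eventually
        ((hg.of_le (m := 1) (by simp)).eventually (by simp))
    filter_upwards [hsrc.mem_nhds hmem, hev] with y hy hgy Z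
    have hy' : y ∈ φ.source := by simpa [hφ] using hy
    have h1 : dirD I f y = dirD I (fun y => g (φ y)) y := by
      refine dirD_congr ?_
      filter_upwards [hsrc.mem_nhds hy] with y' hy''
      simp only [g]
      rw [φ.left_inv (by simpa [hφ] using hy'')]
    have h2 := dirD_comp (I := 𝓘(ℝ, V)) (I' := I) (f := g) (g := φ) (x := y)
      ((hgy.differentiableAt (by simp)).mdifferentiableAt)
      ((hφs.contMDiffAt (hsrc.mem_nhds hy)).mdifferentiableAt (by simp))
    rw [h1, h2]
    simp only [hat]
    rw [φ.left_inv hy']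
    change dirD 𝓘(ℝ, V) g (φ y) _ = _
    unfold dirD
    rw [mfderiv_eq_fderiv]
    rfl
  -- The bracket on a manifold is the pullback of the bracket in the chart, and near φ x the
  -- pulled-back fields are the coordinate representatives `hat`.
  have hbr : dirD I φ x (VectorField.mlieBracket I X Y x) =
      fderiv ℝ (hat Y) (φ x) (hat X (φ x)) - fderiv ℝ (hat X) (φ x) (hat Y (φ x)) := by
    unfold VectorField.mlieBracket
    rw [VectorField.mlieBracketWithin_apply]
    have hinv := isInvertible_mfderiv_extChartAt (I := I) (mem_extChartAt_source (I := I) x)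
    have hval : ∀ u, dirD I φ x ((mfderiv I 𝓘(ℝ, V) φ x).inverse u) = u := by
      intro u
      exact (hinv.inverse_apply_eq (x := (mfderiv I 𝓘(ℝ, V) φ x).inverse u) (y := u)).1 rfl |>.symm
    refine (hval _).trans ?_
    have hpull : ∀ Z : ∀ x : N, TangentSpace I x,
        (fun z => (VectorField.mpullbackWithin 𝓘(ℝ, V) I φ.symm Z (Set.range I) z : V))
          =ᶠ[𝓝 (φ x)] hat Z := by
      intro Z
      filter_upwards [extChartAt_target_mem_nhds (I := I) x] with z hz
      rw [VectorField.mpullbackWithin_apply]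
      refine ((isInvertible_mfderivWithin_extChartAt_symm hz).inverse_apply_eq).2 ?_
      have := mfderivWithin_extChartAt_symm_comp_mfderiv_extChartAt (I := I) hz
      exact (congrArg (fun L => L (Z (φ.symm z))) this).symm
    rw [Set.preimage_univ, Set.univ_inter, I.range_eq_univ]
    have h2 := (hpull X).lieBracket_vectorField_eq (𝕜 := ℝ) (hpull Y)
    rw [I.range_eq_univ] at h2
    exact (congrFun VectorField.lieBracketWithin_univ _).trans h2
  have hsnd : ∀ Z : ∀ x : N, TangentSpace I x,
      ContMDiffOn I I.tangent ∞ (fun x => (⟨x, Z x⟩ : TangentBundle I N)) O →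
      ∀ W : ∀ x : N, TangentSpace I x, dirD I (fun y => dirD I f y (Z y)) x (W x) =
        fderiv ℝ (fderiv ℝ g) (φ x) (hat W (φ x)) (hat Z (φ x)) +
          fderiv ℝ g (φ x) (fderiv ℝ (hat Z) (φ x) (hat W (φ x))) := by
    intro Z hZ W
    have hg' : DifferentiableAt ℝ (fderiv ℝ g) (φ x) :=
      (hg.fderiv_right (m := 1) (WithTop.coe_le_coe.2 le_top)).differentiableAt (by simp)
    have hk : HasFDerivAt (fun z => fderiv ℝ g z (hat Z z)) _ (φ x) :=
      hg'.hasFDerivAt.clm_apply (hhat Z hZ).hasFDerivAt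
    rw [dirD_congr (hder.mono fun y hy => hy Z)]
    rw [dirD_comp (I := 𝓘(ℝ, V)) (f := fun z => fderiv ℝ g z (hat Z z)) (g := φ)
      hk.differentiableAt.mdifferentiableAt
      ((hφs.contMDiffAt (hsrc.mem_nhds hmem)).mdifferentiableAt (by simp))]
    have hW : hat W (φ x) = mfderiv I 𝓘(ℝ, V) φ x (W x) := by
      simp only [hat]
      rw [hφx]
      rfl
    rw [hW]
    change mfderiv 𝓘(ℝ, V) 𝓘(ℝ, F) (fun z => fderiv ℝ g z (hat Z z)) (φ x) _ = _
    rw [mfderiv_eq_fderiv, hk.fderiv]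
    exact add_comm _ _
  have hsymm2 : IsSymmSndFDerivAt ℝ g (φ x) :=
    hg.isSymmSndFDerivAt (by simp [minSmoothness_of_isRCLikeNormedField]; exact WithTop.coe_le_coe.2 le_top)
  rw [hsnd Y hY X, hsnd X hX Y, hsymm2.eq (hat X (φ x)) (hat Y (φ x))]
  have h0 := hder.self_of_nhds (fun y => VectorField.mlieBracket I X Y y)
  rw [h0]
  simp only [hat] at hbr ⊢
  rw [hφx] at hbr ⊢
  rw [hbr, map_sub]
  abel

end DirectionalDerivative

namespace LieAlgebroid

variable {n m : ℕ} {M : Type*} [TopologicalSpace M]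
  [ChartedSpace (EuclideanSpace ℝ (Fin n)) M] [IsManifold (𝓡 n) ∞ M]
  {E : M → Type*} [∀ x, AddCommGroup (E x)] [∀ x, Module ℝ (E x)]
  [∀ x, TopologicalSpace (E x)] [TopologicalSpace (TotalSpace (FibreModel m) E)]
  [FiberBundle (FibreModel m) E] [VectorBundle ℝ (FibreModel m) E]
  [ContMDiffVectorBundle ∞ (FibreModel m) E (𝓡 n)]
  {U : Set M} {s : Fin m → ∀ x, E x}

/-! ### Frames and fibre coordinates -/

/-- The fibre component of a vector in the preferred trivialization at `x₀`. -/
def fibrePart (x₀ : M) (w : TotalSpace (FibreModel m) E) : FibreModel m :=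
  (trivializationAt (FibreModel m) E x₀ w).2

theorem fibrePart_eq {x₀ x : M} (hx : x ∈ (trivializationAt (FibreModel m) E x₀).baseSet)
    (v : E x) : fibrePart x₀ (⟨x, v⟩ : TotalSpace (FibreModel m) E) =
      (trivializationAt (FibreModel m) E x₀).linearMapAt ℝ x v := by
  rw [Trivialization.linearMapAt_apply, if_pos hx]; rfl

theorem fibrePart_sum {x₀ x : M} (hx : x ∈ (trivializationAt (FibreModel m) E x₀).baseSet)
    (c : Fin m → ℝ) (v : Fin m → E x) :
    fibrePart x₀ (⟨x, ∑ α, c α • v α⟩ : TotalSpace (FibreModel m) E) =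
      ∑ α, c α • fibrePart x₀ (⟨x, v α⟩ : TotalSpace (FibreModel m) E) := by
  simp only [fibrePart_eq hx, map_sum, map_smul]

theorem fibrePart_eq_sum (hs : IsLocalFrameOn (𝓡 n) (FibreModel m) ∞ s U) {x₀ x : M}
    (hxU : x ∈ U) (hx : x ∈ (trivializationAt (FibreModel m) E x₀).baseSet) (v : E x) :
    fibrePart x₀ (⟨x, v⟩ : TotalSpace (FibreModel m) E) =
      ∑ α, hs.coeff α x v • fibrePart x₀ (⟨x, s α x⟩ : TotalSpace (FibreModel m) E) := by
  rw [← fibrePart_sum hx]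
  have := (hs.toBasisAt hxU).sum_repr v
  simp only [hs.toBasisAt_coe] at this
  simp only [IsLocalFrameOn.coeff, hxU, dif_pos, Module.Basis.coord_apply, this]

theorem coeff_frame (hs : IsLocalFrameOn (𝓡 n) (FibreModel m) ∞ s U) {x : M} (hx : x ∈ U)
    (α β : Fin m) : hs.coeff α x (s β x) = if β = α then 1 else 0 := by
  simp only [IsLocalFrameOn.coeff, hx, dif_pos, Module.Basis.coord_apply]
  rw [← hs.toBasisAt_coe hx, Module.Basis.repr_self, Finsupp.single_apply]

theorem sum_coeff_smul (hs : IsLocalFrameOn (𝓡 n) (FibreModel m) ∞ s U) {x : M} (hx : x ∈ U)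
    (v : E x) : ∑ α, hs.coeff α x v • s α x = v := by
  have := (hs.toBasisAt hx).sum_repr v
  simp only [hs.toBasisAt_coe] at this
  simpa only [IsLocalFrameOn.coeff, hx, dif_pos, Module.Basis.coord_apply] using this

theorem coeff_sum (hs : IsLocalFrameOn (𝓡 n) (FibreModel m) ∞ s U) {x : M} (hx : x ∈ U)
    (c : Fin m → ℝ) (α : Fin m) : hs.coeff α x (∑ β, c β • s β x) = c α := by
  simp [map_sum, coeff_frame hs hx]

theorem eq_of_coeff_eq (hs : IsLocalFrameOn (𝓡 n) (FibreModel m) ∞ s U) {x : M} (hx : x ∈ U)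
    {v v' : E x} (h : ∀ α, hs.coeff α x v = hs.coeff α x v') : v = v' := by
  rw [← sum_coeff_smul hs hx v, ← sum_coeff_smul hs hx v']
  simp only [h]

theorem contMDiffAt_fibrePart_section {x₀ x : M} {t : ∀ x, E x}
    (hx : x ∈ (trivializationAt (FibreModel m) E x₀).baseSet)
    (ht : ContMDiffAt (𝓡 n) (totalModel n m) ∞
      (fun x => (⟨x, t x⟩ : TotalSpace (FibreModel m) E)) x) :
    ContMDiffAt (𝓡 n) 𝓘(ℝ, FibreModel m) ∞
      (fun x => fibrePart x₀ (⟨x, t x⟩ : TotalSpace (FibreModel m) E)) x :=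
  ((trivializationAt (FibreModel m) E x₀).contMDiffAt_section_iff hx).1 ht

theorem contMDiffAt_fibrePart {x₀ : M} {w : TotalSpace (FibreModel m) E}
    (hw : w.proj ∈ (trivializationAt (FibreModel m) E x₀).baseSet) :
    ContMDiffAt (totalModel n m) 𝓘(ℝ, FibreModel m) ∞ (fibrePart x₀) w :=
  ((trivializationAt (FibreModel m) E x₀).contMDiffAt_iff (IB := 𝓡 n) (n := ∞)
    (f := fun w : TotalSpace (FibreModel m) E => w)
    ((trivializationAt (FibreModel m) E x₀).mem_source.2 hw)).1 contMDiffAt_id |>.2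

/-- The coordinates of a vector are obtained by applying to its fibre part the inverse of the frame
matrix in a trivialization. The matrix depends smoothly on the base point, and inversion is smooth
at invertible maps. -/
theorem contMDiffOn_fibreCoord (hU : IsOpen U)
    (hs : IsLocalFrameOn (𝓡 n) (FibreModel m) ∞ s U) (α : Fin m) :
    ContMDiffOn (totalModel n m) 𝓘(ℝ, ℝ) ∞ (fibreCoord hs α) {w | w.proj ∈ U} := by
  intro w hw
  refine ContMDiffAt.contMDiffWithinAt ?_
  set e := trivializationAt (FibreModel m) E w.proj with he
  have hwe : w.proj ∈ e.baseSet := mem_baseSet_trivializationAt _ _ _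
  -- The frame matrix: its columns are the fibre parts of the s_β.
  let G : M → FibreModel m →L[ℝ] FibreModel m := fun x =>
    ∑ β, ContinuousLinearMap.smulRightL ℝ _ _ (EuclideanSpace.proj β)
      (fibrePart w.proj (⟨x, s β x⟩ : TotalSpace (FibreModel m) E))
  have hG : ContMDiffAt (𝓡 n) 𝓘(ℝ, FibreModel m →L[ℝ] FibreModel m) ∞ G w.proj := by
    refine contMDiffAt_finsetSum fun β _ => ?_
    have h1 := contMDiffAt_fibrePart_section hwe
      ((hs.contMDiffOn β).contMDiffAt (hU.mem_nhds hw))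
    exact ((ContinuousLinearMap.smulRightL ℝ (FibreModel m) (FibreModel m)
      (EuclideanSpace.proj β)).contMDiff.contMDiffAt).comp w.proj h1
  have hequiv : ∀ x ∈ U ∩ e.baseSet, ∃ L : FibreModel m ≃L[ℝ] FibreModel m,
      (L : FibreModel m →L[ℝ] FibreModel m) = G x ∧ ∀ (v : E x) (β : Fin m),
        L.symm (fibrePart w.proj (⟨x, v⟩ : TotalSpace (FibreModel m) E)) β = hs.coeff β x v := by
    rintro x ⟨hxU, hxe⟩
    let L : FibreModel m ≃ₗ[ℝ] FibreModel m :=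
      (WithLp.linearEquiv 2 ℝ (Fin m → ℝ)).trans
        ((hs.toBasisAt hxU).equivFun.symm.trans (e.linearEquivAt ℝ x hxe))
    have hL : ∀ c, L c = G x c := by
      intro c
      have : L c = fibrePart w.proj (⟨x, ∑ β, c β • s β x⟩ : TotalSpace (FibreModel m) E) := by
        have h1 : ((hs.toBasisAt hxU).equivFun.symm ((WithLp.linearEquiv 2 ℝ (Fin m → ℝ)) c)) =
            ∑ β, c β • s β x := by
          simp [Module.Basis.equivFun_symm_apply]
        simp only [L, LinearEquiv.trans_apply, h1]
        rfl
      rw [this, fibrePart_sum hxe]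
      simp [G]
    refine ⟨L.toContinuousLinearEquiv, ?_, ?_⟩
    · ext1 c
      exact hL c
    · intro v β
      have : L.toContinuousLinearEquiv.symm (fibrePart w.proj (⟨x, v⟩ : TotalSpace (FibreModel m) E))
          = WithLp.toLp 2 (fun β => hs.coeff β x v) := by
        rw [ContinuousLinearEquiv.symm_apply_eq]
        change _ = L _
        rw [hL, fibrePart_eq_sum hs hxU hxe]
        simp [G]
      rw [this]
  obtain ⟨L₀, hL₀, -⟩ := hequiv w.proj ⟨hw, hwe⟩
  have hinv : ContMDiffAt (totalModel n m) 𝓘(ℝ, FibreModel m →L[ℝ] FibreModel m) ∞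
      (fun w' : TotalSpace (FibreModel m) E => (G w'.proj).inverse) w := by
    have h1 : ContMDiffAt 𝓘(ℝ, FibreModel m →L[ℝ] FibreModel m)
        𝓘(ℝ, FibreModel m →L[ℝ] FibreModel m) ∞ ContinuousLinearMap.inverse (G w.proj) := by
      rw [← hL₀]
      exact (contDiffAt_map_inverse L₀).contMDiffAt
    exact ContMDiffAt.comp w (g := fun x => (G x).inverse) (I' := 𝓡 n)
      (ContMDiffAt.comp w.proj h1 hG) (contMDiffAt_proj E)
  have hres := hinv.clm_apply (contMDiffAt_fibrePart (n := n) hwe)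
  have hfin : ContMDiffAt (totalModel n m) 𝓘(ℝ, ℝ) ∞
      (fun w' => (G w'.proj).inverse (fibrePart w.proj w') α) w :=
    ((EuclideanSpace.proj (𝕜 := ℝ) α : FibreModel m →L[ℝ] ℝ).contMDiff.contMDiffAt).comp w hres
  refine hfin.congr_of_eventuallyEq ?_
  have hopen : IsOpen {w' : TotalSpace (FibreModel m) E | w'.proj ∈ U ∩ e.baseSet} :=
    (hU.inter e.open_baseSet).preimage (FiberBundle.continuous_proj (FibreModel m) E)
  filter_upwards [hopen.mem_nhds ⟨hw, hwe⟩] with w' hw'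
  obtain ⟨L, hL, hL'⟩ := hequiv w'.proj hw'
  rw [← hL, ContinuousLinearMap.inverse_equiv]
  exact (hL' w'.2 α).symm

/-- A vector field along the projection with smooth coefficients in a local frame is smooth. -/
theorem contMDiffOn_of_coeff (hU : IsOpen U) (hs : IsLocalFrameOn (𝓡 n) (FibreModel m) ∞ s U)
    {Ω : Set (TotalSpace (FibreModel m) E)} (hΩ : ∀ w ∈ Ω, w.proj ∈ U)
    {a : ∀ w : TotalSpace (FibreModel m) E, E w.proj}
    (ha : ∀ α, ContMDiffOn (totalModel n m) 𝓘(ℝ, ℝ) ∞ (fun w => hs.coeff α w.proj (a w)) Ω) :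
    ContMDiffOn (totalModel n m) (totalModel n m) ∞
      (fun w => (⟨w.proj, a w⟩ : TotalSpace (FibreModel m) E)) Ω := by
  intro w hw
  refine contMDiffWithinAt_totalSpace.2 ⟨contMDiffWithinAt_proj E, ?_⟩
  have hwe : w.proj ∈ (trivializationAt (FibreModel m) E w.proj).baseSet :=
    mem_baseSet_trivializationAt _ _ _
  have h1 : ContMDiffWithinAt (totalModel n m) 𝓘(ℝ, FibreModel m) ∞ (fun w' =>
      ∑ α, hs.coeff α w'.proj (a w') • 
        fibrePart w.proj (⟨w'.proj, s α w'.proj⟩ : TotalSpace (FibreModel m) E)) Ω w := by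
    refine contMDiffWithinAt_finsetSum fun α _ => ?_
    refine (ha α w hw).smul ?_
    have h2 := contMDiffAt_fibrePart_section hwe
      ((hs.contMDiffOn α).contMDiffAt (hU.mem_nhds (hΩ w hw)))
    exact (ContMDiffAt.comp w (g := fun x => fibrePart w.proj
      (⟨x, s α x⟩ : TotalSpace (FibreModel m) E)) h2 (contMDiffAt_proj E)).contMDiffWithinAt
  refine h1.congr_of_eventuallyEq_of_mem ?_ hw
  have hopen : IsOpen {w' : TotalSpace (FibreModel m) E |
      w'.proj ∈ (trivializationAt (FibreModel m) E w.proj).baseSet} :=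
    (Trivialization.open_baseSet _).preimage (FiberBundle.continuous_proj (FibreModel m) E)
  filter_upwards [mem_nhdsWithin_of_mem_nhds (hopen.mem_nhds hwe), self_mem_nhdsWithin]
    with w' hw' hw'Ω
  exact fibrePart_eq_sum hs (hΩ w' hw'Ω) hw' (a w')

/-! ### Tangent vectors of the total space -/

section

variable (A : LieAlgebroid n m E)

theorem isOpen_preimage_proj (hU : IsOpen U) :
    IsOpen {w : TotalSpace (FibreModel m) E | w.proj ∈ U} :=
  hU.preimage (FiberBundle.continuous_proj (FibreModel m) E)

theorem mdifferentiableAt_fibreCoord (hU : IsOpen U)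
    (hs : IsLocalFrameOn (𝓡 n) (FibreModel m) ∞ s U) (α : Fin m)
    {w : TotalSpace (FibreModel m) E} (hw : w.proj ∈ U) :
    MDifferentiableAt (totalModel n m) 𝓘(ℝ, ℝ) (fibreCoord hs α) w :=
  ((contMDiffOn_fibreCoord hU hs α).contMDiffAt
    ((isOpen_preimage_proj hU).mem_nhds hw)).mdifferentiableAt (by simp)

theorem dirD_comp_proj {F : Type*} [NormedAddCommGroup F] [NormedSpace ℝ F] {f : M → F}
    {w : TotalSpace (FibreModel m) E} (hf : MDifferentiableAt (𝓡 n) 𝓘(ℝ, F) f w.proj)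
    (v : TangentSpace (totalModel n m) w) :
    dirD (totalModel n m) (fun w => f w.proj) w v = dirD (𝓡 n) f w.proj (A.tangentProj w v) := by
  have h := dirD_comp (I := 𝓡 n) (I' := totalModel n m) (f := f)
    (g := (TotalSpace.proj : TotalSpace (FibreModel m) E → M)) (x := w) hf
    ((contMDiffAt_proj E (n := ∞)).mdifferentiableAt (by simp))
  rw [h]
  rfl

theorem contMDiff_fibreLine (w : TotalSpace (FibreModel m) E) (u : E w.proj) :
    ContMDiff 𝓘(ℝ, ℝ) (totalModel n m) ∞
      (fun t : ℝ => (⟨w.proj, w.2 + t • u⟩ : TotalSpace (FibreModel m) E)) := by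
  intro t
  refine contMDiffAt_totalSpace.2 ⟨contMDiffAt_const, ?_⟩
  have hwe : w.proj ∈ (trivializationAt (FibreModel m) E w.proj).baseSet :=
    mem_baseSet_trivializationAt _ _ _
  have h : (fun t : ℝ => (trivializationAt (FibreModel m) E w.proj
      (⟨w.proj, w.2 + t • u⟩ : TotalSpace (FibreModel m) E)).2) =
      fun t => (trivializationAt (FibreModel m) E w.proj).linearMapAt ℝ w.proj w.2 +
        t • (trivializationAt (FibreModel m) E w.proj).linearMapAt ℝ w.proj u := by
    funext t
    rw [← map_smul, ← map_add]
    exact fibrePart_eq hwe _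
  rw [h]
  exact (contDiff_const.add (contDiff_id.smul contDiff_const)).contMDiff.contMDiffAt

/-- Along the line w + t u the coordinate y^α is affine in t, with slope the α-th coefficient of u.
-/
theorem dirD_fibreCoord_verticalLift (hU : IsOpen U)
    (hs : IsLocalFrameOn (𝓡 n) (FibreModel m) ∞ s U) (α : Fin m)
    {w : TotalSpace (FibreModel m) E} (hw : w.proj ∈ U) (u : E w.proj) :
    dirD (totalModel n m) (fibreCoord hs α) w (verticalLift w u) = hs.coeff α w.proj u := by
  have h0 : (⟨w.proj, w.2 + (0 : ℝ) • u⟩ : TotalSpace (FibreModel m) E) = w := by simp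
  have h1 : HasMFDerivAt (totalModel n m) 𝓘(ℝ, ℝ) (fibreCoord hs α)
      (⟨w.proj, w.2 + (0 : ℝ) • u⟩ : TotalSpace (FibreModel m) E)
      (dirD (totalModel n m) (fibreCoord hs α) w) := by
    rw [h0]
    exact (mdifferentiableAt_fibreCoord hU hs α hw).hasMFDerivAt
  have h2 := h1.comp (0 : ℝ)
    ((contMDiff_fibreLine (n := n) w u).mdifferentiable (by simp) 0).hasMFDerivAt
  have h3' : HasFDerivAt (fun t : ℝ => hs.coeff α w.proj w.2 + t * hs.coeff α w.proj u)
      (ContinuousLinearMap.toSpanSingleton ℝ (hs.coeff α w.proj u)) 0 := by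
    have := ((hasDerivAt_id (0 : ℝ)).mul_const (hs.coeff α w.proj u)).const_add
      (hs.coeff α w.proj w.2)
    simpa using! this.hasFDerivAt
  have h3 := hasMFDerivAt_iff_hasFDerivAt.2 h3'
  have h4 : (fibreCoord hs α) ∘ (fun t : ℝ => (⟨w.proj, w.2 + t • u⟩ :
      TotalSpace (FibreModel m) E)) = fun t : ℝ => hs.coeff α w.proj w.2 +
      t * hs.coeff α w.proj u := by
    funext t
    simp [fibreCoord]
  rw [h4] at h2
  have h5 := congrArg (fun L => L (1 : ℝ)) (hasMFDerivAt_unique h2 h3)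
  refine Eq.trans h5 ?_
  exact one_smul ℝ _

theorem mem_chart_source_totalSpace {w₀ w : TotalSpace (FibreModel m) E} :
    w ∈ (chartAt (ModelProd (EuclideanSpace ℝ (Fin n)) (FibreModel m)) w₀).source ↔
      w.proj ∈ (trivializationAt (FibreModel m) E w₀.proj).baseSet ∧
      w.proj ∈ (chartAt (EuclideanSpace ℝ (Fin n)) w₀.proj).source := by
  rw [FiberBundle.chartedSpace_chartAt]
  simp only [mfld_simps]
  constructor
  · rintro ⟨h1, h2⟩
    have h1' := (Trivialization.mem_source _).1 h1
    exact ⟨h1', by simpa [Trivialization.coe_fst', h1'] using h2⟩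
  · rintro ⟨h1, h2⟩
    exact ⟨(Trivialization.mem_source _).2 h1, by simpa [Trivialization.coe_fst', h1] using h2⟩

/-- The chart of the total space is the pair of a base chart composed with π and the fibre part in a
trivialization. -/
theorem dirD_extChartAt_totalSpace {w₀ w : TotalSpace (FibreModel m) E}
    (hw : w.proj ∈ (trivializationAt (FibreModel m) E w₀.proj).baseSet)
    (hw' : w.proj ∈ (chartAt (EuclideanSpace ℝ (Fin n)) w₀.proj).source)
    (v : TangentSpace (totalModel n m) w) :
    dirD (totalModel n m) (extChartAt (totalModel n m) w₀) w v =
      (dirD (𝓡 n) (extChartAt (𝓡 n) w₀.proj) w.proj (A.tangentProj w v),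
        dirD (totalModel n m) (fibrePart w₀.proj) w v) := by
  have hd : MDifferentiableAt (totalModel n m)
      𝓘(ℝ, EuclideanSpace ℝ (Fin n) × FibreModel m) (extChartAt (totalModel n m) w₀) w :=
    mdifferentiableAt_extChartAt (mem_chart_source_totalSpace.2 ⟨hw, hw'⟩)
  have hev : ∀ᶠ w' : TotalSpace (FibreModel m) E in 𝓝 w,
      extChartAt (totalModel n m) w₀ w' =
        (extChartAt (𝓡 n) w₀.proj w'.proj, fibrePart w₀.proj w') := by
    filter_upwards [(isOpen_preimage_proj (Trivialization.open_baseSet _)).mem_nhds hw]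
      with w' hw'
    rw [FiberBundle.extChartAt]
    have : ((trivializationAt (FibreModel m) E w₀.proj) w').1 = w'.proj :=
      Trivialization.coe_fst' _ hw'
    ext1
    · simp [this]
    · simp [fibrePart]
  have h1 := dirD_clm (ContinuousLinearMap.fst ℝ (EuclideanSpace ℝ (Fin n)) (FibreModel m)) hd
  have h2 := dirD_clm (ContinuousLinearMap.snd ℝ (EuclideanSpace ℝ (Fin n)) (FibreModel m)) hd
  rw [dirD_congr (hev.mono fun w' h => congrArg
    (ContinuousLinearMap.fst ℝ (EuclideanSpace ℝ (Fin n)) (FibreModel m)) h)] at h1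
  rw [dirD_congr (hev.mono fun w' h => congrArg
    (ContinuousLinearMap.snd ℝ (EuclideanSpace ℝ (Fin n)) (FibreModel m)) h)] at h2
  ext1
  · refine (congrArg (fun L => L v) h1).symm.trans ?_
    exact dirD_comp_proj A (mdifferentiableAt_extChartAt hw') v
  · exact (congrArg (fun L => L v) h2).symm

/-- The product rule for w = ∑ y^α s_α(π w). The vector v enters only through its projection and the
numbers dy^α(v), whence `tangent_ext`. -/
theorem dirD_fibrePart (hU : IsOpen U) (hs : IsLocalFrameOn (𝓡 n) (FibreModel m) ∞ s U)
    {x₀ : M} {w : TotalSpace (FibreModel m) E} (hw : w.proj ∈ U)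
    (hwe : w.proj ∈ (trivializationAt (FibreModel m) E x₀).baseSet)
    (v : TangentSpace (totalModel n m) w) :
    dirD (totalModel n m) (fibrePart x₀) w v = ∑ α, (fibreCoord hs α w •
      dirD (𝓡 n) (fun x => fibrePart x₀ (⟨x, s α x⟩ : TotalSpace (FibreModel m) E)) w.proj
        (A.tangentProj w v) +
      dirD (totalModel n m) (fibreCoord hs α) w v •
        fibrePart x₀ (⟨w.proj, s α w.proj⟩ : TotalSpace (FibreModel m) E)) := by
  have hev : ∀ᶠ w' : TotalSpace (FibreModel m) E in 𝓝 w, fibrePart x₀ w' =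
      ∑ α, fibreCoord hs α w' •
        fibrePart x₀ (⟨w'.proj, s α w'.proj⟩ : TotalSpace (FibreModel m) E) := by
    filter_upwards [(isOpen_preimage_proj (hU.inter (Trivialization.open_baseSet _))).mem_nhds
      ⟨hw, hwe⟩] with w' hw'
    exact fibrePart_eq_sum hs hw'.1 hw'.2 w'.2
  have h1 : ∀ α, ContMDiffAt (𝓡 n) 𝓘(ℝ, FibreModel m) ∞ 
      (fun x => fibrePart x₀ (⟨x, s α x⟩ : TotalSpace (FibreModel m) E)) w.proj := fun α =>
    contMDiffAt_fibrePart_section hwe ((hs.contMDiffOn α).contMDiffAt (hU.mem_nhds hw))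
  have h2 : ∀ α, MDifferentiableAt (totalModel n m) 𝓘(ℝ, FibreModel m) 
      (fun w' : TotalSpace (FibreModel m) E =>
        fibrePart x₀ (⟨w'.proj, s α w'.proj⟩ : TotalSpace (FibreModel m) E)) w := fun α =>
    (ContMDiffAt.comp w (h1 α) (contMDiffAt_proj E)).mdifferentiableAt (by simp)
  have h3 : ∀ α, ContMDiffAt (totalModel n m) 𝓘(ℝ, ℝ) ∞ (fibreCoord hs α) w := fun α =>
    (contMDiffOn_fibreCoord hU hs α).contMDiffAt ((isOpen_preimage_proj hU).mem_nhds hw)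
  rw [dirD_congr hev, dirD_sum, sum_apply]
  · refine Finset.sum_congr rfl fun α _ => ?_
    rw [dirD_smul_apply ((h3 α).mdifferentiableAt (by simp)) (h2 α),
      dirD_comp_proj A (f := fun x => fibrePart x₀ (⟨x, s α x⟩ : TotalSpace (FibreModel m) E))
      ((h1 α).mdifferentiableAt (by simp))]
  · exact fun α _ => ((h3 α).smul (ContMDiffAt.comp w (h1 α) (contMDiffAt_proj E))).mdifferentiableAt (by simp)

theorem tangent_ext (hU : IsOpen U) (hs : IsLocalFrameOn (𝓡 n) (FibreModel m) ∞ s U)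
    {w : TotalSpace (FibreModel m) E} (hw : w.proj ∈ U) {v v' : TangentSpace (totalModel n m) w}
    (hp : A.tangentProj w v = A.tangentProj w v')
    (hy : ∀ α, dirD (totalModel n m) (fibreCoord hs α) w v =
      dirD (totalModel n m) (fibreCoord hs α) w v') : v = v' := by
  have hwe : w.proj ∈ (trivializationAt (FibreModel m) E w.proj).baseSet :=
    mem_baseSet_trivializationAt _ _ _
  refine dirD_extChartAt_injective (I := totalModel n m) (x₀ := w) (x := w)
    (mem_chart_source _ w) ?_
  rw [dirD_extChartAt_totalSpace A hwe (mem_chart_source _ _),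
    dirD_extChartAt_totalSpace A hwe (mem_chart_source _ _),
    dirD_fibrePart A hU hs hw hwe, dirD_fibrePart A hU hs hw hwe, hp]
  simp only [hy]

/-! ### Coordinates on the prolongation -/

/-- The coefficients of the first component in a local frame. -/
def prolX (hs : IsLocalFrameOn (𝓡 n) (FibreModel m) ∞ s U) (α : Fin m)
    (w : TotalSpace (FibreModel m) E) : A.Prol w →ₗ[ℝ] ℝ :=
  (hs.coeff α w.proj).comp ((LinearMap.fst ℝ _ _).comp (A.Prol w).subtype)

/-- The derivatives of the fibre coordinates along the second component. -/
def prolV (hs : IsLocalFrameOn (𝓡 n) (FibreModel m) ∞ s U) (α : Fin m)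
    (w : TotalSpace (FibreModel m) E) : A.Prol w →ₗ[ℝ] ℝ :=
  (dirD (totalModel n m) (fibreCoord hs α) w).toLinearMap.comp
    ((LinearMap.snd ℝ _ _).comp (A.Prol w).subtype)

theorem coordX_apply (hs : IsLocalFrameOn (𝓡 n) (FibreModel m) ∞ s U) (Z : A.ProlSection)
    (α : Fin m) (w : TotalSpace (FibreModel m) E) : A.coordX hs Z α w = A.prolX hs α w (Z w) := rfl

theorem coordV_apply (hs : IsLocalFrameOn (𝓡 n) (FibreModel m) ∞ s U) (Z : A.ProlSection)
    (α : Fin m) (w : TotalSpace (FibreModel m) E) : A.coordV hs Z α w = A.prolV hs α w (Z w) := rfl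

theorem prolX_eq (hs : IsLocalFrameOn (𝓡 n) (FibreModel m) ∞ s U) (α : Fin m)
    {w : TotalSpace (FibreModel m) E} (z : A.Prol w) :
    A.prolX hs α w z = hs.coeff α w.proj z.1.1 := rfl

theorem prolV_eq (hs : IsLocalFrameOn (𝓡 n) (FibreModel m) ∞ s U) (α : Fin m)
    {w : TotalSpace (FibreModel m) E} (z : A.Prol w) :
    A.prolV hs α w z = dirD (totalModel n m) (fibreCoord hs α) w z.1.2 := rfl

variable {A}

theorem prol_anchor {w : TotalSpace (FibreModel m) E} (z : A.Prol w) :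
    A.tangentProj w z.1.2 = A.anchor w.proj z.1.1 := z.2.symm

/-- For (u,v) in 𝒯E the projection of v is σ(u), so only u and the dy^α(v) are free. Later
identities in 𝒯E are reduced to real-valued ones through this lemma. -/
theorem prol_ext (hU : IsOpen U) (hs : IsLocalFrameOn (𝓡 n) (FibreModel m) ∞ s U)
    {w : TotalSpace (FibreModel m) E} (hw : w.proj ∈ U) {z z' : A.Prol w}
    (hX : ∀ α, A.prolX hs α w z = A.prolX hs α w z')
    (hV : ∀ α, A.prolV hs α w z = A.prolV hs α w z') : z = z' := by
  have h1 : z.1.1 = z'.1.1 := eq_of_coeff_eq hs hw hX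
  refine Subtype.ext (Prod.ext h1 (tangent_ext A hU hs hw ?_ hV))
  rw [prol_anchor, prol_anchor, h1]

theorem prolX_prolVertical (hs : IsLocalFrameOn (𝓡 n) (FibreModel m) ∞ s U) (α : Fin m)
    (w : TotalSpace (FibreModel m) E) (u : E w.proj) :
    A.prolX hs α w (A.prolVertical w u) = 0 :=
  map_zero (hs.coeff α w.proj)

theorem prolV_prolVertical (hU : IsOpen U) (hs : IsLocalFrameOn (𝓡 n) (FibreModel m) ∞ s U)
    (α : Fin m) {w : TotalSpace (FibreModel m) E} (hw : w.proj ∈ U) (u : E w.proj) :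
    A.prolV hs α w (A.prolVertical w u) = hs.coeff α w.proj u :=
  dirD_fibreCoord_verticalLift hU hs α hw u

theorem anchor_sum (hs : IsLocalFrameOn (𝓡 n) (FibreModel m) ∞ s U) {x : M} (hx : x ∈ U)
    (v : E x) : A.anchor x v = ∑ α, hs.coeff α x v • A.anchor x (s α x) := by
  conv_lhs => rw [← sum_coeff_smul hs hx v]
  simp only [map_sum, map_smul]

theorem contMDiffOn_anchor {t : ∀ x, E x} {O : Set M}
    (ht : ContMDiffOn (𝓡 n) (totalModel n m) ∞
      (fun x => (⟨x, t x⟩ : TotalSpace (FibreModel m) E)) O) :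
    ContMDiffOn (𝓡 n) (𝓡 n).tangent ∞
      (fun x => (⟨x, A.anchor x (t x)⟩ : TangentBundle (𝓡 n) M)) O :=
  A.contMDiff_anchor.comp_contMDiffOn ht

/-- The projection of the second component is the anchor of the first, that is ∑ Z^α σ(s_α), so
smooth Z^α suffice. -/
theorem contMDiffOn_dirD_proj {F : Type*} [NormedAddCommGroup F] [NormedSpace ℝ F] {f : M → F}
    (hU : IsOpen U) (hs : IsLocalFrameOn (𝓡 n) (FibreModel m) ∞ s U) {O : Set M} (hO : IsOpen O)
    (hf : ContMDiffOn (𝓡 n) 𝓘(ℝ, F) ∞ f O) {Ω : Set (TotalSpace (FibreModel m) E)}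
    (hΩ : ∀ w ∈ Ω, w.proj ∈ U) (hΩ' : ∀ w ∈ Ω, w.proj ∈ O) {Z : A.ProlSection}
    (hX : ∀ α, ContMDiffOn (totalModel n m) 𝓘(ℝ, ℝ) ∞ (A.coordX hs Z α) Ω) :
    ContMDiffOn (totalModel n m) 𝓘(ℝ, F) ∞
      (fun w => dirD (𝓡 n) f w.proj (A.tangentProj w (Z w).1.2)) Ω := by
  have h1 : ∀ α, ContMDiffOn (𝓡 n) 𝓘(ℝ, F) ∞
      (fun x => dirD (𝓡 n) f x (A.anchor x (s α x))) (U ∩ O) := fun α =>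
    contMDiffOn_dirD (hU.inter hO) (hf.mono Set.inter_subset_right)
      (contMDiffOn_anchor ((hs.contMDiffOn α).mono Set.inter_subset_left))
  have h2 : ContMDiffOn (totalModel n m) 𝓘(ℝ, F) ∞ (fun w => ∑ α, A.coordX hs Z α w •
      dirD (𝓡 n) f w.proj (A.anchor w.proj (s α w.proj))) Ω :=
    contMDiffOn_finsetSum fun α _ => (hX α).smul
      ((h1 α).comp (contMDiffOn_proj E) fun w hw => ⟨hΩ w hw, hΩ' w hw⟩)
  refine h2.congr fun w hw => ?_
  rw [prol_anchor, anchor_sum hs (hΩ w hw)]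
  simp only [map_sum, map_smul]
  rfl

/-- The converse is the substantial direction: in a chart of E the base part of the vector field is
governed by the anchor and the Z^α, and the fibre part by the product rule `dirD_fibrePart`. -/
theorem smoothOn_iff (hU : IsOpen U) (hs : IsLocalFrameOn (𝓡 n) (FibreModel m) ∞ s U)
    {Ω : Set (TotalSpace (FibreModel m) E)} (hΩo : IsOpen Ω) (hΩ : ∀ w ∈ Ω, w.proj ∈ U)
    {Z : A.ProlSection} : A.SmoothOn Z Ω ↔
      (∀ α, ContMDiffOn (totalModel n m) 𝓘(ℝ, ℝ) ∞ (A.coordX hs Z α) Ω) ∧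
      ∀ α, ContMDiffOn (totalModel n m) 𝓘(ℝ, ℝ) ∞ (A.coordV hs Z α) Ω := by
  constructor
  · rintro ⟨h1, h2⟩
    refine ⟨fun α => ?_, fun α => ?_⟩
    · exact (contMDiffOn_fibreCoord hU hs α).comp h1 hΩ
    · exact contMDiffOn_dirD hΩo ((contMDiffOn_fibreCoord hU hs α).mono hΩ) h2
  · rintro ⟨h1, h2⟩
    refine ⟨contMDiffOn_of_coeff hU hs hΩ h1, fun w₀ hw₀ => ?_⟩
    set e := trivializationAt (FibreModel m) E w₀.proj with he
    set c := chartAt (EuclideanSpace ℝ (Fin n)) w₀.proj with hc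
    have hO : IsOpen {w : TotalSpace (FibreModel m) E | w.proj ∈ e.baseSet ∩ c.source} :=
      isOpen_preimage_proj (e.open_baseSet.inter c.open_source)
    have hw₀' : w₀ ∈ {w : TotalSpace (FibreModel m) E | w.proj ∈ e.baseSet ∩ c.source} :=
      ⟨mem_baseSet_trivializationAt _ _ _, mem_chart_source _ _⟩
    refine ContMDiffAt.contMDiffWithinAt (ContMDiffOn.contMDiffAt (s := Ω ∩
      {w : TotalSpace (FibreModel m) E | w.proj ∈ e.baseSet ∩ c.source}) ?_
      ((hΩo.inter hO).mem_nhds ⟨hw₀, hw₀'⟩))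
    refine contMDiffOn_vectorField_of_dirD_extChartAt (x₀ := w₀)
      (fun w hw => mem_chart_source_totalSpace.2 hw.2) ?_
    have h3 : ContMDiffOn (totalModel n m) 𝓘(ℝ, EuclideanSpace ℝ (Fin n) × FibreModel m) ∞
        (fun w => (dirD (𝓡 n) (extChartAt (𝓡 n) w₀.proj) w.proj (A.tangentProj w (Z w).1.2),
          ∑ α, (fibreCoord hs α w •
          dirD (𝓡 n) (fun x => fibrePart w₀.proj (⟨x, s α x⟩ : TotalSpace (FibreModel m) E)) w.proj
            (A.tangentProj w (Z w).1.2) + A.coordV hs Z α w •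
          fibrePart w₀.proj (⟨w.proj, s α w.proj⟩ : TotalSpace (FibreModel m) E))))
        (Ω ∩ {w : TotalSpace (FibreModel m) E | w.proj ∈ e.baseSet ∩ c.source}) := by
      have hsub : Ω ∩ {w : TotalSpace (FibreModel m) E | w.proj ∈ e.baseSet ∩ c.source} ⊆ Ω :=
        Set.inter_subset_left
      refine ContMDiffOn.prodMk_space ?_ (contMDiffOn_finsetSum fun α _ => ?_)
      · exact contMDiffOn_dirD_proj hU hs c.open_source contMDiffOn_extChartAt
          (fun w hw => hΩ w hw.1) (fun w hw => hw.2.2) fun α => (h1 α).mono hsub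
      · have h4 : ContMDiffOn (𝓡 n) 𝓘(ℝ, FibreModel m) ∞ (fun x => fibrePart w₀.proj
            (⟨x, s α x⟩ : TotalSpace (FibreModel m) E)) (U ∩ e.baseSet) := fun x hx =>
          (contMDiffAt_fibrePart_section hx.2
            ((hs.contMDiffOn α).contMDiffAt (hU.mem_nhds hx.1))).contMDiffWithinAt
        have h5 := contMDiffOn_dirD_proj hU hs (Z := Z) (hU.inter e.open_baseSet) h4
            (fun w hw => hΩ w hw.1) (fun w hw => ⟨hΩ w hw.1, hw.2.1⟩) fun α => (h1 α).mono hsub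
        have h6 := ((contMDiffOn_fibreCoord hU hs α).mono
          (fun w hw => hΩ w (hsub hw))).smul h5
        exact h6.add (((h2 α).mono hsub).smul
          (h4.comp (contMDiffOn_proj E) fun w hw => ⟨hΩ w hw.1, hw.2.1⟩))
    refine h3.congr fun w hw => ?_
    rw [dirD_extChartAt_totalSpace A hw.2.1 hw.2.2, dirD_fibrePart A hU hs (hΩ w hw.1) hw.2.1]
    rfl

end

/-! ### The bracket of local sections -/

section LocalBracket

/-- The local section with constant fibre part `c` in the preferred trivialization at `x₀`. -/
def constSec (E : M → Type*) [∀ x, AddCommGroup (E x)] [∀ x, Module ℝ (E x)]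
    [∀ x, TopologicalSpace (E x)] [TopologicalSpace (TotalSpace (FibreModel m) E)]
    [FiberBundle (FibreModel m) E] (x₀ : M) (c : FibreModel m) (x : M) : E x :=
  (trivializationAt (FibreModel m) E x₀).symm x c

theorem fibrePart_constSec {x₀ x : M} (hx : x ∈ (trivializationAt (FibreModel m) E x₀).baseSet)
    (c : FibreModel m) :
    fibrePart x₀ (⟨x, constSec E x₀ c x⟩ : TotalSpace (FibreModel m) E) = c :=
  congrArg Prod.snd ((trivializationAt (FibreModel m) E x₀).apply_mk_symm hx c)

theorem constSec_fibrePart {x₀ x : M} (hx : x ∈ (trivializationAt (FibreModel m) E x₀).baseSet)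
    (v : E x) : constSec E x₀ (fibrePart x₀ (⟨x, v⟩ : TotalSpace (FibreModel m) E)) x = v :=
  (trivializationAt (FibreModel m) E x₀).symm_apply_apply_mk hx v

/-- `constSec` at a point of the trivialization, as a linear map. -/
theorem constSec_eq {x₀ x : M} (hx : x ∈ (trivializationAt (FibreModel m) E x₀).baseSet)
    (c : FibreModel m) :
    constSec E x₀ c x = (trivializationAt (FibreModel m) E x₀).symmₗ ℝ x c :=
  (Trivialization.symmₗ_apply _ hx c).symm

theorem contMDiffOn_constSec (x₀ : M) (c : FibreModel m) :
    ContMDiffOn (𝓡 n) (totalModel n m) ∞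
      (fun x => (⟨x, constSec E x₀ c x⟩ : TotalSpace (FibreModel m) E))
      (trivializationAt (FibreModel m) E x₀).baseSet := by
  refine ((trivializationAt (FibreModel m) E x₀).contMDiffOn_section_baseSet_iff).2 ?_
  exact contMDiffOn_const.congr fun x hx => fibrePart_constSec hx c

theorem constSec_eq_sum {x₀ x : M} (hx : x ∈ (trivializationAt (FibreModel m) E x₀).baseSet)
    (c : FibreModel m) :
    constSec E x₀ c x = ∑ i, c i • constSec E x₀ (EuclideanSpace.single i 1) x := by
  simp only [constSec_eq hx]
  conv_lhs => rw [← (EuclideanSpace.basisFun (Fin m) ℝ).sum_repr c]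
  simp only [map_sum, map_smul]
  simp

/-! ### Cut-off functions and global extension of germs -/

theorem exists_bump [T2Space M] {O : Set M} (hO : IsOpen O) {x : M} (hx : x ∈ O) :
    ∃ χ : M → ℝ, ContMDiff (𝓡 n) 𝓘(ℝ, ℝ) ∞ χ ∧ tsupport χ ⊆ O ∧ χ =ᶠ[𝓝 x] 1 := by
  obtain ⟨f, -, hf⟩ := (SmoothBumpFunction.nhds_basis_tsupport (I := 𝓡 n) x).mem_iff.1
    (hO.mem_nhds hx)
  exact ⟨f, f.contMDiff, hf, f.eventuallyEq_one⟩

theorem exists_global_section [T2Space M] {O : Set M} (hO : IsOpen O) {x : M} (hx : x ∈ O)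
    {t : ∀ x, E x} (ht : ContMDiffOn (𝓡 n) (totalModel n m) ∞
      (fun x => (⟨x, t x⟩ : TotalSpace (FibreModel m) E)) O) :
    ∃ T : Cₛ^∞⟮𝓡 n; FibreModel m, E⟯, ∀ᶠ y in 𝓝 x, T y = t y := by
  obtain ⟨χ, hχ, hχO, hχx⟩ := exists_bump (n := n) hO hx
  refine ⟨⟨χ • t, ContMDiffOn.smul_section_of_tsupport hχ.contMDiffOn hO hχO ht⟩, ?_⟩
  filter_upwards [hχx] with y hy
  change χ y • t y = t y
  rw [hy, Pi.one_apply, one_smul]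

theorem exists_global_function [T2Space M] {O : Set M} (hO : IsOpen O) {x : M} (hx : x ∈ O)
    {f : M → ℝ} (hf : ContMDiffOn (𝓡 n) 𝓘(ℝ, ℝ) ∞ f O) :
    ∃ F : M → ℝ, ContMDiff (𝓡 n) 𝓘(ℝ, ℝ) ∞ F ∧ F =ᶠ[𝓝 x] f := by
  obtain ⟨χ, hχ, hχO, hχx⟩ := exists_bump (n := n) hO hx
  refine ⟨fun y => χ y * f y, contMDiff_of_tsupport fun y hy => ?_, ?_⟩
  · have hyO : y ∈ O := hχO (closure_mono (fun z hz => by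
      simp only [Function.mem_support] at hz ⊢
      exact left_ne_zero_of_mul hz) hy)
    exact hχ.contMDiffAt.mul (hf.contMDiffAt (hO.mem_nhds hyO))
  · filter_upwards [hχx] with y hy
    rw [hy, Pi.one_apply, one_mul]

theorem globalExtension_eventuallyEq {t : ∀ x, E x} {x : M}
    (h : ∃ T : Cₛ^∞⟮𝓡 n; FibreModel m, E⟯, ∀ᶠ y in 𝓝 x, T y = t y) :
    ∀ᶠ y in 𝓝 x, (globalExtension n t x : Cₛ^∞⟮𝓡 n; FibreModel m, E⟯) y = t y := by
  unfold globalExtension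
  rw [dif_pos h]
  exact h.choose_spec

variable (A : LieAlgebroid n m E)

/-- Locality follows from the Leibniz rule: a section r vanishing near x satisfies r = (1 - χ) r for
a cut-off χ equal to 1 near x, and both Leibniz terms vanish at x. -/
theorem bracket_congr_right [T2Space M] (s t t' : Cₛ^∞⟮𝓡 n; FibreModel m, E⟯) {x : M}
    (h : ∀ᶠ y in 𝓝 x, t y = t' y) : A.bracket s t x = A.bracket s t' x := by
  have key : ∀ r : Cₛ^∞⟮𝓡 n; FibreModel m, E⟯, (∀ᶠ y in 𝓝 x, r y = 0) → A.bracket s r x = 0 := by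
    intro r hr
    obtain ⟨O, hOr, hO, hxO⟩ := eventually_nhds_iff.1 hr
    obtain ⟨χ, hχ, hχO, hχx⟩ := exists_bump (n := n) hO hxO
    have h1 := A.leibniz s r r (fun y => 1 - χ y) (contMDiff_const.sub hχ) (fun y => by
      by_cases hy : y ∈ O
      · rw [hOr y hy, smul_zero]
      · have : χ y = 0 := image_eq_zero_of_notMem_tsupport fun h => hy (hχO h)
        rw [this, sub_zero, one_smul]) x
    rw [h1, hOr x hxO, hχx.self_of_nhds]
    simp
  have h2 := key (t - t') (h.mono fun y hy => by simp [hy])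
  rw [map_sub] at h2
  exact sub_eq_zero.1 h2

theorem bracket_skew_apply (s t : Cₛ^∞⟮𝓡 n; FibreModel m, E⟯) (x : M) :
    A.bracket s t x = -A.bracket t s x := by
  rw [A.skew s t]
  rfl

theorem bracket_congr [T2Space M] {s s' t t' : Cₛ^∞⟮𝓡 n; FibreModel m, E⟯} {x : M}
    (hs : ∀ᶠ y in 𝓝 x, s y = s' y) (ht : ∀ᶠ y in 𝓝 x, t y = t' y) :
    A.bracket s t x = A.bracket s' t' x := by
  rw [bracket_congr_right A s t t' ht, bracket_skew_apply, bracket_congr_right A t' s s' hs,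
    ← bracket_skew_apply]

/-- By locality any extensions may replace the chosen ones. -/
theorem localBracket_eq [T2Space M] {s t : ∀ x, E x} {S T : Cₛ^∞⟮𝓡 n; FibreModel m, E⟯} {x : M}
    (hs : ∀ᶠ y in 𝓝 x, S y = s y) (ht : ∀ᶠ y in 𝓝 x, T y = t y) :
    A.localBracket s t x = A.bracket S T x := by
  refine bracket_congr A ?_ ?_
  · filter_upwards [hs, globalExtension_eventuallyEq ⟨S, hs⟩] with y h1 h2
    rw [h1, h2]
  · filter_upwards [ht, globalExtension_eventuallyEq ⟨T, ht⟩] with y h1 h2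
    rw [h1, h2]

/-- Equal germs give the same predicate to choose from, hence literally the same choice. No
smoothness or existence of an extension is involved. -/
theorem globalExtension_congr {t t' : ∀ x, E x} {x : M} (h : ∀ᶠ y in 𝓝 x, t y = t' y) :
    (globalExtension n t x : Cₛ^∞⟮𝓡 n; FibreModel m, E⟯) = globalExtension n t' x := by
  have h1 : ∀ T : Cₛ^∞⟮𝓡 n; FibreModel m, E⟯,
      (∀ᶠ y in 𝓝 x, T y = t y) = ∀ᶠ y in 𝓝 x, T y = t' y := fun T =>
    propext (eventually_congr (h.mono fun y hy => by rw [hy]))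
  open Classical in
  exact congrArg (fun P : Cₛ^∞⟮𝓡 n; FibreModel m, E⟯ → Prop =>
    if h : ∃ T, P T then h.choose else 0) (funext h1)

theorem localBracket_congr {s s' t t' : ∀ x, E x} {x : M} (hs : ∀ᶠ y in 𝓝 x, s y = s' y)
    (ht : ∀ᶠ y in 𝓝 x, t y = t' y) : A.localBracket s t x = A.localBracket s' t' x := by
  unfold localBracket
  rw [globalExtension_congr hs, globalExtension_congr ht]

theorem localBracket_skew (s t : ∀ x, E x) (x : M) :
    A.localBracket s t x = -A.localBracket t s x :=
  bracket_skew_apply A _ _ x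

theorem localBracket_sum_smul [T2Space M] {O : Set M} (hO : IsOpen O) {x : M} (hx : x ∈ O)
    {s : ∀ x, E x} (hs : ContMDiffOn (𝓡 n) (totalModel n m) ∞
      (fun x => (⟨x, s x⟩ : TotalSpace (FibreModel m) E)) O)
    {f : Fin m → M → ℝ} (hf : ∀ i, ContMDiffOn (𝓡 n) 𝓘(ℝ, ℝ) ∞ (f i) O)
    {t : Fin m → ∀ x, E x} (ht : ∀ i, ContMDiffOn (𝓡 n) (totalModel n m) ∞
      (fun x => (⟨x, t i x⟩ : TotalSpace (FibreModel m) E)) O) :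
    A.localBracket s (fun y => ∑ i, f i y • t i y) x =
      ∑ i, (f i x • A.localBracket s (t i) x +
        dirD (𝓡 n) (f i) x (A.anchor x (s x)) • t i x) := by
  obtain ⟨S, hS⟩ := exists_global_section hO hx hs
  choose T hT using fun i => exists_global_section hO hx (ht i)
  choose F hF hFf using fun i => exists_global_function hO hx (hf i)
  let FT : Fin m → Cₛ^∞⟮𝓡 n; FibreModel m, E⟯ := fun i =>
    ⟨fun y => F i y • T i y, (hF i).smul_section (T i).contMDiff⟩
  have h1 : ∀ᶠ y in 𝓝 x, (∑ i, FT i) y = ∑ i, f i y • t i y := by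
    filter_upwards [eventually_all.2 hT, eventually_all.2 hFf] with y h1 h2
    have : (∑ i, FT i) y = ∑ i, FT i y := by
      have := map_sum (ContMDiffSection.coeAddHom (𝓡 n) (FibreModel m) ∞ E) FT Finset.univ
      have h3 := congrFun this y
      rw [Finset.sum_apply] at h3
      exact h3
    rw [this]
    exact Finset.sum_congr rfl fun i _ => by rw [← h1 i, ← h2 i]; rfl
  rw [localBracket_eq A hS h1, map_sum]
  have h2 : (∑ i, A.bracket S (FT i)) x = ∑ i, A.bracket S (FT i) x := by
    have := map_sum (ContMDiffSection.coeAddHom (𝓡 n) (FibreModel m) ∞ E)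
      (fun i => A.bracket S (FT i)) Finset.univ
    have h3 := congrFun this x
    rw [Finset.sum_apply] at h3
    exact h3
  rw [h2]
  refine Finset.sum_congr rfl fun i _ => ?_
  rw [A.leibniz S (T i) (FT i) (F i) (hF i) (fun y => rfl), localBracket_eq A hS (hT i),
    tangentDeriv_eq_dirD, dirD_congr (hFf i), (hFf i).self_of_nhds, hS.self_of_nhds,
    (hT i).self_of_nhds]

/-- Expanding t and the section with its fibre part frozen at x in the same constant frame, the two
brackets differ only by the Leibniz terms, the derivatives of the coefficients of t along σ(s). -/
theorem localBracket_constSec_right [T2Space M] {O : Set M} (hO : IsOpen O) {x : M} (hx : x ∈ O)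
    {s : ∀ x, E x} (hs : ContMDiffOn (𝓡 n) (totalModel n m) ∞
      (fun x => (⟨x, s x⟩ : TotalSpace (FibreModel m) E)) O)
    {t : ∀ x, E x} (ht : ContMDiffOn (𝓡 n) (totalModel n m) ∞
      (fun x => (⟨x, t x⟩ : TotalSpace (FibreModel m) E)) O) {x₀ : M}
    (hx₀ : x ∈ (trivializationAt (FibreModel m) E x₀).baseSet) :
    A.localBracket s t x =
      A.localBracket s (constSec E x₀ (fibrePart x₀ (⟨x, t x⟩ : TotalSpace (FibreModel m) E))) x +
      constSec E x₀ (dirD (𝓡 n) (fun y => fibrePart x₀ (⟨y, t y⟩ : TotalSpace (FibreModel m) E)) x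
        (A.anchor x (s x))) x := by
  set e := trivializationAt (FibreModel m) E x₀ with he
  have hOe : IsOpen (O ∩ e.baseSet) := hO.inter e.open_baseSet
  set th : M → FibreModel m := fun y => fibrePart x₀ (⟨y, t y⟩ : TotalSpace (FibreModel m) E)
  have hth : ContMDiffOn (𝓡 n) 𝓘(ℝ, FibreModel m) ∞ th (O ∩ e.baseSet) := fun y hy =>
    (contMDiffAt_fibrePart_section hy.2 (ht.contMDiffAt (hO.mem_nhds hy.1))).contMDiffWithinAt
  have hthi : ∀ i, ContMDiffOn (𝓡 n) 𝓘(ℝ, ℝ) ∞ (fun y => th y i) (O ∩ e.baseSet) := fun i =>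
    (EuclideanSpace.proj (𝕜 := ℝ) i : FibreModel m →L[ℝ] ℝ).contMDiff.comp_contMDiffOn hth
  have hsO := hs.mono (Set.inter_subset_left (s := O) (t := e.baseSet))
  have hce : ∀ i : Fin m, ContMDiffOn (𝓡 n) (totalModel n m) ∞
      (fun x => (⟨x, constSec E x₀ (EuclideanSpace.single i 1) x⟩ : TotalSpace (FibreModel m) E))
      (O ∩ e.baseSet) := fun i => (contMDiffOn_constSec x₀ _).mono Set.inter_subset_right
  have h1 : ∀ᶠ y in 𝓝 x, t y = ∑ i, th y i • constSec E x₀ (EuclideanSpace.single i 1) y := by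
    filter_upwards [hOe.mem_nhds ⟨hx, hx₀⟩] with y hy
    rw [← constSec_eq_sum hy.2, constSec_fibrePart hy.2]
  have h2 : ∀ᶠ y in 𝓝 x, constSec E x₀ (th x) y =
      ∑ i, th x i • constSec E x₀ (EuclideanSpace.single i 1) y := by
    filter_upwards [hOe.mem_nhds ⟨hx, hx₀⟩] with y hy
    exact constSec_eq_sum hy.2 _
  rw [localBracket_congr A (Eventually.of_forall fun _ => rfl) h1,
    localBracket_sum_smul A hOe ⟨hx, hx₀⟩ hsO hthi hce,
    localBracket_congr A (Eventually.of_forall fun _ => rfl) h2,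
    localBracket_sum_smul A (f := fun i _ => th x i) hOe ⟨hx, hx₀⟩ hsO
      (fun i => contMDiffOn_const) hce, constSec_eq_sum hx₀]
  simp only [dirD_const, zero_apply, zero_smul, add_zero]
  rw [Finset.sum_add_distrib]
  congr 1
  refine Finset.sum_congr rfl fun i _ => ?_
  congr 1
  have := dirD_clm (EuclideanSpace.proj (𝕜 := ℝ) i : FibreModel m →L[ℝ] ℝ)
    ((hth.contMDiffAt (hOe.mem_nhds ⟨hx, hx₀⟩)).mdifferentiableAt (by simp))
  exact congrArg (fun L => L (A.anchor x (s x))) this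

/-- The bracket of local sections compared to the bracket of the sections with constant fibre
parts and the same values at the point. -/
theorem localBracket_constSec [T2Space M] {O : Set M} (hO : IsOpen O) {x : M} (hx : x ∈ O)
    {s : ∀ x, E x} (hs : ContMDiffOn (𝓡 n) (totalModel n m) ∞
      (fun x => (⟨x, s x⟩ : TotalSpace (FibreModel m) E)) O)
    {t : ∀ x, E x} (ht : ContMDiffOn (𝓡 n) (totalModel n m) ∞
      (fun x => (⟨x, t x⟩ : TotalSpace (FibreModel m) E)) O) {x₀ : M}
    (hx₀ : x ∈ (trivializationAt (FibreModel m) E x₀).baseSet) :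
    A.localBracket s t x =
      A.localBracket (constSec E x₀ (fibrePart x₀ (⟨x, s x⟩ : TotalSpace (FibreModel m) E)))
        (constSec E x₀ (fibrePart x₀ (⟨x, t x⟩ : TotalSpace (FibreModel m) E))) x +
      constSec E x₀ (dirD (𝓡 n) (fun y => fibrePart x₀ (⟨y, t y⟩ : TotalSpace (FibreModel m) E)) x
        (A.anchor x (s x)) -
        dirD (𝓡 n) (fun y => fibrePart x₀ (⟨y, s y⟩ : TotalSpace (FibreModel m) E)) x
        (A.anchor x (t x))) x := by
  have hOe : IsOpen (O ∩ (trivializationAt (FibreModel m) E x₀).baseSet) :=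
    hO.inter (Trivialization.open_baseSet _)
  rw [localBracket_constSec_right A hO hx hs ht hx₀, localBracket_skew,
    localBracket_constSec_right A hOe ⟨hx, hx₀⟩
      ((contMDiffOn_constSec x₀ _).mono Set.inter_subset_right) (hs.mono Set.inter_subset_left) hx₀,
    constSec_fibrePart hx₀, localBracket_skew A (constSec E x₀ (fibrePart x₀ ⟨x, s x⟩))]
  simp only [constSec_eq hx₀, map_sub]
  abel

end LocalBracket

/-! ### The bracket of the prolongation in a local frame -/

section ProlBracket

theorem contMDiffAt_fibrePart_frame (hU : IsOpen U)
    (hs : IsLocalFrameOn (𝓡 n) (FibreModel m) ∞ s U) (α : Fin m) {x₀ x : M} (hx : x ∈ U)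
    (hx₀ : x ∈ (trivializationAt (FibreModel m) E x₀).baseSet) :
    ContMDiffAt (𝓡 n) 𝓘(ℝ, FibreModel m) ∞
      (fun y => fibrePart x₀ (⟨y, s α y⟩ : TotalSpace (FibreModel m) E)) x :=
  contMDiffAt_fibrePart_section hx₀ ((hs.contMDiffOn α).contMDiffAt (hU.mem_nhds hx))

variable {A : LieAlgebroid n m E}

/-- The product rule, arranged so that the first term has coefficients frozen at w and lives on M.
Terms of this kind are matched with brackets of frozen sections. -/
theorem dirD_sum_smul_proj {F : Type*} [NormedAddCommGroup F] [NormedSpace ℝ F]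
    {w : TotalSpace (FibreModel m) E} {c : Fin m → TotalSpace (FibreModel m) E → ℝ}
    (hc : ∀ α, ContMDiffAt (totalModel n m) 𝓘(ℝ, ℝ) ∞ (c α) w) {G : Fin m → M → F}
    (hG : ∀ α, ContMDiffAt (𝓡 n) 𝓘(ℝ, F) ∞ (G α) w.proj) (v : TangentSpace (totalModel n m) w) :
    dirD (totalModel n m) (fun w' => ∑ α, c α w' • G α w'.proj) w v =
      dirD (𝓡 n) (fun y => ∑ α, c α w • G α y) w.proj (A.tangentProj w v) +
      ∑ α, dirD (totalModel n m) (c α) w v • G α w.proj := by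
  have h2 : ∀ α, ContMDiffAt (totalModel n m) 𝓘(ℝ, F) ∞
      (fun w' : TotalSpace (FibreModel m) E => G α w'.proj) w := fun α =>
    ContMDiffAt.comp w (hG α) (contMDiffAt_proj E)
  have h3 : ∀ α, ContMDiffAt (𝓡 n) 𝓘(ℝ, F) ∞ (fun y => c α w • G α y) w.proj := fun α =>
    (contMDiffAt_const (I := 𝓡 n) (I' := 𝓘(ℝ, ℝ)) (c := c α w)).smul (hG α)
  rw [dirD_sum (f := fun α w' => c α w' • G α w'.proj) _
      fun α _ => ((hc α).smul (h2 α)).mdifferentiableAt (by simp),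
    dirD_sum (f := fun α y => c α w • G α y) _
      fun α _ => (h3 α).mdifferentiableAt (by simp),
    sum_apply, sum_apply, ← Finset.sum_add_distrib]
  refine Finset.sum_congr rfl fun α _ => ?_
  rw [dirD_smul_apply ((hc α).mdifferentiableAt (by simp)) ((h2 α).mdifferentiableAt (by simp)),
    dirD_smul_apply mdifferentiableAt_const ((hG α).mdifferentiableAt (by simp)),
    dirD_comp_proj A ((hG α).mdifferentiableAt (by simp)), dirD_const]
  simp

theorem SmoothOn.mono {Z : A.ProlSection} {Ω Ω' : Set (TotalSpace (FibreModel m) E)}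
    (h : A.SmoothOn Z Ω) (hΩ : Ω' ⊆ Ω) : A.SmoothOn Z Ω' :=
  ⟨h.1.mono hΩ, h.2.mono hΩ⟩

theorem contMDiffAt_coordX (hU : IsOpen U) (hs : IsLocalFrameOn (𝓡 n) (FibreModel m) ∞ s U)
    {Ω : Set (TotalSpace (FibreModel m) E)} (hΩ : IsOpen Ω) {Z : A.ProlSection}
    (hZ : A.SmoothOn Z Ω) {w : TotalSpace (FibreModel m) E} (hw : w ∈ Ω) (hwU : w.proj ∈ U)
    (α : Fin m) : ContMDiffAt (totalModel n m) 𝓘(ℝ, ℝ) ∞ (A.coordX hs Z α) w := by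
  have ho := hΩ.inter (isOpen_preimage_proj (E := E) (m := m) hU)
  exact (((smoothOn_iff hU hs ho (fun w hw => hw.2)).1
    (hZ.mono Set.inter_subset_left)).1 α).contMDiffAt (ho.mem_nhds ⟨hw, hwU⟩)

theorem contMDiffAt_coordV (hU : IsOpen U) (hs : IsLocalFrameOn (𝓡 n) (FibreModel m) ∞ s U)
    {Ω : Set (TotalSpace (FibreModel m) E)} (hΩ : IsOpen Ω) {Z : A.ProlSection}
    (hZ : A.SmoothOn Z Ω) {w : TotalSpace (FibreModel m) E} (hw : w ∈ Ω) (hwU : w.proj ∈ U)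
    (α : Fin m) : ContMDiffAt (totalModel n m) 𝓘(ℝ, ℝ) ∞ (A.coordV hs Z α) w := by
  have ho := hΩ.inter (isOpen_preimage_proj (E := E) (m := m) hU)
  exact (((smoothOn_iff hU hs ho (fun w hw => hw.2)).1
    (hZ.mono Set.inter_subset_left)).2 α).contMDiffAt (ho.mem_nhds ⟨hw, hwU⟩)

/-- The local section of `E` with the constant coefficients `Zᵅ(w)` in a local frame. -/
def frozenSec (A : LieAlgebroid n m E) (hs : IsLocalFrameOn (𝓡 n) (FibreModel m) ∞ s U)
    (Z : A.ProlSection) (w : TotalSpace (FibreModel m) E) (x : M) : E x :=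
  ∑ α, A.coordX hs Z α w • s α x

theorem frozenSec_proj (hs : IsLocalFrameOn (𝓡 n) (FibreModel m) ∞ s U) (Z : A.ProlSection)
    {w : TotalSpace (FibreModel m) E} (hw : w.proj ∈ U) :
    A.frozenSec hs Z w w.proj = (Z w).1.1 :=
  sum_coeff_smul hs hw _

theorem contMDiffOn_frozenSec (hs : IsLocalFrameOn (𝓡 n) (FibreModel m) ∞ s U)
    (Z : A.ProlSection) (w : TotalSpace (FibreModel m) E) :
    ContMDiffOn (𝓡 n) (totalModel n m) ∞
      (fun x => (⟨x, A.frozenSec hs Z w x⟩ : TotalSpace (FibreModel m) E)) U :=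
  ContMDiffOn.sum_section fun α _ => (hs.contMDiffOn α).const_smul_section

theorem dirD_fibrePart_section (hU : IsOpen U) (hs : IsLocalFrameOn (𝓡 n) (FibreModel m) ∞ s U)
    {Ω : Set (TotalSpace (FibreModel m) E)} (hΩ : IsOpen Ω) {Z : A.ProlSection}
    (hZ : A.SmoothOn Z Ω) {w : TotalSpace (FibreModel m) E} (hw : w ∈ Ω) (hwU : w.proj ∈ U) {x₀ : M}
    (hx₀ : w.proj ∈ (trivializationAt (FibreModel m) E x₀).baseSet)
    (v : TangentSpace (totalModel n m) w) :
    dirD (totalModel n m)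
      (fun w' => fibrePart x₀ (⟨w'.proj, (Z w').1.1⟩ : TotalSpace (FibreModel m) E)) w v =
      dirD (𝓡 n) (fun y => fibrePart x₀
        (⟨y, A.frozenSec hs Z w y⟩ : TotalSpace (FibreModel m) E)) w.proj (A.tangentProj w v) +
      ∑ α, dirD (totalModel n m) (A.coordX hs Z α) w v •
        fibrePart x₀ (⟨w.proj, s α w.proj⟩ : TotalSpace (FibreModel m) E) := by
  have ho := hU.inter (Trivialization.open_baseSet (trivializationAt (FibreModel m) E x₀))
  have h1 : ∀ᶠ w' : TotalSpace (FibreModel m) E in 𝓝 w,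
      fibrePart x₀ (⟨w'.proj, (Z w').1.1⟩ : TotalSpace (FibreModel m) E) =
      ∑ α, A.coordX hs Z α w' •
        fibrePart x₀ (⟨w'.proj, s α w'.proj⟩ : TotalSpace (FibreModel m) E) := by
    filter_upwards [(isOpen_preimage_proj ho).mem_nhds ⟨hwU, hx₀⟩] with w' hw'
    exact fibrePart_eq_sum hs hw'.1 hw'.2 _
  have h2 : ∀ᶠ y in 𝓝 w.proj,
      fibrePart x₀ (⟨y, A.frozenSec hs Z w y⟩ : TotalSpace (FibreModel m) E) =
      ∑ α, A.coordX hs Z α w • fibrePart x₀ (⟨y, s α y⟩ : TotalSpace (FibreModel m) E) := by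
    filter_upwards [ho.mem_nhds ⟨hwU, hx₀⟩] with y hy
    exact fibrePart_sum hy.2 _ _
  rw [dirD_congr h1, dirD_congr h2]
  exact dirD_sum_smul_proj (fun α => contMDiffAt_coordX hU hs hΩ hZ hw hwU α)
    (G := fun α y => fibrePart x₀ (⟨y, s α y⟩ : TotalSpace (FibreModel m) E))
    (fun α => contMDiffAt_fibrePart_frame hU hs α hwU hx₀) v

theorem bracketPair_eq (Z W : A.ProlSection) (w : TotalSpace (FibreModel m) E) :
    A.bracketPair Z W w =
      (A.localBracket (constSec E w.proj (fibrePart w.proj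
          (⟨w.proj, (Z w).1.1⟩ : TotalSpace (FibreModel m) E)))
        (constSec E w.proj (fibrePart w.proj
          (⟨w.proj, (W w).1.1⟩ : TotalSpace (FibreModel m) E))) w.proj +
        constSec E w.proj (dirD (totalModel n m) (fun w' => fibrePart w.proj
            (⟨w'.proj, (W w').1.1⟩ : TotalSpace (FibreModel m) E)) w (Z w).1.2 -
          dirD (totalModel n m) (fun w' => fibrePart w.proj
            (⟨w'.proj, (Z w').1.1⟩ : TotalSpace (FibreModel m) E)) w (W w).1.2) w.proj,
      VectorField.mlieBracket (totalModel n m) (fun w' => (Z w').1.2) (fun w' => (W w').1.2) w) :=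
  rfl

theorem contMDiffOn_deriv {Ω : Set (TotalSpace (FibreModel m) E)} (hΩ : IsOpen Ω)
    {Z : A.ProlSection} (hZ : A.SmoothOn Z Ω) {f : TotalSpace (FibreModel m) E → ℝ}
    (hf : ContMDiffOn (totalModel n m) 𝓘(ℝ, ℝ) ∞ f Ω) :
    ContMDiffOn (totalModel n m) 𝓘(ℝ, ℝ) ∞ (A.deriv Z f) Ω :=
  contMDiffOn_dirD hΩ hf hZ.2

/-- The frame given by the preferred trivialization at `x₀`. -/
def trivFrame (E : M → Type*) [∀ x, AddCommGroup (E x)] [∀ x, Module ℝ (E x)]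
    [∀ x, TopologicalSpace (E x)] [TopologicalSpace (TotalSpace (FibreModel m) E)]
    [FiberBundle (FibreModel m) E] [VectorBundle ℝ (FibreModel m) E] (x₀ : M) :
    Fin m → ∀ x, E x :=
  (trivializationAt (FibreModel m) E x₀).localFrame (EuclideanSpace.basisFun (Fin m) ℝ).toBasis

theorem isLocalFrameOn_trivFrame (x₀ : M) :
    IsLocalFrameOn (𝓡 n) (FibreModel m) ∞ (trivFrame (m := m) E x₀)
      (trivializationAt (FibreModel m) E x₀).baseSet :=
  Trivialization.isLocalFrameOn_localFrame_baseSet (𝓡 n) ∞ _ _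

theorem smoothOn_of_frames {Z : A.ProlSection} {Ω : Set (TotalSpace (FibreModel m) E)}
    (hΩ : IsOpen Ω)
    (h : ∀ x₀ : M, A.SmoothOn Z
      (Ω ∩ {w | w.proj ∈ (trivializationAt (FibreModel m) E x₀).baseSet})) : A.SmoothOn Z Ω := by
  have hmem : ∀ w ∈ Ω,
      Ω ∩ {w' | w'.proj ∈ (trivializationAt (FibreModel m) E w.proj).baseSet} ∈ 𝓝 w := fun w hw =>
    (hΩ.inter (isOpen_preimage_proj (Trivialization.open_baseSet _))).mem_nhds
      ⟨hw, mem_baseSet_trivializationAt _ _ _⟩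
  exact ⟨fun w hw => ((h w.proj).1.contMDiffAt (hmem w hw)).contMDiffWithinAt,
    fun w hw => ((h w.proj).2.contMDiffAt (hmem w hw)).contMDiffWithinAt⟩

theorem toProl_of_mem {w : TotalSpace (FibreModel m) E}
    {p : E w.proj × TangentSpace (totalModel n m) w} (hp : p ∈ A.Prol w) :
    (A.toProl w p).1 = p := by
  unfold toProl
  rw [dif_pos hp]

/-! ### The bracket of 𝒯E: frame formulas, values and smoothness -/

variable [T2Space M]

/-- The defining formula does not depend on the frame. Passing from constant fibre parts to frozen
coefficients changes the E-bracket by derivatives along σ of the first components, and the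
derivative terms by derivatives along the projected vectors. These agree on 𝒯E. -/
theorem bracketPair_fst (hU : IsOpen U) (hs : IsLocalFrameOn (𝓡 n) (FibreModel m) ∞ s U)
    {Ω : Set (TotalSpace (FibreModel m) E)} (hΩ : IsOpen Ω) {Z W : A.ProlSection}
    (hZ : A.SmoothOn Z Ω) (hW : A.SmoothOn W Ω) {w : TotalSpace (FibreModel m) E} (hw : w ∈ Ω)
    (hwU : w.proj ∈ U) :
    (A.bracketPair Z W w).1 =
      A.localBracket (A.frozenSec hs Z w) (A.frozenSec hs W w) w.proj +
      ∑ α, (A.deriv Z (A.coordX hs W α) w - A.deriv W (A.coordX hs Z α) w) • s α w.proj := by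
  have hwe : w.proj ∈ (trivializationAt (FibreModel m) E w.proj).baseSet :=
    mem_baseSet_trivializationAt _ _ _
  rw [bracketPair_eq, dirD_fibrePart_section hU hs hΩ hZ hw hwU hwe,
    dirD_fibrePart_section hU hs hΩ hW hw hwU hwe,
    localBracket_constSec A hU hwU (contMDiffOn_frozenSec hs Z w)
      (contMDiffOn_frozenSec hs W w) hwe, frozenSec_proj hs Z hwU, frozenSec_proj hs W hwU,
    prol_anchor, prol_anchor]
  have h1 : ∀ α, s α w.proj = (trivializationAt (FibreModel m) E w.proj).symmₗ ℝ w.proj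
      (fibrePart w.proj (⟨w.proj, s α w.proj⟩ : TotalSpace (FibreModel m) E)) := fun α => by
    rw [← constSec_eq hwe, constSec_fibrePart hwe]
  have h2 : ∑ α, (A.deriv Z (A.coordX hs W α) w - A.deriv W (A.coordX hs Z α) w) • s α w.proj =
      constSec E w.proj (∑ α, (A.deriv Z (A.coordX hs W α) w - A.deriv W (A.coordX hs Z α) w) •
        fibrePart w.proj (⟨w.proj, s α w.proj⟩ : TotalSpace (FibreModel m) E)) w.proj := by
    rw [constSec_eq hwe, map_sum]
    refine Finset.sum_congr rfl fun α _ => ?_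
    rw [map_smul, ← h1]
  rw [h2, add_assoc]
  simp only [constSec_eq hwe]
  rw [← map_add]
  congr 2
  simp only [sub_smul, Finset.sum_sub_distrib]
  simp only [deriv, tangentDeriv_eq_dirD]
  abel

theorem anchor_localBracket {O : Set M} (hO : IsOpen O) {x : M} (hx : x ∈ O)
    {p q : ∀ x, E x} (hp : ContMDiffOn (𝓡 n) (totalModel n m) ∞
      (fun x => (⟨x, p x⟩ : TotalSpace (FibreModel m) E)) O)
    (hq : ContMDiffOn (𝓡 n) (totalModel n m) ∞
      (fun x => (⟨x, q x⟩ : TotalSpace (FibreModel m) E)) O) :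
    A.anchor x (A.localBracket p q x) =
      VectorField.mlieBracket (𝓡 n) (fun y => A.anchor y (p y)) (fun y => A.anchor y (q y)) x := by
  unfold localBracket
  rw [A.anchor_bracket]
  refine EventuallyEq.mlieBracket_vectorField_eq ?_ ?_
  · filter_upwards [globalExtension_eventuallyEq (exists_global_section hO hx hp)] with y hy
    rw [hy]
  · filter_upwards [globalExtension_eventuallyEq (exists_global_section hO hx hq)] with y hy
    rw [hy]

/-- Both sides are compared through a chart φ of M. On the left the anchor turns the bracket of
frozen sections into a commutator acting on φ. On the right the commutator of the vector fields acts
on φ ∘ π, where the field of Z gives ∑ Z^α σ(s_α)φ. Separating the frozen part from the derivatives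
of the coefficients makes the two expressions coincide. -/
theorem bracketPair_mem (hU : IsOpen U) (hs : IsLocalFrameOn (𝓡 n) (FibreModel m) ∞ s U)
    {Ω : Set (TotalSpace (FibreModel m) E)} (hΩ : IsOpen Ω) {Z W : A.ProlSection}
    (hZ : A.SmoothOn Z Ω) (hW : A.SmoothOn W Ω) {w : TotalSpace (FibreModel m) E} (hw : w ∈ Ω)
    (hwU : w.proj ∈ U) : A.bracketPair Z W w ∈ A.Prol w := by
  change A.anchor w.proj (A.bracketPair Z W w).1 = A.tangentProj w (A.bracketPair Z W w).2
  set c := chartAt (EuclideanSpace ℝ (Fin n)) w.proj with hc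
  set φ := extChartAt (𝓡 n) w.proj with hφ
  have hwc : w.proj ∈ c.source := mem_chart_source _ _
  have hUc : IsOpen (U ∩ c.source) := hU.inter c.open_source
  refine dirD_extChartAt_injective (I := 𝓡 n) (x₀ := w.proj) (x := w.proj) hwc ?_
  change dirD (𝓡 n) φ w.proj _ = dirD (𝓡 n) φ w.proj _
  have hφs : ContMDiffOn (𝓡 n) 𝓘(ℝ, EuclideanSpace ℝ (Fin n)) ∞ φ c.source :=
    contMDiffOn_extChartAt
  have hφd : ∀ x ∈ c.source, MDifferentiableAt (𝓡 n) 𝓘(ℝ, EuclideanSpace ℝ (Fin n)) φ x :=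
    fun x hx => (hφs.contMDiffAt (c.open_source.mem_nhds hx)).mdifferentiableAt (by simp)
  let G : Fin m → M → EuclideanSpace ℝ (Fin n) := fun α y => dirD (𝓡 n) φ y (A.anchor y (s α y))
  have hG : ∀ α, ContMDiffAt (𝓡 n) 𝓘(ℝ, EuclideanSpace ℝ (Fin n)) ∞ (G α) w.proj := fun α =>
    (contMDiffOn_dirD hUc (hφs.mono Set.inter_subset_right)
      (contMDiffOn_anchor ((hs.contMDiffOn α).mono Set.inter_subset_left))).contMDiffAt
      (hUc.mem_nhds ⟨hwU, hwc⟩)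
  have hfroz : ∀ Z : A.ProlSection, (fun y => dirD (𝓡 n) φ y (A.anchor y (A.frozenSec hs Z w y))) =
      fun y => ∑ α, A.coordX hs Z α w • G α y := by
    intro Z
    funext y
    simp only [frozenSec, map_sum, map_smul, G]
  have hproj : ∀ Z : A.ProlSection, (fun w' : TotalSpace (FibreModel m) E =>
      dirD (totalModel n m) (fun w' : TotalSpace (FibreModel m) E => φ w'.proj) w' (Z w').1.2)
      =ᶠ[𝓝 w] fun w' => ∑ α, A.coordX hs Z α w' • G α w'.proj := by
    intro Z
    filter_upwards [(isOpen_preimage_proj hUc).mem_nhds ⟨hwU, hwc⟩] with w' hw'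
    rw [dirD_comp_proj A (hφd _ hw'.2), prol_anchor, anchor_sum hs hw'.1]
    simp only [map_sum, map_smul, G]
    rfl
  have hlhs : dirD (𝓡 n) φ w.proj (A.anchor w.proj
      (A.localBracket (A.frozenSec hs Z w) (A.frozenSec hs W w) w.proj)) =
      dirD (𝓡 n) (fun y => ∑ α, A.coordX hs W α w • G α y) w.proj (A.anchor w.proj (Z w).1.1) -
      dirD (𝓡 n) (fun y => ∑ α, A.coordX hs Z α w • G α y) w.proj (A.anchor w.proj (W w).1.1) := by
    rw [anchor_localBracket hU hwU (contMDiffOn_frozenSec hs Z w) (contMDiffOn_frozenSec hs W w),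
      dirD_mlieBracket hUc (hφs.mono Set.inter_subset_right)
        (contMDiffOn_anchor ((contMDiffOn_frozenSec hs Z w).mono Set.inter_subset_left))
        (contMDiffOn_anchor ((contMDiffOn_frozenSec hs W w).mono Set.inter_subset_left))
        ⟨hwU, hwc⟩, hfroz, hfroz, frozenSec_proj hs Z hwU, frozenSec_proj hs W hwU]
  have ho : IsOpen (Ω ∩ {w' : TotalSpace (FibreModel m) E | w'.proj ∈ c.source}) :=
    hΩ.inter (isOpen_preimage_proj c.open_source)
  have hrhs : dirD (𝓡 n) φ w.proj (A.tangentProj w (A.bracketPair Z W w).2) =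
      dirD (totalModel n m) (fun w' => ∑ α, A.coordX hs W α w' • G α w'.proj) w (Z w).1.2 -
      dirD (totalModel n m) (fun w' => ∑ α, A.coordX hs Z α w' • G α w'.proj) w (W w).1.2 := by
    have hcomp : ContMDiffOn (totalModel n m) 𝓘(ℝ, EuclideanSpace ℝ (Fin n)) ∞
        (fun w' : TotalSpace (FibreModel m) E => φ w'.proj)
        (Ω ∩ {w' : TotalSpace (FibreModel m) E | w'.proj ∈ c.source}) :=
      hφs.comp (contMDiffOn_proj E) fun w' hw' => hw'.2
    have hb := dirD_mlieBracket ho hcomp (hZ.2.mono Set.inter_subset_left)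
      (hW.2.mono Set.inter_subset_left) ⟨hw, hwc⟩
    rw [← dirD_comp_proj A (hφd _ hwc)]
    refine Eq.trans hb ?_
    rw [dirD_congr (hproj W), dirD_congr (hproj Z)]
  rw [hrhs, dirD_sum_smul_proj (fun α => contMDiffAt_coordX hU hs hΩ hW hw hwU α) hG,
    dirD_sum_smul_proj (fun α => contMDiffAt_coordX hU hs hΩ hZ hw hwU α) hG, prol_anchor,
    prol_anchor, bracketPair_fst hU hs hΩ hZ hW hw hwU, map_add, map_add, hlhs]
  simp only [map_sum, map_smul, map_sub, sub_smul, Finset.sum_sub_distrib, deriv,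
    tangentDeriv_eq_dirD, G]
  abel

theorem prolBracket_val (hU : IsOpen U) (hs : IsLocalFrameOn (𝓡 n) (FibreModel m) ∞ s U)
    {Ω : Set (TotalSpace (FibreModel m) E)} (hΩ : IsOpen Ω) {Z W : A.ProlSection}
    (hZ : A.SmoothOn Z Ω) (hW : A.SmoothOn W Ω) {w : TotalSpace (FibreModel m) E} (hw : w ∈ Ω)
    (hwU : w.proj ∈ U) : (A.prolBracket Z W w).1 = A.bracketPair Z W w :=
  toProl_of_mem (bracketPair_mem hU hs hΩ hZ hW hw hwU)

/-- Constant coefficients produce no Leibniz terms; the left slot is handled through skew-symmetry.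
-/
theorem localBracket_frozenSec (hU : IsOpen U) (hs : IsLocalFrameOn (𝓡 n) (FibreModel m) ∞ s U)
    (Z W : A.ProlSection) {w : TotalSpace (FibreModel m) E} (hwU : w.proj ∈ U) :
    A.localBracket (A.frozenSec hs Z w) (A.frozenSec hs W w) w.proj =
      ∑ α, ∑ β, (A.coordX hs Z α w * A.coordX hs W β w) • A.localBracket (s α) (s β) w.proj := by
  have h1 : ∀ (Z : A.ProlSection) {t : ∀ x, E x}, ContMDiffOn (𝓡 n) (totalModel n m) ∞
      (fun x => (⟨x, t x⟩ : TotalSpace (FibreModel m) E)) U →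
      A.localBracket t (A.frozenSec hs Z w) w.proj =
        ∑ α, A.coordX hs Z α w • A.localBracket t (s α) w.proj := by
    intro Z t ht
    have := localBracket_sum_smul A (f := fun α _ => A.coordX hs Z α w) hU hwU ht
      (fun α => contMDiffOn_const) hs.contMDiffOn
    refine this.trans (Finset.sum_congr rfl fun α _ => ?_)
    rw [dirD_const]
    simp
  rw [h1 W (contMDiffOn_frozenSec hs Z w), Finset.sum_comm]
  refine Finset.sum_congr rfl fun β _ => ?_
  rw [localBracket_skew, h1 Z (hs.contMDiffOn β), smul_neg, Finset.smul_sum,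
    ← Finset.sum_neg_distrib]
  refine Finset.sum_congr rfl fun α _ => ?_
  rw [localBracket_skew A (s β), smul_neg, smul_neg, neg_neg, smul_smul, mul_comm]

theorem coordX_prolBracket (hU : IsOpen U) (hs : IsLocalFrameOn (𝓡 n) (FibreModel m) ∞ s U)
    {Ω : Set (TotalSpace (FibreModel m) E)} (hΩ : IsOpen Ω) {Z W : A.ProlSection}
    (hZ : A.SmoothOn Z Ω) (hW : A.SmoothOn W Ω) {w : TotalSpace (FibreModel m) E} (hw : w ∈ Ω)
    (hwU : w.proj ∈ U) (γ : Fin m) :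
    A.coordX hs (A.prolBracket Z W) γ w =
      A.deriv Z (A.coordX hs W γ) w - A.deriv W (A.coordX hs Z γ) w +
      ∑ α, ∑ β, A.structureFunction hs γ α β w.proj * A.coordX hs Z α w * A.coordX hs W β w := by
  change hs.coeff γ w.proj (A.prolBracket Z W w).1.1 = _
  rw [prolBracket_val hU hs hΩ hZ hW hw hwU, bracketPair_fst hU hs hΩ hZ hW hw hwU, map_add,
    coeff_sum hs hwU, localBracket_frozenSec hU hs Z W hwU, add_comm]
  congr 1
  simp only [map_sum, map_smul, smul_eq_mul]
  refine Finset.sum_congr rfl fun α _ => Finset.sum_congr rfl fun β _ => ?_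
  rw [mul_comm, mul_assoc]
  rfl

/-- The commutator of the second components evaluated on y^γ; structure functions do not enter. -/
theorem coordV_prolBracket (hU : IsOpen U) (hs : IsLocalFrameOn (𝓡 n) (FibreModel m) ∞ s U)
    {Ω : Set (TotalSpace (FibreModel m) E)} (hΩ : IsOpen Ω) {Z W : A.ProlSection}
    (hZ : A.SmoothOn Z Ω) (hW : A.SmoothOn W Ω) {w : TotalSpace (FibreModel m) E} (hw : w ∈ Ω)
    (hwU : w.proj ∈ U) (γ : Fin m) :
    A.coordV hs (A.prolBracket Z W) γ w =
      A.deriv Z (A.coordV hs W γ) w - A.deriv W (A.coordV hs Z γ) w := by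
  change dirD (totalModel n m) (fibreCoord hs γ) w (A.prolBracket Z W w).1.2 = _
  rw [prolBracket_val hU hs hΩ hZ hW hw hwU]
  exact dirD_mlieBracket (hΩ.inter (isOpen_preimage_proj hU))
    ((contMDiffOn_fibreCoord hU hs γ).mono Set.inter_subset_right)
    (hZ.2.mono Set.inter_subset_left) (hW.2.mono Set.inter_subset_left) ⟨hw, hwU⟩

theorem contMDiffOn_structureFunction (hU : IsOpen U)
    (hs : IsLocalFrameOn (𝓡 n) (FibreModel m) ∞ s U) (γ α β : Fin m) :
    ContMDiffOn (𝓡 n) 𝓘(ℝ, ℝ) ∞ (A.structureFunction hs γ α β) U := by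
  intro x hx
  obtain ⟨S, hS⟩ := exists_global_section hU hx (hs.contMDiffOn α)
  obtain ⟨T, hT⟩ := exists_global_section hU hx (hs.contMDiffOn β)
  have h1 : ContMDiffAt (𝓡 n) 𝓘(ℝ, ℝ) ∞ (fun y => hs.coeff γ y (A.bracket S T y)) x := by
    refine ContMDiffAt.comp x (g := fibreCoord hs γ) (I' := totalModel n m)
      (f := fun y => (⟨y, A.bracket S T y⟩ : TotalSpace (FibreModel m) E)) ?_
      (A.bracket S T).contMDiff.contMDiffAt
    exact (contMDiffOn_fibreCoord hU hs γ).contMDiffAt ((isOpen_preimage_proj hU).mem_nhds hx)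
  refine (h1.congr_of_eventuallyEq ?_).contMDiffWithinAt
  -- The same extensions S and T serve at all points near x, whereas `localBracket` chooses new ones
  -- at each point.
  filter_upwards [eventually_eventually_nhds.2 hS, eventually_eventually_nhds.2 hT] with y hSy hTy
  change hs.coeff γ y (A.localBracket (s α) (s β) y) = _
  rw [localBracket_eq A hSy hTy]

theorem SmoothOn.prolBracket {Ω : Set (TotalSpace (FibreModel m) E)} (hΩ : IsOpen Ω)
    {Z W : A.ProlSection} (hZ : A.SmoothOn Z Ω) (hW : A.SmoothOn W Ω) :
    A.SmoothOn (A.prolBracket Z W) Ω := by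
  refine smoothOn_of_frames hΩ fun x₀ => ?_
  have hU := (trivializationAt (FibreModel m) E x₀).open_baseSet
  have hs := isLocalFrameOn_trivFrame (n := n) (m := m) (E := E) x₀
  set Ω' := Ω ∩ {w | w.proj ∈ (trivializationAt (FibreModel m) E x₀).baseSet} with hΩ'
  have ho : IsOpen Ω' := hΩ.inter (isOpen_preimage_proj hU)
  have hZ' := hZ.mono (Set.inter_subset_left : Ω' ⊆ Ω)
  have hW' := hW.mono (Set.inter_subset_left : Ω' ⊆ Ω)
  obtain ⟨hZX, hZV⟩ := (smoothOn_iff hU hs ho (fun w hw => hw.2)).1 hZ'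
  obtain ⟨hWX, hWV⟩ := (smoothOn_iff hU hs ho (fun w hw => hw.2)).1 hW'
  refine (smoothOn_iff hU hs ho (fun w hw => hw.2)).2 ⟨fun γ => ?_, fun γ => ?_⟩
  · have hproj : ContMDiffOn (totalModel n m) (𝓡 n) ∞
        (TotalSpace.proj : TotalSpace (FibreModel m) E → M) Ω' := contMDiffOn_proj E
    have h1 : ∀ α β, ContMDiffOn (totalModel n m) 𝓘(ℝ, ℝ) ∞ (fun w =>
        A.structureFunction hs γ α β w.proj * A.coordX hs Z α w * A.coordX hs W β w) Ω' :=
      fun α β => (((contMDiffOn_structureFunction (A := A) hU hs γ α β).comp hproj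
        fun w hw => hw.2).mul (hZX α)).mul (hWX β)
    have h2 : ContMDiffOn (totalModel n m) 𝓘(ℝ, ℝ) ∞ (fun w => ∑ α, ∑ β,
        A.structureFunction hs γ α β w.proj * A.coordX hs Z α w * A.coordX hs W β w) Ω' :=
      contMDiffOn_finsetSum fun α _ => contMDiffOn_finsetSum fun β _ => h1 α β
    refine ContMDiffOn.congr (((contMDiffOn_deriv ho hZ' (hWX γ)).sub
      (contMDiffOn_deriv ho hW' (hZX γ))).add h2) ?_
    intro w hw
    exact coordX_prolBracket hU hs ho hZ' hW' hw hw.2 γ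
  · refine ContMDiffOn.congr ((contMDiffOn_deriv ho hZ' (hWV γ)).sub
      (contMDiffOn_deriv ho hW' (hZV γ))) ?_
    intro w hw
    exact coordV_prolBracket hU hs ho hZ' hW' hw hw.2 γ

end ProlBracket

/-! ### Sections of the prolongation -/

section Sections

variable {A : LieAlgebroid n m E}

theorem mem_trivFrame (w : TotalSpace (FibreModel m) E) :
    w.proj ∈ (trivializationAt (FibreModel m) E w.proj).baseSet :=
  mem_baseSet_trivializationAt _ _ _

theorem isOpen_trivFrame (x₀ : M) : IsOpen (trivializationAt (FibreModel m) E x₀).baseSet :=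
  Trivialization.open_baseSet _

theorem isOpen_slit (_A : LieAlgebroid n m E) : IsOpen (slit (m := m) (E := E)) := by
  rw [isOpen_iff_mem_nhds]
  intro w hw
  have hs := isLocalFrameOn_trivFrame (n := n) (m := m) (E := E) w.proj
  have hU := isOpen_trivFrame (m := m) (E := E) w.proj
  obtain ⟨α, hα⟩ : ∃ α, fibreCoord hs α w ≠ 0 := by
    by_contra! h
    refine hw (eq_of_coeff_eq hs (mem_trivFrame w) fun α => ?_)
    rw [map_zero]
    exact h α
  have hc := (contMDiffOn_fibreCoord hU hs α).continuousOn.continuousAt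
    ((isOpen_preimage_proj hU).mem_nhds (mem_trivFrame w))
  filter_upwards [hc.eventually_ne hα] with w' hw' h0
  refine hw' ?_
  change hs.coeff α w'.proj w'.2 = 0
  rw [h0, map_zero]

theorem SmoothOn.congr {Z W : A.ProlSection} {Ω : Set (TotalSpace (FibreModel m) E)}
    (hZ : A.SmoothOn Z Ω) (h : ∀ w ∈ Ω, W w = Z w) : A.SmoothOn W Ω :=
  ⟨hZ.1.congr fun w hw => by rw [h w hw], hZ.2.congr fun w hw => by rw [h w hw]⟩

theorem smoothOn_iff_trivFrame {Z : A.ProlSection} {Ω : Set (TotalSpace (FibreModel m) E)}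
    (hΩ : IsOpen Ω) : A.SmoothOn Z Ω ↔ ∀ x₀ : M,
      (∀ α, ContMDiffOn (totalModel n m) 𝓘(ℝ, ℝ) ∞
        (A.coordX (isLocalFrameOn_trivFrame x₀) Z α)
        (Ω ∩ {w | w.proj ∈ (trivializationAt (FibreModel m) E x₀).baseSet})) ∧
      ∀ α, ContMDiffOn (totalModel n m) 𝓘(ℝ, ℝ) ∞
        (A.coordV (isLocalFrameOn_trivFrame x₀) Z α)
        (Ω ∩ {w | w.proj ∈ (trivializationAt (FibreModel m) E x₀).baseSet}) := by
  have h : ∀ x₀ : M, IsOpen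
      (Ω ∩ {w | w.proj ∈ (trivializationAt (FibreModel m) E x₀).baseSet}) := fun x₀ =>
    hΩ.inter (isOpen_preimage_proj (isOpen_trivFrame x₀))
  constructor
  · exact fun hZ x₀ => (smoothOn_iff (isOpen_trivFrame x₀) _ (h x₀) fun w hw => hw.2).1
      (hZ.mono Set.inter_subset_left)
  · exact fun hZ => smoothOn_of_frames hΩ fun x₀ =>
      (smoothOn_iff (isOpen_trivFrame x₀) _ (h x₀) fun w hw => hw.2).2 (hZ x₀)

theorem smoothOn_sum_smul {ι : Type} [Fintype ι] {f : ι → TotalSpace (FibreModel m) E → ℝ}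
    {Z : ι → A.ProlSection} {Ω : Set (TotalSpace (FibreModel m) E)} (hΩ : IsOpen Ω)
    (hf : ∀ i, ContMDiffOn (totalModel n m) 𝓘(ℝ, ℝ) ∞ (f i) Ω) (hZ : ∀ i, A.SmoothOn (Z i) Ω) :
    A.SmoothOn (fun w => ∑ i, f i w • Z i w) Ω := by
  refine (smoothOn_iff_trivFrame hΩ).2 fun x₀ => ⟨fun α => ?_, fun α => ?_⟩
  · have h : ContMDiffOn (totalModel n m) 𝓘(ℝ, ℝ) ∞ (fun w => ∑ i, f i w *
        A.coordX (isLocalFrameOn_trivFrame x₀) (Z i) α w)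
        (Ω ∩ {w | w.proj ∈ (trivializationAt (FibreModel m) E x₀).baseSet}) :=
      contMDiffOn_finsetSum fun i _ => ((hf i).mono Set.inter_subset_left).mul
        (((smoothOn_iff_trivFrame hΩ).1 (hZ i) x₀).1 α)
    refine h.congr fun w _ => ?_
    simp only [coordX_apply, map_sum, map_smul, smul_eq_mul]
  · have h : ContMDiffOn (totalModel n m) 𝓘(ℝ, ℝ) ∞ (fun w => ∑ i, f i w *
        A.coordV (isLocalFrameOn_trivFrame x₀) (Z i) α w)
        (Ω ∩ {w | w.proj ∈ (trivializationAt (FibreModel m) E x₀).baseSet}) :=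
      contMDiffOn_finsetSum fun i _ => ((hf i).mono Set.inter_subset_left).mul
        (((smoothOn_iff_trivFrame hΩ).1 (hZ i) x₀).2 α)
    refine h.congr fun w _ => ?_
    simp only [coordV_apply, map_sum, map_smul, smul_eq_mul]

theorem SmoothOn.linearCombination {Z W : A.ProlSection} {Ω : Set (TotalSpace (FibreModel m) E)}
    (hΩ : IsOpen Ω) (hZ : A.SmoothOn Z Ω) (hW : A.SmoothOn W Ω) (c d : ℝ) :
    A.SmoothOn (fun w => c • Z w + d • W w) Ω := by
  -- A two-term combination is a sum over `Bool`.
  refine (smoothOn_sum_smul (ι := Bool) (f := fun i _ => cond i c d) (Z := fun i => cond i Z W) hΩ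
    (fun i => contMDiffOn_const) fun i => by cases i <;> assumption).congr fun w _ => ?_
  simp

theorem smoothOn_zero {Ω : Set (TotalSpace (FibreModel m) E)} (hΩ : IsOpen Ω) :
    A.SmoothOn (0 : A.ProlSection) Ω :=
  (smoothOn_sum_smul (ι := Empty) (f := fun _ _ => 0) (Z := fun _ => 0) hΩ
    (fun i => i.elim) fun i => i.elim).congr fun w _ => by simp

theorem SmoothOn.sub {Z W : A.ProlSection} {Ω : Set (TotalSpace (FibreModel m) E)}
    (hΩ : IsOpen Ω) (hZ : A.SmoothOn Z Ω) (hW : A.SmoothOn W Ω) : A.SmoothOn (Z - W) Ω :=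
  (hZ.linearCombination hΩ hW 1 (-1)).congr fun w _ => by
    change Z w - W w = _
    module

theorem coordX_tangentStructure (hs : IsLocalFrameOn (𝓡 n) (FibreModel m) ∞ s U)
    (Z : A.ProlSection) (α : Fin m) (w : TotalSpace (FibreModel m) E) :
    A.coordX hs (A.tangentStructure Z) α w = 0 :=
  prolX_prolVertical (A := A) hs α w (Z w).1.1

theorem coordV_tangentStructure (hU : IsOpen U) (hs : IsLocalFrameOn (𝓡 n) (FibreModel m) ∞ s U)
    (Z : A.ProlSection) (α : Fin m) {w : TotalSpace (FibreModel m) E} (hw : w.proj ∈ U) :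
    A.coordV hs (A.tangentStructure Z) α w = A.coordX hs Z α w :=
  prolV_prolVertical (A := A) hU hs α hw (Z w).1.1

theorem SmoothOn.tangentStructure {Z : A.ProlSection} {Ω : Set (TotalSpace (FibreModel m) E)}
    (hΩ : IsOpen Ω) (hZ : A.SmoothOn Z Ω) : A.SmoothOn (A.tangentStructure Z) Ω := by
  refine (smoothOn_iff_trivFrame hΩ).2 fun x₀ => ⟨fun α => ?_, fun α => ?_⟩
  · have h : ContMDiffOn (totalModel n m) 𝓘(ℝ, ℝ) ∞ (fun _ => (0 : ℝ))
        (Ω ∩ {w | w.proj ∈ (trivializationAt (FibreModel m) E x₀).baseSet}) := contMDiffOn_const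
    exact h.congr fun w _ => coordX_tangentStructure _ Z α w
  · exact (((smoothOn_iff_trivFrame hΩ).1 hZ x₀).1 α).congr fun w hw =>
      coordV_tangentStructure (isOpen_trivFrame x₀) _ Z α hw.2

/-- The map `u ↦ (0, u_w^v)` as a linear map. -/
def prolVerticalLinear (A : LieAlgebroid n m E) (w : TotalSpace (FibreModel m) E) :
    E w.proj →ₗ[ℝ] A.Prol w where
  toFun := A.prolVertical w
  map_add' u u' := by
    refine prol_ext (isOpen_trivFrame w.proj) (isLocalFrameOn_trivFrame w.proj) (mem_trivFrame w)
      (fun α => ?_) fun α => ?_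
    · simp only [map_add, prolX_prolVertical, add_zero]
    · simp only [map_add, prolV_prolVertical (isOpen_trivFrame w.proj) _ _ (mem_trivFrame w)]
  map_smul' c u := by
    refine prol_ext (isOpen_trivFrame w.proj) (isLocalFrameOn_trivFrame w.proj) (mem_trivFrame w)
      (fun α => ?_) fun α => ?_
    · simp only [map_smul, prolX_prolVertical, smul_zero]
    · simp only [map_smul, prolV_prolVertical (isOpen_trivFrame w.proj) _ _ (mem_trivFrame w)]
      rfl

theorem prolVertical_injective (w : TotalSpace (FibreModel m) E) {u : E w.proj}
    (h : A.prolVertical w u = 0) : u = 0 := by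
  have hs := isLocalFrameOn_trivFrame (n := n) (m := m) (E := E) w.proj
  refine eq_of_coeff_eq hs (mem_trivFrame w) fun α => ?_
  rw [← prolV_prolVertical (A := A) (isOpen_trivFrame w.proj) hs α (mem_trivFrame w), h, map_zero,
    map_zero]

theorem prolX_eq_zero (hs : IsLocalFrameOn (𝓡 n) (FibreModel m) ∞ s U)
    {w : TotalSpace (FibreModel m) E} {z : A.Prol w} (hz : z.1.1 = 0) (α : Fin m) :
    A.prolX hs α w z = 0 := by
  rw [prolX_eq, hz, map_zero]

theorem eq_sum_frameV (hU : IsOpen U) (hs : IsLocalFrameOn (𝓡 n) (FibreModel m) ∞ s U)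
    {w : TotalSpace (FibreModel m) E} (hw : w.proj ∈ U) {z : A.Prol w} (hz : z.1.1 = 0) :
    z = ∑ α, A.prolV hs α w z • A.frameV s α w := by
  refine prol_ext hU hs hw (fun α => ?_) fun α => ?_
  · rw [prolX_eq_zero hs hz]
    simp [frameV, prolX_prolVertical]
  · simp [frameV, prolV_prolVertical hU hs α hw, coeff_frame hs hw]

theorem prolV_sum_frameV (hU : IsOpen U) (hs : IsLocalFrameOn (𝓡 n) (FibreModel m) ∞ s U)
    {w : TotalSpace (FibreModel m) E} (hw : w.proj ∈ U) (c : Fin m → ℝ) (α : Fin m) :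
    A.prolV hs α w (∑ β, c β • A.frameV s β w) = c α := by
  simp [frameV, prolV_prolVertical hU hs α hw, coeff_frame hs hw]

end Sections

/-! ### Algebraic rules for the bracket -/

section BracketRules

variable {A : LieAlgebroid n m E}

theorem deriv_congr {Z : A.ProlSection} {f g : TotalSpace (FibreModel m) E → ℝ}
    {w : TotalSpace (FibreModel m) E} (h : f =ᶠ[𝓝 w] g) : A.deriv Z f w = A.deriv Z g w :=
  congrArg (fun L => L (Z w).1.2) (dirD_congr h)

theorem deriv_zero (Z : A.ProlSection) (w : TotalSpace (FibreModel m) E) :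
    A.deriv Z (fun _ => 0) w = 0 := by
  change dirD (totalModel n m) (fun _ => (0 : ℝ)) w (Z w).1.2 = 0
  rw [dirD_const]
  rfl

/-- The derivative of a function at `w` as a linear form on `𝒯_w E`. -/
def derivLinear (A : LieAlgebroid n m E) (f : TotalSpace (FibreModel m) E → ℝ)
    (w : TotalSpace (FibreModel m) E) : A.Prol w →ₗ[ℝ] ℝ :=
  (dirD (totalModel n m) f w).toLinearMap.comp
    ((LinearMap.snd ℝ _ _).comp (A.Prol w).subtype)

theorem deriv_eq (Z : A.ProlSection) (f : TotalSpace (FibreModel m) E → ℝ)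
    (w : TotalSpace (FibreModel m) E) : A.deriv Z f w = A.derivLinear f w (Z w) := rfl

theorem deriv_sum_mul {ι : Type} [Fintype ι] (Z : A.ProlSection)
    {f g : ι → TotalSpace (FibreModel m) E → ℝ} {w : TotalSpace (FibreModel m) E}
    (hf : ∀ i, MDifferentiableAt (totalModel n m) 𝓘(ℝ, ℝ) (f i) w)
    (hg : ∀ i, MDifferentiableAt (totalModel n m) 𝓘(ℝ, ℝ) (g i) w) :
    A.deriv Z (fun w' => ∑ i, f i w' * g i w') w =
      ∑ i, (f i w * A.deriv Z (g i) w + A.deriv Z (f i) w * g i w) := by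
  change dirD (totalModel n m) _ w (Z w).1.2 = _
  rw [dirD_sum (I := totalModel n m) Finset.univ (f := fun i w' => f i w' * g i w')
    fun i _ => (hf i).mul (hg i), sum_apply]
  exact Finset.sum_congr rfl fun i _ => dirD_mul_apply (hf i) (hg i) _

/-- Values and derivatives at w depend only on germs. This permits replacing sections inside ℒ_S by
ones that agree with them only on an open set, such as E \ {0}. -/
theorem prolBracket_congr {Ω : Set (TotalSpace (FibreModel m) E)} (hΩ : IsOpen Ω)
    {Z Z' W W' : A.ProlSection} (hZ : ∀ w ∈ Ω, Z w = Z' w) (hW : ∀ w ∈ Ω, W w = W' w)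
    {w : TotalSpace (FibreModel m) E} (hw : w ∈ Ω) :
    A.prolBracket Z W w = A.prolBracket Z' W' w := by
  have hn := hΩ.mem_nhds hw
  have h1 : A.bracketPair Z W w = A.bracketPair Z' W' w := by
    have ha : (fun w' => (trivializationAt (FibreModel m) E w.proj ⟨w'.proj, (Z w').1.1⟩).2) =ᶠ[𝓝 w]
        fun w' => (trivializationAt (FibreModel m) E w.proj ⟨w'.proj, (Z' w').1.1⟩).2 := by
      filter_upwards [hn] with w' hw'
      rw [hZ w' hw']
    have hb : (fun w' => (trivializationAt (FibreModel m) E w.proj ⟨w'.proj, (W w').1.1⟩).2) =ᶠ[𝓝 w]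
        fun w' => (trivializationAt (FibreModel m) E w.proj ⟨w'.proj, (W' w').1.1⟩).2 := by
      filter_upwards [hn] with w' hw'
      rw [hW w' hw']
    have hV : (fun w' => (Z w').1.2) =ᶠ[𝓝 w] fun w' => (Z' w').1.2 := by
      filter_upwards [hn] with w' hw'
      rw [hZ w' hw']
    have hV' : (fun w' => (W w').1.2) =ᶠ[𝓝 w] fun w' => (W' w').1.2 := by
      filter_upwards [hn] with w' hw'
      rw [hW w' hw']
    simp only [bracketPair]
    rw [hV.mlieBracket_vectorField_eq hV', ha.mfderiv_eq, hb.mfderiv_eq, hZ w hw, hW w hw]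
    rfl
  unfold prolBracket
  rw [h1]

variable [T2Space M]

/-- The Leibniz rule, checked in coordinates. It is stated for sums so as to cover real linear
combinations and expansions in a frame alike. -/
theorem prolBracket_sum_smul {ι : Type} [Fintype ι] {Ω : Set (TotalSpace (FibreModel m) E)}
    (hΩ : IsOpen Ω) {S : A.ProlSection} (hS : A.SmoothOn S Ω)
    {f : ι → TotalSpace (FibreModel m) E → ℝ} {Z : ι → A.ProlSection}
    (hf : ∀ i, ContMDiffOn (totalModel n m) 𝓘(ℝ, ℝ) ∞ (f i) Ω) (hZ : ∀ i, A.SmoothOn (Z i) Ω)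
    {w : TotalSpace (FibreModel m) E} (hw : w ∈ Ω) :
    A.prolBracket S (fun w' => ∑ i, f i w' • Z i w') w =
      ∑ i, (f i w • A.prolBracket S (Z i) w + A.deriv S (f i) w • Z i w) := by
  have hU := isOpen_trivFrame (m := m) (E := E) w.proj
  have hs := isLocalFrameOn_trivFrame (n := n) (m := m) (E := E) w.proj
  have hwU := mem_trivFrame w
  have hsum := smoothOn_sum_smul hΩ hf hZ
  have hfd : ∀ i, MDifferentiableAt (totalModel n m) 𝓘(ℝ, ℝ) (f i) w := fun i =>
    ((hf i).contMDiffAt (hΩ.mem_nhds hw)).mdifferentiableAt (by simp)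
  refine prol_ext hU hs hwU (fun γ => ?_) fun γ => ?_
  · rw [← coordX_apply, coordX_prolBracket hU hs hΩ hS hsum hw hwU]
    have hg : ∀ i, MDifferentiableAt (totalModel n m) 𝓘(ℝ, ℝ) (A.coordX hs (Z i) γ) w := fun i =>
      (contMDiffAt_coordX hU hs hΩ (hZ i) hw hwU γ).mdifferentiableAt (by simp)
    have h1 : ∀ β w', A.coordX hs (fun w' => ∑ i, f i w' • Z i w') β w' =
        ∑ i, f i w' * A.coordX hs (Z i) β w' := fun β w' => by
      simp only [coordX_apply, map_sum, map_smul, smul_eq_mul]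
    have h2 : A.deriv S (A.coordX hs (fun w' => ∑ i, f i w' • Z i w') γ) w =
        ∑ i, (f i w * A.deriv S (A.coordX hs (Z i) γ) w +
          A.deriv S (f i) w * A.coordX hs (Z i) γ w) := by
      rw [← deriv_sum_mul S hfd hg]
      exact deriv_congr (Eventually.of_forall (h1 γ))
    rw [h2]
    simp only [map_sum, map_add, map_smul, smul_eq_mul, ← coordX_apply, h1,
      coordX_prolBracket hU hs hΩ hS (hZ _) hw hwU]
    rw [deriv_eq]
    simp only [map_sum, map_smul, smul_eq_mul, ← deriv_eq, Finset.mul_sum]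
    simp only [mul_add, mul_sub, Finset.sum_add_distrib, Finset.sum_sub_distrib, Finset.mul_sum]
    have h3 : ∑ α, ∑ β, ∑ i, A.structureFunction hs γ α β w.proj * A.coordX hs S α w *
        (f i w * A.coordX hs (Z i) β w) = ∑ i, ∑ α, ∑ β, f i w *
        (A.structureFunction hs γ α β w.proj * A.coordX hs S α w * A.coordX hs (Z i) β w) := by
      symm
      rw [Finset.sum_comm]
      refine Finset.sum_congr rfl fun α _ => ?_
      rw [Finset.sum_comm]
      exact Finset.sum_congr rfl fun β _ => Finset.sum_congr rfl fun i _ => by ring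
    rw [h3]
    ring
  · rw [← coordV_apply, coordV_prolBracket hU hs hΩ hS hsum hw hwU]
    have hg : ∀ i, MDifferentiableAt (totalModel n m) 𝓘(ℝ, ℝ) (A.coordV hs (Z i) γ) w := fun i =>
      (contMDiffAt_coordV hU hs hΩ (hZ i) hw hwU γ).mdifferentiableAt (by simp)
    have h1 : ∀ β w', A.coordV hs (fun w' => ∑ i, f i w' • Z i w') β w' =
        ∑ i, f i w' * A.coordV hs (Z i) β w' := fun β w' => by
      simp only [coordV_apply, map_sum, map_smul, smul_eq_mul]
    have h2 : A.deriv S (A.coordV hs (fun w' => ∑ i, f i w' • Z i w') γ) w =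
        ∑ i, (f i w * A.deriv S (A.coordV hs (Z i) γ) w +
          A.deriv S (f i) w * A.coordV hs (Z i) γ w) := by
      rw [← deriv_sum_mul S hfd hg]
      exact deriv_congr (Eventually.of_forall (h1 γ))
    rw [h2, deriv_eq]
    simp only [map_sum, map_add, map_smul, smul_eq_mul, ← coordV_apply, ← deriv_eq,
      coordV_prolBracket hU hs hΩ hS (hZ _) hw hwU]
    simp only [mul_sub, Finset.sum_add_distrib, Finset.sum_sub_distrib]
    ring

theorem prolBracket_linearCombination {Ω : Set (TotalSpace (FibreModel m) E)}
    (hΩ : IsOpen Ω) {S Z W : A.ProlSection} (hS : A.SmoothOn S Ω) (hZ : A.SmoothOn Z Ω)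
    (hW : A.SmoothOn W Ω) (c d : ℝ) {w : TotalSpace (FibreModel m) E} (hw : w ∈ Ω) :
    A.prolBracket S (fun w' => c • Z w' + d • W w') w =
      c • A.prolBracket S Z w + d • A.prolBracket S W w := by
  have h := prolBracket_sum_smul (ι := Bool) hΩ hS (f := fun i _ => cond i c d)
    (Z := fun i => cond i Z W) (fun i => contMDiffOn_const)
    (fun i => by cases i <;> assumption) hw
  have h0 : ∀ a : ℝ, A.deriv S (fun _ => a) w = 0 := fun a => by
    change dirD (totalModel n m) (fun _ => a) w (S w).1.2 = 0
    rw [dirD_const]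
    rfl
  simpa only [Fintype.sum_bool, cond_true, cond_false, h0, zero_smul, add_zero] using h

theorem prolBracket_sub {Ω : Set (TotalSpace (FibreModel m) E)}
    (hΩ : IsOpen Ω) {S Z W : A.ProlSection} (hS : A.SmoothOn S Ω) (hZ : A.SmoothOn Z Ω)
    (hW : A.SmoothOn W Ω) {w : TotalSpace (FibreModel m) E} (hw : w ∈ Ω) :
    A.prolBracket S (Z - W) w = A.prolBracket S Z w - A.prolBracket S W w := by
  have h := prolBracket_linearCombination hΩ hS hZ hW 1 (-1) hw
  refine (prolBracket_congr hΩ (fun _ _ => rfl) (fun w' _ => ?_) hw).trans (h.trans ?_)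
  · change Z w' - W w' = _
    module
  · module

theorem prolBracket_add {Ω : Set (TotalSpace (FibreModel m) E)}
    (hΩ : IsOpen Ω) {S Z W : A.ProlSection} (hS : A.SmoothOn S Ω) (hZ : A.SmoothOn Z Ω)
    (hW : A.SmoothOn W Ω) {w : TotalSpace (FibreModel m) E} (hw : w ∈ Ω) :
    A.prolBracket S (Z + W) w = A.prolBracket S Z w + A.prolBracket S W w := by
  have h := prolBracket_linearCombination hΩ hS hZ hW 1 1 hw
  simp only [one_smul] at h
  exact h

theorem prolBracket_zero {Ω : Set (TotalSpace (FibreModel m) E)}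
    (hΩ : IsOpen Ω) {S Z : A.ProlSection} (hS : A.SmoothOn S Ω) (hZ : ∀ w ∈ Ω, Z w = 0)
    {w : TotalSpace (FibreModel m) E} (hw : w ∈ Ω) : A.prolBracket S Z w = 0 := by
  have h := prolBracket_sub hΩ hS (smoothOn_zero hΩ) (smoothOn_zero hΩ) hw
  rw [sub_zero, sub_self] at h
  rw [← h]
  exact prolBracket_congr hΩ (fun _ _ => rfl) hZ hw

end BracketRules

/-! ### Brackets with a semispray -/

section Semispray

variable {A : LieAlgebroid n m E} {S : A.ProlSection}

theorem IsSemispray.coordX (hS : A.IsSemispray S) (hU : IsOpen U)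
    (hs : IsLocalFrameOn (𝓡 n) (FibreModel m) ∞ s U) {w : TotalSpace (FibreModel m) E}
    (hw : w ∈ slit) (hwU : w.proj ∈ U) (γ : Fin m) : A.coordX hs S γ w = fibreCoord hs γ w := by
  have h := congrArg (A.prolV hs γ w) (hS.2 w hw)
  rw [← coordV_apply, coordV_tangentStructure hU hs S γ hwU] at h
  exact h.trans (prolV_prolVertical hU hs γ hwU _)

variable [T2Space M]

/-- Since S^γ = y^γ near w, the term Z(S^γ) is dy^γ(Z), the vertical coordinate of Z. This is how
the second-order nature of S enters. -/
theorem IsSemispray.coordX_prolBracket (hS : A.IsSemispray S) (hU : IsOpen U)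
    (hs : IsLocalFrameOn (𝓡 n) (FibreModel m) ∞ s U)
    {Ω : Set (TotalSpace (FibreModel m) E)} (hΩ : IsOpen Ω) (hsub : Ω ⊆ slit) {Z : A.ProlSection}
    (hZ : A.SmoothOn Z Ω) {w : TotalSpace (FibreModel m) E} (hw : w ∈ Ω)
    (hwU : w.proj ∈ U) (γ : Fin m) :
    A.coordX hs (A.prolBracket S Z) γ w =
      A.deriv S (A.coordX hs Z γ) w - A.coordV hs Z γ w +
      ∑ α, ∑ β, A.structureFunction hs γ α β w.proj * fibreCoord hs α w * A.coordX hs Z β w := by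
  rw [LieAlgebroid.coordX_prolBracket hU hs hΩ (hS.1.mono hsub) hZ hw hwU]
  simp only [hS.coordX hU hs (hsub hw) hwU]
  congr 2
  refine deriv_congr ?_
  filter_upwards [hΩ.mem_nhds hw, (isOpen_preimage_proj hU).mem_nhds hwU] with w' hw' hwU'
  exact hS.coordX hU hs (hsub hw') hwU' γ

/-- `J[S, V] = -V` for vertical `V`. -/
theorem IsSemispray.tangentStructure_prolBracket (hS : A.IsSemispray S)
    {Ω : Set (TotalSpace (FibreModel m) E)} (hΩ : IsOpen Ω) (hsub : Ω ⊆ slit) {V : A.ProlSection}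
    (hV : A.SmoothOn V Ω) (hv : ∀ w ∈ Ω, (V w).1.1 = 0) {w : TotalSpace (FibreModel m) E}
    (hw : w ∈ Ω) : A.tangentStructure (A.prolBracket S V) w = -V w := by
  have hU := isOpen_trivFrame (m := m) (E := E) w.proj
  have hs := isLocalFrameOn_trivFrame (n := n) (m := m) (E := E) w.proj
  have hwU := mem_trivFrame w
  refine prol_ext hU hs hwU (fun γ => ?_) fun γ => ?_
  · rw [← coordX_apply, coordX_tangentStructure, map_neg, prolX_eq_zero hs (hv w hw), neg_zero]
  · rw [← coordV_apply, coordV_tangentStructure hU hs _ _ hwU,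
      hS.coordX_prolBracket hU hs hΩ hsub hV hw hwU, map_neg, ← coordV_apply]
    -- All first components vanish on a neighbourhood, so their derivative along S does too, and
    -- only -V^γ survives.
    have h1 : ∀ w' ∈ Ω, ∀ β, A.coordX hs V β w' = 0 := fun w' hw' β =>
      prolX_eq_zero hs (hv w' hw') β
    have h2 : A.deriv S (A.coordX hs V γ) w = 0 := by
      rw [← deriv_zero S w]
      refine deriv_congr ?_
      filter_upwards [hΩ.mem_nhds hw] with w' hw'
      exact h1 w' hw' γ
    simp [h1 w hw, h2]

end Semispray

/-! ### Nonlinear connections -/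

namespace NonlinearConnection

variable {A : LieAlgebroid n m E} (N : A.NonlinearConnection)

theorem toFun_of_vertical {w : TotalSpace (FibreModel m) E} (hw : w ∈ slit) {z : A.Prol w}
    (hz : z.1.1 = 0) : N.toFun w z = -z :=
  eq_neg_of_add_eq_zero_right ((N.vertical w hw z).2 hz)

/-- By 𝒩² = Id the vector z - 𝒩z lies in ker(Id + 𝒩), so it is vertical. -/
theorem toFun_fst {w : TotalSpace (FibreModel m) E} (hw : w ∈ slit) (z : A.Prol w) :
    (N.toFun w z).1.1 = z.1.1 := by
  have h := (N.vertical w hw (z - N.toFun w z)).1 (by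
    rw [map_sub, N.involutive w hw]
    abel)
  exact (sub_eq_zero.1 h).symm

theorem ver_fst {w : TotalSpace (FibreModel m) E} (hw : w ∈ slit) (Z : A.ProlSection) :
    (N.ver Z w).1.1 = 0 := by
  change (1 / 2 : ℝ) • ((Z w).1.1 - (N.toFun w (Z w)).1.1) = 0
  rw [N.toFun_fst hw, sub_self, smul_zero]

theorem hor_fst {w : TotalSpace (FibreModel m) E} (hw : w ∈ slit) (Z : A.ProlSection) :
    (N.hor Z w).1.1 = (Z w).1.1 := by
  change (1 / 2 : ℝ) • ((Z w).1.1 + (N.toFun w (Z w)).1.1) = _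
  rw [N.toFun_fst hw]
  module

theorem ver_of_vertical {w : TotalSpace (FibreModel m) E} (hw : w ∈ slit) {Z : A.ProlSection}
    (hz : (Z w).1.1 = 0) : N.ver Z w = Z w := by
  change (1 / 2 : ℝ) • (Z w - N.toFun w (Z w)) = _
  rw [N.toFun_of_vertical hw hz]
  module

theorem hor_of_vertical {w : TotalSpace (FibreModel m) E} (hw : w ∈ slit) {Z : A.ProlSection}
    (hz : (Z w).1.1 = 0) : N.hor Z w = 0 := by
  change (1 / 2 : ℝ) • (Z w + N.toFun w (Z w)) = _
  rw [N.toFun_of_vertical hw hz]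
  module

theorem hor_eq_sub_ver (Z : A.ProlSection) (w : TotalSpace (FibreModel m) E) :
    N.hor Z w = Z w - N.ver Z w := by
  change (1 / 2 : ℝ) • (Z w + N.toFun w (Z w)) = Z w - (1 / 2 : ℝ) • (Z w - N.toFun w (Z w))
  module

theorem ver_congr {Z W : A.ProlSection} {w : TotalSpace (FibreModel m) E} (h : Z w = W w) :
    N.ver Z w = N.ver W w := by
  simp only [ver, h]

theorem hor_congr {Z W : A.ProlSection} {w : TotalSpace (FibreModel m) E} (h : Z w = W w) :
    N.hor Z w = N.hor W w := by
  simp only [hor, h]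

theorem ver_of_eq_zero {Z : A.ProlSection} {w : TotalSpace (FibreModel m) E} (h : Z w = 0) :
    N.ver Z w = 0 := by
  simp [ver, h]

theorem hor_of_eq_zero {Z : A.ProlSection} {w : TotalSpace (FibreModel m) E} (h : Z w = 0) :
    N.hor Z w = 0 := by
  simp [hor, h]

theorem ver_add (Z W : A.ProlSection) (w : TotalSpace (FibreModel m) E) :
    N.ver (Z + W) w = N.ver Z w + N.ver W w := by
  change (1 / 2 : ℝ) • ((Z w + W w) - N.toFun w (Z w + W w)) =
    (1 / 2 : ℝ) • (Z w - N.toFun w (Z w)) + (1 / 2 : ℝ) • (W w - N.toFun w (W w))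
  rw [map_add]
  module

theorem ver_sub (Z W : A.ProlSection) (w : TotalSpace (FibreModel m) E) :
    N.ver (Z - W) w = N.ver Z w - N.ver W w := by
  change (1 / 2 : ℝ) • ((Z w - W w) - N.toFun w (Z w - W w)) =
    (1 / 2 : ℝ) • (Z w - N.toFun w (Z w)) - (1 / 2 : ℝ) • (W w - N.toFun w (W w))
  rw [map_sub]
  module

theorem ver_toFun {w : TotalSpace (FibreModel m) E} (hw : w ∈ slit) (Z : A.ProlSection) :
    N.ver (fun w' => N.toFun w' (Z w')) w = -N.ver Z w := by
  change (1 / 2 : ℝ) • (N.toFun w (Z w) - N.toFun w (N.toFun w (Z w))) =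
    -((1 / 2 : ℝ) • (Z w - N.toFun w (Z w)))
  rw [N.involutive w hw]
  module

theorem nabla_congr {Ω : Set (TotalSpace (FibreModel m) E)} (hΩ : IsOpen Ω)
    (S : A.ProlSection) {Z W : A.ProlSection} (h : ∀ w ∈ Ω, Z w = W w)
    {w : TotalSpace (FibreModel m) E} (hw : w ∈ Ω) : N.nabla S Z w = N.nabla S W w := by
  change N.hor _ w + N.ver _ w = N.hor _ w + N.ver _ w
  rw [N.hor_congr (prolBracket_congr hΩ (fun _ _ => rfl) (fun w' hw' => N.hor_congr (h w' hw')) hw),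
    N.ver_congr (prolBracket_congr hΩ (fun _ _ => rfl) (fun w' hw' => N.ver_congr (h w' hw')) hw)]

theorem jacobiEndomorphism_congr {Ω : Set (TotalSpace (FibreModel m) E)} (hΩ : IsOpen Ω)
    (S : A.ProlSection) {Z W : A.ProlSection} (h : ∀ w ∈ Ω, Z w = W w)
    {w : TotalSpace (FibreModel m) E} (hw : w ∈ Ω) :
    N.jacobiEndomorphism S Z w = N.jacobiEndomorphism S W w := by
  change -N.ver _ w = -N.ver _ w
  rw [N.ver_sub, N.ver_sub, N.ver_congr (prolBracket_congr hΩ (fun _ _ => rfl)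
    (fun w' hw' => N.ver_congr (h w' hw')) hw), N.ver_congr (N.ver_congr
    (prolBracket_congr hΩ (fun _ _ => rfl) h hw))]

theorem jacobiEndomorphism_eq (S Z : A.ProlSection) {w : TotalSpace (FibreModel m) E}
    (hw : w ∈ slit) : N.jacobiEndomorphism S Z w =
      N.ver (A.prolBracket S Z) w - N.ver (A.prolBracket S (N.ver Z)) w := by
  change -N.ver _ w = _
  rw [N.ver_sub, N.ver_of_vertical hw (N.ver_fst hw (A.prolBracket S Z)), neg_sub]

theorem jacobiEndomorphism_fst (S Z : A.ProlSection) {w : TotalSpace (FibreModel m) E}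
    (hw : w ∈ slit) : (N.jacobiEndomorphism S Z w).1.1 = 0 := by
  rw [N.jacobiEndomorphism_eq S Z hw]
  change (N.ver _ w).1.1 - (N.ver _ w).1.1 = 0
  rw [N.ver_fst hw, N.ver_fst hw, sub_zero]

/-! ### The invariant equations for an arbitrary and for the canonical connection -/

variable [T2Space M] {S : A.ProlSection}

theorem smoothOn_ver {Ω : Set (TotalSpace (FibreModel m) E)} (hΩ : IsOpen Ω) (hsub : Ω ⊆ slit)
    {Z : A.ProlSection} (hZ : A.SmoothOn Z Ω) : A.SmoothOn (N.ver Z) Ω := by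
  refine (hZ.linearCombination hΩ (N.smooth Ω hΩ hsub Z hZ) (1 / 2) (-(1 / 2))).congr
    fun w _ => ?_
  change (1 / 2 : ℝ) • (Z w - N.toFun w (Z w)) = _
  module

/-- On an open set where Y is vertical, hY = 0 and vY = Y, so the horizontal half of ∇ drops out. -/
theorem nabla_of_vertical {Ω : Set (TotalSpace (FibreModel m) E)} (hΩ : IsOpen Ω)
    (hsub : Ω ⊆ slit) (hS : A.SmoothOn S Ω) {Y : A.ProlSection} (hY : ∀ w ∈ Ω, (Y w).1.1 = 0)
    {w : TotalSpace (FibreModel m) E} (hw : w ∈ Ω) :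
    N.nabla S Y w = N.ver (A.prolBracket S Y) w := by
  change N.hor _ w + N.ver _ w = _
  rw [N.hor_of_eq_zero (prolBracket_zero hΩ hS
    (fun w' hw' => N.hor_of_vertical (hsub hw') (hY w' hw')) hw), zero_add]
  exact N.ver_congr (prolBracket_congr hΩ (fun _ _ => rfl)
    (fun w' hw' => N.ver_of_vertical (hsub hw') (hY w' hw')) hw)

/-- `J∇X = vX + J[S, X]`. -/
theorem tangentStructure_nabla (hS : A.IsSemispray S)
    {Ω : Set (TotalSpace (FibreModel m) E)} (hΩ : IsOpen Ω) (hsub : Ω ⊆ slit) {X : A.ProlSection}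
    (hX : A.SmoothOn X Ω) {w : TotalSpace (FibreModel m) E} (hw : w ∈ Ω) :
    A.tangentStructure (N.nabla S X) w =
      N.ver X w + A.tangentStructure (A.prolBracket S X) w := by
  have hv := N.smoothOn_ver hΩ hsub hX
  have h1 : (N.nabla S X w).1.1 = (A.prolBracket S (N.hor X) w).1.1 := by
    -- J sees only the first component, to which v contributes nothing and which h preserves.
    change (N.hor _ w).1.1 + (N.ver _ w).1.1 = _
    rw [N.hor_fst (hsub hw), N.ver_fst (hsub hw), add_zero]
  have h2 : A.prolBracket S (N.hor X) w =
      A.prolBracket S X w - A.prolBracket S (N.ver X) w := by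
    rw [← prolBracket_sub hΩ (hS.1.mono hsub) hX hv hw]
    exact prolBracket_congr hΩ (fun _ _ => rfl) (fun w' _ => N.hor_eq_sub_ver X w') hw
  have h3 := hS.tangentStructure_prolBracket hΩ hsub hv (fun w' hw' => N.ver_fst (hsub hw') X) hw
  change A.prolVerticalLinear w (N.nabla S X w).1.1 = _
  rw [h1, h2]
  change A.prolVerticalLinear w
    ((A.prolBracket S X w).1.1 - (A.prolBracket S (N.ver X) w).1.1) = _
  rw [map_sub]
  change A.tangentStructure (A.prolBracket S X) w -
    A.tangentStructure (A.prolBracket S (N.ver X)) w = _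
  rw [h3]
  abel

/-- Inserting J∇X = vX + J[S,X] into v ∘ ℒ_S produces v[S,vX], which Φ(X) removes. What is left
involves the connection only through an outer v. -/
theorem nabla_tangentStructure_nabla_add (hS : A.IsSemispray S) {X : A.ProlSection}
    (hX : A.SmoothOn X slit) {w : TotalSpace (FibreModel m) E} (hw : w ∈ slit) :
    N.nabla S (A.tangentStructure (N.nabla S X)) w + N.jacobiEndomorphism S X w =
      N.ver (A.prolBracket S X) w +
        N.ver (A.prolBracket S (A.tangentStructure (A.prolBracket S X))) w := by
  have ho := isOpen_slit A
  have hv := N.smoothOn_ver ho subset_rfl hX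
  rw [N.nabla_of_vertical ho subset_rfl hS.1 (fun _ _ => rfl) hw, N.jacobiEndomorphism_eq S X hw,
    N.ver_congr ((prolBracket_congr ho (fun _ _ => rfl)
      (fun w' hw' => N.tangentStructure_nabla hS ho subset_rfl hX hw') hw).trans
      (prolBracket_add ho hS.1 hv ((SmoothOn.prolBracket ho hS.1 hX).tangentStructure ho) hw)
      : _ = (A.prolBracket S (N.ver X) +
        A.prolBracket S (A.tangentStructure (A.prolBracket S X))) w), N.ver_add]
  abel

theorem isDynamicalSymmetry_iff (hS : A.IsSemispray S) {X : A.ProlSection}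
    (hX : A.SmoothOn X slit) : A.IsDynamicalSymmetry S X ↔
      A.IsNewtonoid S X ∧ ∀ w ∈ slit (m := m),
        N.nabla S (A.tangentStructure (N.nabla S X)) w + N.jacobiEndomorphism S X w = 0 := by
  have key : A.IsNewtonoid S X → ∀ w ∈ slit (m := m),
      N.nabla S (A.tangentStructure (N.nabla S X)) w + N.jacobiEndomorphism S X w =
        A.prolBracket S X w := by
    intro h w hw
    rw [N.nabla_tangentStructure_nabla_add hS hX hw,
      N.ver_of_eq_zero (prolBracket_zero (isOpen_slit A) hS.1 h hw), add_zero]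
    -- J[S,X] = 0 means that [S,X] is vertical, as the vertical lift is injective.
    exact N.ver_of_vertical hw (prolVertical_injective w (h w hw))
  constructor
  · intro h
    have hN : A.IsNewtonoid S X := fun w hw => by
      change A.prolVerticalLinear w (A.prolBracket S X w).1.1 = 0
      rw [h w hw]
      exact map_zero (A.prolVerticalLinear w)
    exact ⟨hN, fun w hw => (key hN w hw).trans (h w hw)⟩
  · exact fun h w hw => (key h.1 w hw).symm.trans (h.2 w hw)

/-- `∇JX = J∇X` for the canonical connection. -/
theorem IsCanonical.nabla_tangentStructure {N : A.NonlinearConnection} (hN : N.IsCanonical S)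
    (hS : A.IsSemispray S)
    {Ω : Set (TotalSpace (FibreModel m) E)} (hΩ : IsOpen Ω) (hsub : Ω ⊆ slit) {X : A.ProlSection}
    (hX : A.SmoothOn X Ω) {w : TotalSpace (FibreModel m) E} (hw : w ∈ Ω) :
    N.nabla S (A.tangentStructure X) w = A.tangentStructure (N.nabla S X) w := by
  rw [N.tangentStructure_nabla hS hΩ hsub hX hw,
    N.nabla_of_vertical hΩ hsub (hS.1.mono hsub) (fun _ _ => rfl) hw]
  have h1 : A.prolBracket S (A.tangentStructure X) w =
      (A.tangentStructure (A.prolBracket S X) - fun w' => N.toFun w' (X w')) w := by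
    change _ = A.tangentStructure (A.prolBracket S X) w - N.toFun w (X w)
    rw [hN Ω hΩ hsub X hX w hw]
    abel
  rw [N.ver_congr h1, N.ver_sub, N.ver_toFun (hsub hw),
    N.ver_of_vertical (hsub hw) (rfl : (A.tangentStructure _ w).1.1 = 0)]
  abel

theorem IsCanonical.isDynamicalSymmetry_iff {N : A.NonlinearConnection} (hN : N.IsCanonical S)
    (hS : A.IsSemispray S) {X : A.ProlSection} (hX : A.SmoothOn X slit) :
    A.IsDynamicalSymmetry S X ↔ A.IsNewtonoid S X ∧ ∀ w ∈ slit (m := m),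
      N.nabla S (N.nabla S (A.tangentStructure X)) w + N.jacobiEndomorphism S X w = 0 := by
  rw [N.isDynamicalSymmetry_iff hS hX]
  refine and_congr_right fun _ => forall₂_congr fun w hw => ?_
  rw [N.nabla_congr (isOpen_slit A) S
    (fun w' hw' => hN.nabla_tangentStructure hS (isOpen_slit A) subset_rfl hX hw') hw]

end NonlinearConnection

/-! ### The canonical nonlinear connection -/

section Canonical

variable {A : LieAlgebroid n m E}

/-- The linear forms `z ↦ V_α(S'^γ) zᵅ + L^γ_{εα} y^ε zᵅ` on `𝒯_w E`, where `S'^γ = dy^γ(S)`. -/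
def canonicalForm (A : LieAlgebroid n m E) (S : A.ProlSection)
    (hs : IsLocalFrameOn (𝓡 n) (FibreModel m) ∞ s U) (γ : Fin m)
    (w : TotalSpace (FibreModel m) E) : A.Prol w →ₗ[ℝ] ℝ :=
  (A.derivLinear (A.coordV hs S γ) w).comp ((A.prolVerticalLinear w).comp
    ((LinearMap.fst ℝ _ _).comp (A.Prol w).subtype)) +
  ∑ α, ∑ β, (A.structureFunction hs γ α β w.proj * fibreCoord hs α w) • A.prolX hs β w

theorem canonicalForm_apply (S : A.ProlSection) (hs : IsLocalFrameOn (𝓡 n) (FibreModel m) ∞ s U)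
    (γ : Fin m) {w : TotalSpace (FibreModel m) E} (z : A.Prol w) :
    A.canonicalForm S hs γ w z = A.derivLinear (A.coordV hs S γ) w (A.prolVertical w z.1.1) +
      ∑ α, ∑ β, A.structureFunction hs γ α β w.proj * fibreCoord hs α w * A.prolX hs β w z := by
  simp only [canonicalForm, LinearMap.add_apply, LinearMap.sum_apply, LinearMap.smul_apply,
    smul_eq_mul]
  rfl

/-- The form depends only on the first component: this makes `canonicalMap` an involution and makes
it -1 on vertical vectors. -/
theorem canonicalForm_congr (S : A.ProlSection) (hs : IsLocalFrameOn (𝓡 n) (FibreModel m) ∞ s U)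
    (γ : Fin m) {w : TotalSpace (FibreModel m) E} {z z' : A.Prol w} (h : z.1.1 = z'.1.1) :
    A.canonicalForm S hs γ w z = A.canonicalForm S hs γ w z' := by
  simp only [canonicalForm_apply, prolX_eq, h]

variable [T2Space M] {S : A.ProlSection}

/-- The local expression of `-ℒ_S J`. -/
theorem IsSemispray.prolV_lieDerivative (hS : A.IsSemispray S) (hU : IsOpen U)
    (hs : IsLocalFrameOn (𝓡 n) (FibreModel m) ∞ s U)
    {Ω : Set (TotalSpace (FibreModel m) E)} (hΩ : IsOpen Ω) (hsub : Ω ⊆ slit) {Z : A.ProlSection}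
    (hZ : A.SmoothOn Z Ω) {w : TotalSpace (FibreModel m) E} (hw : w ∈ Ω)
    (hwU : w.proj ∈ U) (γ : Fin m) :
    A.prolV hs γ w
      (-(A.prolBracket S (A.tangentStructure Z) w - A.tangentStructure (A.prolBracket S Z) w)) =
      A.canonicalForm S hs γ w (Z w) - A.prolV hs γ w (Z w) := by
  rw [map_neg, map_sub, ← coordV_apply, ← coordV_apply, coordV_tangentStructure hU hs _ _ hwU,
    hS.coordX_prolBracket hU hs hΩ hsub hZ hw hwU,
    coordV_prolBracket hU hs hΩ (hS.1.mono hsub) (hZ.tangentStructure hΩ) hw hwU,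
    canonicalForm_apply]
  -- The derivatives S(Z^γ) in [S,JZ] and in J[S,Z] are equal and cancel, so the result depends on Z
  -- only through its value at w.
  have h1 : A.deriv S (A.coordV hs (A.tangentStructure Z) γ) w =
      A.deriv S (A.coordX hs Z γ) w := by
    refine deriv_congr ?_
    filter_upwards [(isOpen_preimage_proj hU).mem_nhds hwU] with w' hw'
    exact coordV_tangentStructure hU hs Z γ hw'
  rw [h1, deriv_eq (A.tangentStructure Z)]
  simp only [← coordX_apply, ← coordV_apply]
  change _ = A.derivLinear (A.coordV hs S γ) w (A.tangentStructure Z w) + _ - _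
  ring

theorem IsSemispray.prolX_lieDerivative (hS : A.IsSemispray S) (hU : IsOpen U)
    (hs : IsLocalFrameOn (𝓡 n) (FibreModel m) ∞ s U)
    {Ω : Set (TotalSpace (FibreModel m) E)} (hΩ : IsOpen Ω) (hsub : Ω ⊆ slit) {Z : A.ProlSection}
    (hZ : A.SmoothOn Z Ω) {w : TotalSpace (FibreModel m) E} (hw : w ∈ Ω)
    (hwU : w.proj ∈ U) (γ : Fin m) :
    A.prolX hs γ w
      (-(A.prolBracket S (A.tangentStructure Z) w - A.tangentStructure (A.prolBracket S Z) w)) =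
      A.prolX hs γ w (Z w) := by
  rw [map_neg, map_sub, ← coordX_apply, ← coordX_apply, coordX_tangentStructure,
    hS.coordX_prolBracket hU hs hΩ hsub (hZ.tangentStructure hΩ) hw hwU,
    coordV_tangentStructure hU hs _ _ hwU]
  have h1 : A.coordX hs (A.tangentStructure Z) γ = fun _ => 0 :=
    funext fun w' => coordX_tangentStructure hs Z γ w'
  rw [h1, deriv_zero]
  simp only [coordX_tangentStructure, mul_zero, Finset.sum_const_zero]
  rw [coordX_apply]
  ring

/-- The canonical nonlinear connection as a linear map on the fibres: in the frame given by the
preferred trivialization at `π w`, it preserves the components `zᵅ` and maps `z'^γ` to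
`canonicalForm γ z - z'^γ`. -/
def canonicalMap (A : LieAlgebroid n m E) (S : A.ProlSection) (w : TotalSpace (FibreModel m) E) :
    A.Prol w →ₗ[ℝ] A.Prol w :=
  LinearMap.id + ∑ γ, (A.canonicalForm S (isLocalFrameOn_trivFrame w.proj) γ w -
    (2 : ℝ) • A.prolV (isLocalFrameOn_trivFrame w.proj) γ w).smulRight
      (A.frameV (trivFrame E w.proj) γ w)

theorem canonicalMap_apply (S : A.ProlSection) {w : TotalSpace (FibreModel m) E} (z : A.Prol w) :
    A.canonicalMap S w z = z + ∑ γ, (A.canonicalForm S (isLocalFrameOn_trivFrame w.proj) γ w z -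
      2 * A.prolV (isLocalFrameOn_trivFrame w.proj) γ w z) •
        A.frameV (trivFrame E w.proj) γ w := by
  simp only [canonicalMap, LinearMap.add_apply, LinearMap.sum_apply, LinearMap.smulRight_apply,
    LinearMap.sub_apply, LinearMap.smul_apply, smul_eq_mul, LinearMap.id_apply]

theorem prolX_canonicalMap (S : A.ProlSection) {w : TotalSpace (FibreModel m) E} (z : A.Prol w)
    (γ : Fin m) : A.prolX (isLocalFrameOn_trivFrame w.proj) γ w (A.canonicalMap S w z) =
      A.prolX (isLocalFrameOn_trivFrame w.proj) γ w z := by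
  rw [canonicalMap_apply]
  simp [frameV, prolX_prolVertical]

theorem prolV_canonicalMap (S : A.ProlSection) {w : TotalSpace (FibreModel m) E} (z : A.Prol w)
    (γ : Fin m) : A.prolV (isLocalFrameOn_trivFrame w.proj) γ w (A.canonicalMap S w z) =
      A.canonicalForm S (isLocalFrameOn_trivFrame w.proj) γ w z -
        A.prolV (isLocalFrameOn_trivFrame w.proj) γ w z := by
  rw [canonicalMap_apply, map_add, prolV_sum_frameV (isOpen_trivFrame w.proj) _ (mem_trivFrame w)]
  ring

theorem canonicalMap_fst (S : A.ProlSection) {w : TotalSpace (FibreModel m) E} (z : A.Prol w) :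
    (A.canonicalMap S w z).1.1 = z.1.1 :=
  eq_of_coeff_eq (isLocalFrameOn_trivFrame w.proj) (mem_trivFrame w) (prolX_canonicalMap S z)

/-- Both sides have the same coordinates in the frame chosen at w. The left one is manifestly a
linear map of fibres, the right one is free of choices. -/
theorem IsSemispray.canonicalMap_eq (hS : A.IsSemispray S)
    {Ω : Set (TotalSpace (FibreModel m) E)} (hΩ : IsOpen Ω) (hsub : Ω ⊆ slit) {Z : A.ProlSection}
    (hZ : A.SmoothOn Z Ω) {w : TotalSpace (FibreModel m) E} (hw : w ∈ Ω) :
    A.canonicalMap S w (Z w) =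
      -(A.prolBracket S (A.tangentStructure Z) w - A.tangentStructure (A.prolBracket S Z) w) := by
  have hU := isOpen_trivFrame (m := m) (E := E) w.proj
  have hs := isLocalFrameOn_trivFrame (n := n) (m := m) (E := E) w.proj
  have hwU := mem_trivFrame w
  refine prol_ext hU hs hwU (fun γ => ?_) fun γ => ?_
  · rw [hS.prolX_lieDerivative hU hs hΩ hsub hZ hw hwU, prolX_canonicalMap]
  · rw [hS.prolV_lieDerivative hU hs hΩ hsub hZ hw hwU, prolV_canonicalMap]

/-- The canonical nonlinear connection of a semispray. -/
def IsSemispray.canonicalConnection (hS : A.IsSemispray S) : A.NonlinearConnection where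
  toFun := A.canonicalMap S
  involutive w _ z := by
    refine prol_ext (isOpen_trivFrame w.proj) (isLocalFrameOn_trivFrame w.proj) (mem_trivFrame w)
      (fun γ => ?_) fun γ => ?_
    · rw [prolX_canonicalMap, prolX_canonicalMap]
    -- Applied twice, z' becomes C(z) - (C(z) - z') = z', since C is unchanged by the map.
    · rw [prolV_canonicalMap, prolV_canonicalMap,
        canonicalForm_congr S _ γ (canonicalMap_fst S z), sub_sub_cancel]
  vertical w _ z := by
    have hs := isLocalFrameOn_trivFrame (n := n) (m := m) (E := E) w.proj
    constructor
    · intro h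
      refine eq_of_coeff_eq hs (mem_trivFrame w) fun γ => ?_
      have h1 := congrArg (A.prolX hs γ w) h
      rw [map_add, prolX_canonicalMap, map_zero, prolX_eq] at h1
      rw [map_zero]
      linarith
    · intro h
      refine prol_ext (isOpen_trivFrame w.proj) hs (mem_trivFrame w) (fun γ => ?_) fun γ => ?_
      · rw [map_add, prolX_canonicalMap, map_zero, prolX_eq_zero hs h, add_zero]
      · rw [map_add, prolV_canonicalMap, canonicalForm_congr S hs γ (z' := 0) h, map_zero, map_zero]
        ring
  -- `canonicalMap` uses a different trivialization at each w, so smoothness is read off from J[S,Z]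
  -- - [S,JZ] instead.
  smooth Ω hΩ hsub Z hZ := by
    refine ((SmoothOn.prolBracket hΩ (hS.1.mono hsub) hZ).tangentStructure hΩ |>.sub hΩ
      (SmoothOn.prolBracket hΩ (hS.1.mono hsub) (hZ.tangentStructure hΩ))).congr fun w hw => ?_
    rw [hS.canonicalMap_eq hΩ hsub hZ hw, neg_sub]
    rfl

theorem IsSemispray.isCanonical_canonicalConnection (hS : A.IsSemispray S) :
    hS.canonicalConnection.IsCanonical S :=
  fun _ hΩ hsub _ hZ _ hw => hS.canonicalMap_eq hΩ hsub hZ hw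

end Canonical

/-! ### The local frame of the prolongation -/

section LocalFrame

variable {A : LieAlgebroid n m E}

theorem mdifferentiableAt_sum_frame (hU : IsOpen U) (hs : IsLocalFrameOn (𝓡 n) (FibreModel m) ∞ s U)
    {x : M} (hx : x ∈ U) (c : Fin m → ℝ) :
    MDifferentiableAt (𝓡 n) (totalModel n m)
      (fun x => (⟨x, ∑ β, c β • s β x⟩ : TotalSpace (FibreModel m) E)) x := by
  have h : ContMDiffOn (𝓡 n) (totalModel n m) ∞
      (fun x => (⟨x, ∑ β, c β • s β x⟩ : TotalSpace (FibreModel m) E)) U :=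
    ContMDiffOn.sum_section fun α _ => (hs.contMDiffOn α).const_smul_section
  exact (h.contMDiffAt (hU.mem_nhds hx)).mdifferentiableAt (by simp)

theorem tangentProj_section (A : LieAlgebroid n m E) {t : ∀ x, E x} {x : M}
    (ht : MDifferentiableAt (𝓡 n) (totalModel n m)
      (fun x => (⟨x, t x⟩ : TotalSpace (FibreModel m) E)) x) (v : TangentSpace (𝓡 n) x) :
    A.tangentProj (⟨x, t x⟩ : TotalSpace (FibreModel m) E)
      (mfderiv (𝓡 n) (totalModel n m)
        (fun x => (⟨x, t x⟩ : TotalSpace (FibreModel m) E)) x v) = v := by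
  have hp : HasMFDerivAt (totalModel n m) (𝓡 n)
      (TotalSpace.proj : TotalSpace (FibreModel m) E → M)
      (⟨x, t x⟩ : TotalSpace (FibreModel m) E) (A.tangentProj ⟨x, t x⟩) :=
    ((contMDiff_proj (n := ∞) E).mdifferentiable (by simp) _).hasMFDerivAt
  have h1 := hp.comp x ht.hasMFDerivAt
  exact congrArg (fun L => L v) (hasMFDerivAt_unique h1 (hasMFDerivAt_id x))

theorem dirD_fibreCoord_sum_frame (hU : IsOpen U)
    (hs : IsLocalFrameOn (𝓡 n) (FibreModel m) ∞ s U) {x : M} (hx : x ∈ U) (c : Fin m → ℝ)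
    (γ : Fin m) (v : TangentSpace (𝓡 n) x) :
    dirD (totalModel n m) (fibreCoord hs γ)
      (⟨x, ∑ β, c β • s β x⟩ : TotalSpace (FibreModel m) E) (mfderiv (𝓡 n) (totalModel n m)
      (fun x => (⟨x, ∑ β, c β • s β x⟩ : TotalSpace (FibreModel m) E)) x v) = 0 := by
  have h1 := dirD_comp (I := totalModel n m) (I' := 𝓡 n) (f := fibreCoord hs γ)
    (g := fun x => (⟨x, ∑ β, c β • s β x⟩ : TotalSpace (FibreModel m) E)) (x := x)
    (mdifferentiableAt_fibreCoord hU hs γ hx) (mdifferentiableAt_sum_frame hU hs hx c)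
  have h2 : dirD (𝓡 n) (fun y => fibreCoord hs γ
      (⟨y, ∑ β, c β • s β y⟩ : TotalSpace (FibreModel m) E)) x = 0 := by
    rw [← dirD_const (I := 𝓡 n) (c γ) x]
    refine dirD_congr ?_
    filter_upwards [hU.mem_nhds hx] with y hy
    exact coeff_sum hs hy c γ
  exact (congrArg (fun L => L v) (h1.symm.trans h2)).trans rfl

theorem frameX_val (hU : IsOpen U) (hs : IsLocalFrameOn (𝓡 n) (FibreModel m) ∞ s U)
    {w : TotalSpace (FibreModel m) E} (hw : w.proj ∈ U) (α : Fin m) :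
    (A.frameX hs α w).1.1 = s α w.proj ∧ ∀ γ, A.prolV hs γ w (A.frameX hs α w) = 0 := by
  have h0 : (⟨w.proj, ∑ β, fibreCoord hs β w • s β w.proj⟩ : TotalSpace (FibreModel m) E) = w := by
    have := sum_coeff_smul hs hw w.2
    exact congrArg (TotalSpace.mk w.proj) this
  set V : TangentSpace (totalModel n m) w :=
    show TangentSpace (totalModel n m)
        (⟨w.proj, ∑ β, fibreCoord hs β w • s β w.proj⟩ : TotalSpace (FibreModel m) E) from
      mfderiv (𝓡 n) (totalModel n m)
        (fun x => (⟨x, ∑ β, fibreCoord hs β w • s β x⟩ : TotalSpace (FibreModel m) E)) w.proj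
        (A.anchor w.proj (s α w.proj)) with hV
  have h1 : A.tangentProj w V = A.anchor w.proj (s α w.proj) := by
    have h := tangentProj_section A (mdifferentiableAt_sum_frame hU hs hw fun β => fibreCoord hs β w)
      (A.anchor w.proj (s α w.proj))
    -- V is a derivative at the point ∑ y^β s_β, which equals w only propositionally. As all tangent
    -- spaces are the same model space, the base point can be generalized and substituted.
    have h3 : ∀ w' : TotalSpace (FibreModel m) E, w' = w →
        (A.tangentProj w' : _ → EuclideanSpace ℝ (Fin n)) V =
        (A.tangentProj w : _ → EuclideanSpace ℝ (Fin n)) V := by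
      rintro w' rfl
      rfl
    exact (h3 _ h0).symm.trans h
  have h2 : ∀ γ, dirD (totalModel n m) (fibreCoord hs γ) w V = 0 := fun γ => by
    have h := dirD_fibreCoord_sum_frame hU hs hw (fun β => fibreCoord hs β w) γ
      (A.anchor w.proj (s α w.proj))
    have h3 : ∀ w' : TotalSpace (FibreModel m) E, w' = w →
        (dirD (totalModel n m) (fibreCoord hs γ) w' : _ → ℝ) V =
        (dirD (totalModel n m) (fibreCoord hs γ) w : _ → ℝ) V := by
      rintro w' rfl
      rfl
    exact (h3 _ h0).symm.trans h
  have h3 : (A.frameX hs α w).1 = (s α w.proj, V) := toProl_of_mem h1.symm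
  refine ⟨congrArg Prod.fst h3, fun γ => ?_⟩
  rw [prolV_eq, h3]
  exact h2 γ

theorem prolX_frameX (hU : IsOpen U) (hs : IsLocalFrameOn (𝓡 n) (FibreModel m) ∞ s U)
    {w : TotalSpace (FibreModel m) E} (hw : w.proj ∈ U) (α β : Fin m) :
    A.prolX hs α w (A.frameX hs β w) = if β = α then 1 else 0 := by
  rw [prolX_eq, (frameX_val hU hs hw β).1, coeff_frame hs hw]

theorem prolV_frameV (hU : IsOpen U) (hs : IsLocalFrameOn (𝓡 n) (FibreModel m) ∞ s U)
    {w : TotalSpace (FibreModel m) E} (hw : w.proj ∈ U) (α β : Fin m) :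
    A.prolV hs α w (A.frameV s β w) = if β = α then 1 else 0 := by
  change A.prolV hs α w (A.prolVertical w _) = _
  rw [prolV_prolVertical hU hs α hw, coeff_frame hs hw]

theorem smoothOn_frameX (hU : IsOpen U) (hs : IsLocalFrameOn (𝓡 n) (FibreModel m) ∞ s U)
    {Ω : Set (TotalSpace (FibreModel m) E)} (hΩ : IsOpen Ω) (hΩU : ∀ w ∈ Ω, w.proj ∈ U)
    (β : Fin m) : A.SmoothOn (A.frameX hs β) Ω := by
  refine (smoothOn_iff hU hs hΩ hΩU).2 ⟨fun α => ?_, fun α => ?_⟩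
  · have h : ContMDiffOn (totalModel n m) 𝓘(ℝ, ℝ) ∞ (fun _ => if β = α then (1 : ℝ) else 0) Ω :=
      contMDiffOn_const
    exact h.congr fun w hw => prolX_frameX hU hs (hΩU w hw) α β
  · have h : ContMDiffOn (totalModel n m) 𝓘(ℝ, ℝ) ∞ (fun _ => (0 : ℝ)) Ω := contMDiffOn_const
    exact h.congr fun w hw => (frameX_val hU hs (hΩU w hw) β).2 α

theorem smoothOn_frameV (hU : IsOpen U) (hs : IsLocalFrameOn (𝓡 n) (FibreModel m) ∞ s U)
    {Ω : Set (TotalSpace (FibreModel m) E)} (hΩ : IsOpen Ω) (hΩU : ∀ w ∈ Ω, w.proj ∈ U)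
    (β : Fin m) : A.SmoothOn (A.frameV s β) Ω := by
  refine (smoothOn_iff hU hs hΩ hΩU).2 ⟨fun α => ?_, fun α => ?_⟩
  · have h : ContMDiffOn (totalModel n m) 𝓘(ℝ, ℝ) ∞ (fun _ => (0 : ℝ)) Ω := contMDiffOn_const
    exact h.congr fun w _ => prolX_prolVertical (A := A) hs α w (s β w.proj)
  · have h : ContMDiffOn (totalModel n m) 𝓘(ℝ, ℝ) ∞ (fun _ => if β = α then (1 : ℝ) else 0) Ω :=
      contMDiffOn_const
    exact h.congr fun w hw => prolV_frameV (A := A) hU hs (hΩU w hw) α β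

theorem prol_eq_sum (hU : IsOpen U) (hs : IsLocalFrameOn (𝓡 n) (FibreModel m) ∞ s U)
    {w : TotalSpace (FibreModel m) E} (hw : w.proj ∈ U) (z : A.Prol w) :
    z = ∑ β, A.prolX hs β w z • A.frameX hs β w + ∑ β, A.prolV hs β w z • A.frameV s β w := by
  refine prol_ext hU hs hw (fun α => ?_) fun α => ?_
  · simp [prolX_frameX hU hs hw, frameV, prolX_prolVertical]
  · rw [map_add, prolV_sum_frameV hU hs hw]
    simp [(frameX_val hU hs hw _).2]

end LocalFrame

/-! ### Local expressions for the canonical connection -/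

namespace NonlinearConnection

variable {A : LieAlgebroid n m E} (N : A.NonlinearConnection) {S : A.ProlSection}

/-- The vertical projector on the fibre `𝒯_w E`. -/
def verAt (w : TotalSpace (FibreModel m) E) : A.Prol w →ₗ[ℝ] A.Prol w :=
  (1 / 2 : ℝ) • (LinearMap.id - N.toFun w)

theorem ver_eq_verAt (Z : A.ProlSection) (w : TotalSpace (FibreModel m) E) :
    N.ver Z w = N.verAt w (Z w) := rfl

theorem nablaLocal_congr (S : A.ProlSection) (hs : IsLocalFrameOn (𝓡 n) (FibreModel m) ∞ s U)
    {f g : Fin m → TotalSpace (FibreModel m) E → ℝ} {Ω : Set (TotalSpace (FibreModel m) E)}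
    (hΩ : IsOpen Ω) (h : ∀ β, ∀ w ∈ Ω, f β w = g β w) {w : TotalSpace (FibreModel m) E}
    (hw : w ∈ Ω) (α : Fin m) : N.nablaLocal S hs f α w = N.nablaLocal S hs g α w := by
  unfold nablaLocal
  have h1 : A.deriv S (f α) w = A.deriv S (g α) w :=
    deriv_congr (by filter_upwards [hΩ.mem_nhds hw] with w' hw' using h α w' hw')
  rw [h1]
  simp only [h _ w hw]

variable [T2Space M]

/-- Φ is tensorial: the Leibniz terms S(f) vZ from v[S,fZ] and from v[S,v(fZ)] cancel because v² =
v. -/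
theorem jacobiEndomorphism_sum_smul {ι : Type} [Fintype ι]
    {Ω : Set (TotalSpace (FibreModel m) E)} (hΩ : IsOpen Ω) (hsub : Ω ⊆ slit)
    (hS : A.SmoothOn S Ω) {f : ι → TotalSpace (FibreModel m) E → ℝ} {Z : ι → A.ProlSection}
    (hf : ∀ i, ContMDiffOn (totalModel n m) 𝓘(ℝ, ℝ) ∞ (f i) Ω) (hZ : ∀ i, A.SmoothOn (Z i) Ω)
    {w : TotalSpace (FibreModel m) E} (hw : w ∈ Ω) :
    N.jacobiEndomorphism S (fun w' => ∑ i, f i w' • Z i w') w =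
      ∑ i, f i w • N.jacobiEndomorphism S (Z i) w := by
  have h1 : A.prolBracket S (N.ver fun w' => ∑ i, f i w' • Z i w') w =
      ∑ i, (f i w • A.prolBracket S (N.ver (Z i)) w + A.deriv S (f i) w • N.ver (Z i) w) := by
    rw [← prolBracket_sum_smul hΩ hS hf (fun i => N.smoothOn_ver hΩ hsub (hZ i)) hw]
    refine prolBracket_congr hΩ (fun _ _ => rfl) (fun w' _ => ?_) hw
    simp only [ver_eq_verAt, map_sum, map_smul]
  have h2 : ∀ i, N.verAt w (N.ver (Z i) w) = N.ver (Z i) w := fun i =>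
    N.ver_of_vertical (hsub hw) (N.ver_fst (hsub hw) (Z i))
  simp only [N.jacobiEndomorphism_eq S _ (hsub hw)]
  rw [ver_eq_verAt, ver_eq_verAt, h1, prolBracket_sum_smul hΩ hS hf hZ hw]
  simp only [map_sum, map_add, map_smul, h2, ← Finset.sum_sub_distrib]
  refine Finset.sum_congr rfl fun i _ => ?_
  rw [smul_sub, ver_eq_verAt N (Z i), ver_eq_verAt N (A.prolBracket S (Z i)),
    ver_eq_verAt N (A.prolBracket S (N.ver (Z i)))]
  abel

theorem jacobiEndomorphism_of_vertical {Ω : Set (TotalSpace (FibreModel m) E)} (hΩ : IsOpen Ω)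
    (hsub : Ω ⊆ slit) {V : A.ProlSection} (hV : ∀ w ∈ Ω, (V w).1.1 = 0)
    {w : TotalSpace (FibreModel m) E} (hw : w ∈ Ω) : N.jacobiEndomorphism S V w = 0 := by
  rw [N.jacobiEndomorphism_eq S V (hsub hw), sub_eq_zero]
  exact N.ver_congr (prolBracket_congr hΩ (fun _ _ => rfl)
    (fun w' hw' => (N.ver_of_vertical (hsub hw') (hV w' hw')).symm) hw)

/-- Expand X in the frame 𝒳, 𝒱 and use tensoriality; the 𝒱 terms disappear because Φ kills vertical
sections. -/
theorem prolV_jacobiEndomorphism (hS : A.IsSemispray S) (hU : IsOpen U)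
    (hs : IsLocalFrameOn (𝓡 n) (FibreModel m) ∞ s U) {Ω : Set (TotalSpace (FibreModel m) E)}
    (hΩ : IsOpen Ω) (hsub : Ω ⊆ slit) (hΩU : ∀ w ∈ Ω, w.proj ∈ U) {X : A.ProlSection}
    (hX : A.SmoothOn X Ω) {w : TotalSpace (FibreModel m) E} (hw : w ∈ Ω) (α : Fin m) :
    A.prolV hs α w (N.jacobiEndomorphism S X w) =
      ∑ β, N.jacobiCoefficient S hs α β w * A.coordX hs X β w := by
  obtain ⟨hXX, hXV⟩ := (smoothOn_iff hU hs hΩ hΩU).1 hX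
  have h1 := N.jacobiEndomorphism_sum_smul (ι := Fin m ⊕ Fin m) hΩ hsub (hS.1.mono hsub)
    (f := Sum.elim (A.coordX hs X) (A.coordV hs X))
    (Z := Sum.elim (A.frameX hs) (A.frameV s)) (Sum.rec hXX hXV)
    (Sum.rec (smoothOn_frameX hU hs hΩ hΩU) (smoothOn_frameV hU hs hΩ hΩU)) hw
  have h2 : N.jacobiEndomorphism S X w = _ :=
    (N.jacobiEndomorphism_congr hΩ S (fun w' hw' => ?_) hw).trans h1
  · rw [h2]
    simp only [Fintype.sum_sum_type, Sum.elim_inl, Sum.elim_inr,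
      N.jacobiEndomorphism_of_vertical hΩ hsub (V := A.frameV s _) (fun _ _ => rfl) hw, smul_zero,
      Finset.sum_const_zero, add_zero, map_sum, map_smul, smul_eq_mul]
    exact Finset.sum_congr rfl fun β _ => mul_comm _ _
  · rw [Fintype.sum_sum_type]
    exact prol_eq_sum hU hs (hΩU w' hw') (X w')

variable {N}

theorem IsCanonical.prolV_toFun (hN : N.IsCanonical S) (hS : A.IsSemispray S) (hU : IsOpen U)
    (hs : IsLocalFrameOn (𝓡 n) (FibreModel m) ∞ s U) {Ω : Set (TotalSpace (FibreModel m) E)}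
    (hΩ : IsOpen Ω) (hsub : Ω ⊆ slit) (hΩU : ∀ w ∈ Ω, w.proj ∈ U) {Z : A.ProlSection}
    (hZ : A.SmoothOn Z Ω) {w : TotalSpace (FibreModel m) E} (hw : w ∈ Ω) (γ : Fin m) :
    A.prolV hs γ w (N.toFun w (Z w)) =
      A.canonicalForm S hs γ w (Z w) - A.prolV hs γ w (Z w) := by
  rw [hN Ω hΩ hsub Z hZ w hw, hS.prolV_lieDerivative hU hs hΩ hsub hZ hw (hΩU w hw)]

/-- The vertical coordinates of 𝒳_β are zero, so those of 𝒩(𝒳_β) are the canonical form alone. This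
links derivatives of S to the coefficients 𝒩_β^γ. -/
theorem IsCanonical.canonicalForm_frameX (hN : N.IsCanonical S) (hS : A.IsSemispray S)
    (hU : IsOpen U) (hs : IsLocalFrameOn (𝓡 n) (FibreModel m) ∞ s U)
    {Ω : Set (TotalSpace (FibreModel m) E)}
    (hΩ : IsOpen Ω) (hsub : Ω ⊆ slit) (hΩU : ∀ w ∈ Ω, w.proj ∈ U)
    {w : TotalSpace (FibreModel m) E} (hw : w ∈ Ω) (γ β : Fin m) :
    A.canonicalForm S hs γ w (A.frameX hs β w) = -2 * N.coefficient hs γ β w := by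
  have h := hN.prolV_toFun hS hU hs hΩ hsub hΩU (smoothOn_frameX hU hs hΩ hΩU β) hw γ
  rw [(frameX_val hU hs (hΩU w hw) β).2, sub_zero] at h
  rw [← h]
  change _ = -2 * (-(1 / 2) * A.prolV hs γ w (N.toFun w (A.frameX hs β w)))
  ring

theorem canonicalForm_eq_sum (hU : IsOpen U) (hs : IsLocalFrameOn (𝓡 n) (FibreModel m) ∞ s U)
    {w : TotalSpace (FibreModel m) E} (hw : w.proj ∈ U) (γ : Fin m) (z : A.Prol w) :
    A.canonicalForm S hs γ w z =
      ∑ β, A.prolX hs β w z * A.canonicalForm S hs γ w (A.frameX hs β w) := by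
  have h : A.canonicalForm S hs γ w z =
      A.canonicalForm S hs γ w (∑ β, A.prolX hs β w z • A.frameX hs β w) := by
    refine canonicalForm_congr S hs γ (eq_of_coeff_eq hs hw fun α => ?_)
    change A.prolX hs α w z = A.prolX hs α w _
    simp [prolX_frameX hU hs hw]
  rw [h]
  simp only [map_sum, map_smul, smul_eq_mul]

/-- The dynamical covariant derivative of a vertical section in local coordinates. -/
theorem IsCanonical.prolV_nabla (hN : N.IsCanonical S) (hS : A.IsSemispray S) (hU : IsOpen U)
    (hs : IsLocalFrameOn (𝓡 n) (FibreModel m) ∞ s U) {Ω : Set (TotalSpace (FibreModel m) E)}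
    (hΩ : IsOpen Ω) (hsub : Ω ⊆ slit) (hΩU : ∀ w ∈ Ω, w.proj ∈ U) {Y : A.ProlSection}
    (hY : A.SmoothOn Y Ω) (hv : ∀ w ∈ Ω, (Y w).1.1 = 0)
    {w : TotalSpace (FibreModel m) E} (hw : w ∈ Ω) (γ : Fin m) :
    A.prolV hs γ w (N.nabla S Y w) = N.nablaLocal S hs (A.coordV hs Y) γ w := by
  have hB := SmoothOn.prolBracket hΩ (hS.1.mono hsub) hY
  have hwU := hΩU w hw
  have h1 : ∀ β, A.prolX hs β w (A.prolBracket S Y w) = -A.coordV hs Y β w := fun β => by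
    rw [coordV_apply, ← map_neg, ← hS.tangentStructure_prolBracket hΩ hsub hY hv hw,
      ← coordV_apply, coordV_tangentStructure hU hs _ _ hwU, coordX_apply]
  -- Solving the formula for the canonical form of 𝒳_β for the derivative: 𝒱_β(S'^γ) = -2𝒩_β^γ - y^ε
  -- L^γ_{εβ}.
  have h2 : A.deriv Y (A.coordV hs S γ) w = ∑ β, A.coordV hs Y β w *
      (-2 * N.coefficient hs γ β w -
        ∑ ε, fibreCoord hs ε w * A.structureFunction hs γ ε β w.proj) := by
    rw [deriv_eq, eq_sum_frameV hU hs hwU (hv w hw), map_sum]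
    refine Finset.sum_congr rfl fun β _ => ?_
    rw [map_smul, smul_eq_mul, ← hN.canonicalForm_frameX hS hU hs hΩ hsub hΩU hw,
      canonicalForm_apply, (frameX_val hU hs hwU β).1]
    simp only [prolX_frameX hU hs hwU, mul_ite, mul_one, mul_zero, Finset.sum_ite_eq,
      Finset.mem_univ, if_true]
    simp only [mul_comm (fibreCoord hs _ w), add_sub_cancel_right]
    rfl
  rw [N.nabla_of_vertical hΩ hsub (hS.1.mono hsub) hv hw]
  -- The coordinate is S(Y^γ) - Y(S'^γ) minus half the canonical form of [S,Y]. As [S,Y] has first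
  -- components -Y^β, that half is 𝒩_β^γ Y^β, which reduces the coefficient 2𝒩 coming from `h2` to
  -- 𝒩.
  change A.prolV hs γ w ((1 / 2 : ℝ) • (A.prolBracket S Y w - N.toFun w (A.prolBracket S Y w))) = _
  rw [map_smul, map_sub, hN.prolV_toFun hS hU hs hΩ hsub hΩU hB hw,
    canonicalForm_eq_sum hU hs hwU, ← coordV_apply,
    coordV_prolBracket hU hs hΩ (hS.1.mono hsub) hY hw hwU, h2]
  simp only [h1, hN.canonicalForm_frameX hS hU hs hΩ hsub hΩU hw, nablaLocal, smul_eq_mul]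
  have h3 : ∑ β, -A.coordV hs Y β w * (-2 * N.coefficient hs γ β w) =
      2 * ∑ β, A.coordV hs Y β w * N.coefficient hs γ β w := by
    rw [Finset.mul_sum]
    exact Finset.sum_congr rfl fun β _ => by ring
  rw [h3]
  simp only [mul_sub, add_mul, Finset.sum_sub_distrib, Finset.sum_add_distrib]
  have h4 : ∑ β, A.coordV hs Y β w * (-2 * N.coefficient hs γ β w) =
      -2 * ∑ β, A.coordV hs Y β w * N.coefficient hs γ β w := by
    rw [Finset.mul_sum]
    exact Finset.sum_congr rfl fun β _ => by ring
  rw [h4]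
  simp only [mul_comm (A.coordV hs Y _ w)]
  ring

theorem nabla_fst_of_vertical {Ω : Set (TotalSpace (FibreModel m) E)} (hΩ : IsOpen Ω)
    (hsub : Ω ⊆ slit) (hS : A.SmoothOn S Ω) {Y : A.ProlSection} (hY : ∀ w ∈ Ω, (Y w).1.1 = 0)
    {w : TotalSpace (FibreModel m) E} (hw : w ∈ Ω) : (N.nabla S Y w).1.1 = 0 := by
  rw [N.nabla_of_vertical hΩ hsub hS hY hw, N.ver_fst (hsub hw)]

theorem smoothOn_nabla_of_vertical {Ω : Set (TotalSpace (FibreModel m) E)} (hΩ : IsOpen Ω)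
    (hsub : Ω ⊆ slit) (hS : A.SmoothOn S Ω) {Y : A.ProlSection} (hY : ∀ w ∈ Ω, (Y w).1.1 = 0)
    (hYs : A.SmoothOn Y Ω) : A.SmoothOn (N.nabla S Y) Ω :=
  (N.smoothOn_ver hΩ hsub (SmoothOn.prolBracket hΩ hS hYs)).congr fun _ hw =>
    N.nabla_of_vertical hΩ hsub hS hY hw

theorem IsCanonical.nabla_nabla_add_jacobiEndomorphism (hN : N.IsCanonical S)
    (hS : A.IsSemispray S) (hU : IsOpen U) (hs : IsLocalFrameOn (𝓡 n) (FibreModel m) ∞ s U)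
    {X : A.ProlSection} (hX : A.SmoothOn X slit) {w : TotalSpace (FibreModel m) E}
    (hw : w ∈ slit) (hwU : w.proj ∈ U) :
    N.nabla S (N.nabla S (A.tangentStructure X)) w + N.jacobiEndomorphism S X w =
      ∑ α, N.symmetryEquation S X hs α w • A.frameV s α w := by
  set Ω : Set (TotalSpace (FibreModel m) E) := slit ∩ {w | w.proj ∈ U} with hΩd
  have hΩ : IsOpen Ω := (isOpen_slit A).inter (isOpen_preimage_proj hU)
  have hsub : Ω ⊆ slit := Set.inter_subset_left
  have hΩU : ∀ w ∈ Ω, w.proj ∈ U := fun w hw => hw.2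
  have hwΩ : w ∈ Ω := ⟨hw, hwU⟩
  have hSΩ := hS.1.mono hsub
  have hJ : ∀ w ∈ Ω, (A.tangentStructure X w).1.1 = 0 := fun _ _ => rfl
  have hJs := (hX.mono hsub).tangentStructure hΩ
  have hY : ∀ w ∈ Ω, (N.nabla S (A.tangentStructure X) w).1.1 = 0 := fun w hw =>
    nabla_fst_of_vertical hΩ hsub hSΩ hJ hw
  have hYs := smoothOn_nabla_of_vertical (N := N) hΩ hsub hSΩ hJ hJs
  have h1 : (N.nabla S (N.nabla S (A.tangentStructure X)) w +
      N.jacobiEndomorphism S X w).1.1 = 0 := by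
    change (N.nabla S _ w).1.1 + (N.jacobiEndomorphism S X w).1.1 = 0
    rw [nabla_fst_of_vertical hΩ hsub hSΩ hY hwΩ, N.jacobiEndomorphism_fst S X hw, add_zero]
  rw [eq_sum_frameV hU hs hwU h1]
  refine Finset.sum_congr rfl fun α _ => ?_
  rw [map_add, hN.prolV_nabla hS hU hs hΩ hsub hΩU hYs hY hwΩ,
    N.prolV_jacobiEndomorphism hS hU hs hΩ hsub hΩU (hX.mono hsub) hwΩ]
  congr 2
  -- The outer operator differentiates, so the inner coordinates must be identified on all of Ω and
  -- not only at w.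
  refine N.nablaLocal_congr S hs hΩ (fun β w' hw' => ?_) hwΩ α
  refine (hN.prolV_nabla hS hU hs hΩ hsub hΩU hJs hJ hw' β).trans ?_
  exact N.nablaLocal_congr S hs hΩ
    (fun δ w'' hw'' => coordV_tangentStructure hU hs X δ (hΩU w'' hw'')) hw' β

theorem IsCanonical.isDynamicalSymmetry_iff_symmetryEquation (hN : N.IsCanonical S)
    (hS : A.IsSemispray S) {X : A.ProlSection} (hX : A.SmoothOn X slit) :
    A.IsDynamicalSymmetry S X ↔ A.IsNewtonoid S X ∧
      ∀ (U : Set M) (s : Fin m → ∀ x, E x) (_ : IsOpen U)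
        (hs : IsLocalFrameOn (𝓡 n) (FibreModel m) ∞ s U),
        ∀ w ∈ slit (m := m), w.proj ∈ U → ∀ α, N.symmetryEquation S X hs α w = 0 := by
  rw [hN.isDynamicalSymmetry_iff hS hX]
  refine and_congr_right fun _ => ⟨fun h U s hU hs w hw hwU α => ?_, fun h w hw => ?_⟩
  · rw [← prolV_sum_frameV (A := A) hU hs hwU (fun α => N.symmetryEquation S X hs α w) α,
      ← hN.nabla_nabla_add_jacobiEndomorphism hS hU hs hX hw hwU, h w hw, map_zero]
  -- For the converse one frame around each point suffices, here the one of the preferred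
  -- trivialization.
  · rw [hN.nabla_nabla_add_jacobiEndomorphism hS (isOpen_trivFrame w.proj)
      (isLocalFrameOn_trivFrame w.proj) hX hw (mem_trivFrame w)]
    refine Finset.sum_eq_zero fun α _ => ?_
    rw [h _ _ (isOpen_trivFrame w.proj) (isLocalFrameOn_trivFrame w.proj) w hw (mem_trivFrame w),
      zero_smul]

end NonlinearConnection

end LieAlgebroid

end

theorem proposition14 {n m : ℕ} {M : Type*} [TopologicalSpace M] [T2Space M]
    [ChartedSpace (EuclideanSpace ℝ (Fin n)) M] [IsManifold (𝓡 n) ∞ M]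
    {E : M → Type*} [∀ x, AddCommGroup (E x)] [∀ x, Module ℝ (E x)]
    [∀ x, TopologicalSpace (E x)] [TopologicalSpace (TotalSpace (FibreModel m) E)]
    [FiberBundle (FibreModel m) E] [VectorBundle ℝ (FibreModel m) E]
    [ContMDiffVectorBundle ∞ (FibreModel m) E (𝓡 n)]
    (A : LieAlgebroid n m E) (S : A.ProlSection) (hS : A.IsSemispray S) :
    -- the invariant equation for an arbitrary nonlinear connection
    (∀ (N : A.NonlinearConnection) (X : A.ProlSection), A.SmoothOn X LieAlgebroid.slit →
      (A.IsDynamicalSymmetry S X ↔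
        A.IsNewtonoid S X ∧ ∀ w ∈ LieAlgebroid.slit (m := m),
          N.nabla S (A.tangentStructure (N.nabla S X)) w + N.jacobiEndomorphism S X w = 0)) ∧
    -- the canonical nonlinear connection exists
    (∃ N : A.NonlinearConnection, N.IsCanonical S) ∧
    -- the invariant and the local equation for the canonical nonlinear connection
    (∀ N : A.NonlinearConnection, N.IsCanonical S →
      ∀ X : A.ProlSection, A.SmoothOn X LieAlgebroid.slit →
        (A.IsDynamicalSymmetry S X ↔
          A.IsNewtonoid S X ∧ ∀ w ∈ LieAlgebroid.slit (m := m),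
            N.nabla S (N.nabla S (A.tangentStructure X)) w + N.jacobiEndomorphism S X w = 0) ∧
        (∀ (U : Set M) (s : Fin m → ∀ x, E x) (_ : IsOpen U)
          (hs : IsLocalFrameOn (𝓡 n) (FibreModel m) ∞ s U),
          ∀ w ∈ LieAlgebroid.slit (m := m), w.proj ∈ U →
            N.nabla S (N.nabla S (A.tangentStructure X)) w + N.jacobiEndomorphism S X w =
              ∑ α, N.symmetryEquation S X hs α w • A.frameV s α w) ∧
        (A.IsDynamicalSymmetry S X ↔
          A.IsNewtonoid S X ∧
            ∀ (U : Set M) (s : Fin m → ∀ x, E x) (_ : IsOpen U)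
              (hs : IsLocalFrameOn (𝓡 n) (FibreModel m) ∞ s U),
              ∀ w ∈ LieAlgebroid.slit (m := m), w.proj ∈ U →
                ∀ α, N.symmetryEquation S X hs α w = 0)) := by
  refine ⟨fun N X hX => N.isDynamicalSymmetry_iff hS hX,
    ⟨hS.canonicalConnection, hS.isCanonical_canonicalConnection⟩, fun N hN X hX =>
    ⟨hN.isDynamicalSymmetry_iff hS hX, fun U s hU hs w hw hwU =>
      hN.nabla_nabla_add_jacobiEndomorphism hS hU hs hX hw hwU,
      hN.isDynamicalSymmetry_iff_symmetryEquation hS hX⟩⟩
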